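/- Let $\mathbb T=\mathbb R/2\pi\mathbb Z$, $\langle n\rangle=(1+n^2)^{1/2}$, $\varphi(n)=\frac{n}{1+n^2}$, and let $S(t)=e^{-it\varphi(D_x)}$ be the Fourier multiplier operator on periodic distributions with symbol $e^{-it\varphi(n)}$, $n\in\mathbb Z$. For $s\in\mathbb R$ let $W^{s,\infty}(\mathbb T)$ be the space of periodic distributions $u$ with $\langle\partial_x\rangle^s u\in L^\infty(\mathbb T)$, with norm $\|u\|_{W^{s,\infty}}=\|\langle\partial_x\rangle^s u\|_{L^\infty}$. For a periodic distribution $u$ put $$\mathcal N(u)=\sum_{n\ne0}\varphi(n)e^{inx}\sum_{n_1+n_2=n}\widehat u(n_1)\widehat u(n_2)$$ whenever the inner sums converge as limits of the sums over $|n_1|\le M$, $M\to\infty$. Let $(g_n)_{n\in\mathbb Z}$ be random variables on a probability space $(\Omega,\mathcal F,\mathbb P)$ such that $g_0,g_1,g_2,\dots$ are independent, $g_n$ is a standard complex Gaussian for $n\ge1$, $g_0$ is a standard real Gaussian, and $g_{-n}=\overline{g_n}$ almost surely for every $n$. Let $$u_0^\omega=\sum_{n\in\mathbb Z}\frac{g_n(\omega)}{\langle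 n\rangle^\alpha}e^{inx},\qquad z(t)=S(t)u_0^\omega .$$ A mollification kernel is a continuous function $\rho:\mathbb R\to[0,\infty)$ vanishing outside $(-\pi,\pi]$ with $\int_{\mathbb R}\rho\,dx=1$; put $\rho_k(x)=k\rho(kx)$ and $z_k(t)=S(t)(u_0^\omega*\rho_k)$, where $(u*\rho_k)(x)=\int u(x-y)\rho_k(y)\,dy$. **Proposition.** Let $\frac14<\alpha\le\frac12$, $s_1<\alpha-\frac12$ and $s_2<2\alpha$. (1) For every $T>0$, almost surely the sums defining $\mathcal N(z(t))$ converge for all $t\in[0,T]$, and $$(z,\mathcal N(z))\in X_T:=C([0,T];W^{s_1,\infty}(\mathbb T))\times C([0,T];W^{s_2,\infty}(\mathbb T));$$ moreover $(z,\mathcal N(z))\in L^q(\Omega;X_T)$ for every $1\le q<\infty$. (2) For every $T>0$ and every mollification kernel $\rho$, almost surely, for all $k$, the sums defining $\mathcal N(z_k(t))$ converge for all $t\in[0,T]$ and $(z_k,\mathcal N(z_k))\in X_T$; and $$(z_k,\mathcal N(z_k))\longrightarrow(z,\mathcal N(z))\qquad(k\to\infty)$$ almost surely in $X_T$ and in $L^q(\Omega;X_T)$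 for every $1\le q<\infty$. The limit is thus the same for all $\rho$. The same holds, with the same limit, if $u_0^\omega*\rho_k$ is replaced by the Dirichlet projection of $u_0^\omega$ onto the frequencies $|n|\le k$. (3) There exist $C,C',c>0$ such that for all $T>0$ and $\lambda>0$ $$\mathbb P\Big(\|z\|_{C([0,T];W^{s_1,\infty})}+\|\mathcal N(z)\|_{C([0,T];W^{s_2,\infty})}>\lambda\Big)\le C'\big(e^{-C\lambda/T^{c}}+e^{-C\lambda}\big).$$ -/

import Mathlib

open MeasureTheory ProbabilityTheory Filter Topology
open scoped ENNReal

noncomputable section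

namespace BBM

/-! ### Function spaces on the torus `𝕋 = ℝ / 2πℤ`

A periodic distribution is represented by its sequence of Fourier coefficients `u : ℤ → ℂ`,
that is, `u` stands for `∑ₙ u n * exp (i n x)`. -/

instance instFactTwoPi : Fact (0 < 2 * Real.pi) := ⟨Real.two_pi_pos⟩

/-- The torus `ℝ / 2πℤ`. -/
abbrev Torus : Type := AddCircle (2 * Real.pi)

/-- `L^∞(𝕋)`, complex valued. -/
abbrev LInfty : Type := Lp ℂ ∞ (AddCircle.haarAddCircle : Measure Torus)

/-- The Japanese bracket `⟨n⟩ = (1 + n²)^{1/2}`. -/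
def japanese (n : ℤ) : ℝ := Real.sqrt (1 + (n : ℝ) ^ 2)

lemma japanese_pos (n : ℤ) : 0 < japanese n := Real.sqrt_pos.mpr (by positivity)

/-- `h ∈ L^∞(𝕋)` is the function `⟨∂ₓ⟩^s u`. -/
def IsBesselPotential (s : ℝ) (u : ℤ → ℂ) (h : LInfty) : Prop :=
  ∀ n : ℤ, fourierCoeff (h : Torus → ℂ) n = ((japanese n ^ s : ℝ) : ℂ) * u n

lemma integrable_linfty (h : LInfty) :
    Integrable (h : Torus → ℂ) (AddCircle.haarAddCircle : Measure Torus) :=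
  (Lp.memLp h).integrable le_top

lemma linfty_ext {h₁ h₂ : LInfty}
    (H : ∀ n : ℤ, fourierCoeff (h₁ : Torus → ℂ) n = fourierCoeff (h₂ : Torus → ℂ) n) :
    h₁ = h₂ := by
  have m₁ : MemLp (h₁ : Torus → ℂ) 2 (AddCircle.haarAddCircle : Measure Torus) :=
    (Lp.memLp h₁).mono_exponent le_top
  have m₂ : MemLp (h₂ : Torus → ℂ) 2 (AddCircle.haarAddCircle : Measure Torus) :=
    (Lp.memLp h₂).mono_exponent le_top
  have key : m₁.toLp _ = m₂.toLp _ := by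
    apply (fourierBasis (T := 2 * Real.pi)).repr.injective
    ext n
    rw [fourierBasis_repr, fourierBasis_repr, fourierCoeff_congr_ae m₁.coeFn_toLp,
      fourierCoeff_congr_ae m₂.coeFn_toLp, H n]
  exact Lp.ext ((MemLp.toLp_eq_toLp_iff m₁ m₂).mp key)

lemma IsBesselPotential.unique {s : ℝ} {u : ℤ → ℂ} {h₁ h₂ : LInfty}
    (H₁ : IsBesselPotential s u h₁) (H₂ : IsBesselPotential s u h₂) : h₁ = h₂ :=
  linfty_ext fun n => (H₁ n).trans (H₂ n).symm

lemma IsBesselPotential.add {s : ℝ} {u v : ℤ → ℂ} {h k : LInfty}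
    (hu : IsBesselPotential s u h) (hv : IsBesselPotential s v k) :
    IsBesselPotential s (u + v) (h + k) := by
  intro n
  rw [fourierCoeff_congr_ae (Lp.coeFn_add h k),
    fourierCoeff.add (integrable_linfty h) (integrable_linfty k), Pi.add_apply, hu n, hv n,
    Pi.add_apply, mul_add]

lemma IsBesselPotential.smul {s : ℝ} {u : ℤ → ℂ} {h : LInfty} (c : ℂ)
    (hu : IsBesselPotential s u h) : IsBesselPotential s (c • u) (c • h) := by
  intro n
  rw [fourierCoeff_congr_ae (Lp.coeFn_smul c h), fourierCoeff.const_smul, hu n]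
  simp only [Pi.smul_apply, smul_eq_mul]
  ring

lemma IsBesselPotential.zero (s : ℝ) : IsBesselPotential s 0 0 := by
  have h := IsBesselPotential.smul (s := s) (u := fun n => (((japanese n ^ s : ℝ) : ℂ))⁻¹ *
    fourierCoeff ((0 : LInfty) : Torus → ℂ) n) (h := 0) 0 (fun n => by
      have : ((japanese n ^ s : ℝ) : ℂ) ≠ 0 :=
        Complex.ofReal_ne_zero.mpr (Real.rpow_pos_of_pos (japanese_pos n) s).ne'
      field_simp)
  simpa using h

/-- The distributions `u` on `𝕋` with `⟨∂ₓ⟩^s u ∈ L^∞(𝕋)`, as a vector space. -/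
def sobolevSubmodule (s : ℝ) : Submodule ℂ (ℤ → ℂ) where
  carrier := {u | ∃ h : LInfty, IsBesselPotential s u h}
  add_mem' := fun ⟨h, hu⟩ ⟨k, hv⟩ => ⟨h + k, hu.add hv⟩
  zero_mem' := ⟨0, IsBesselPotential.zero s⟩
  smul_mem' := fun c _ ⟨h, hu⟩ => ⟨c • h, hu.smul c⟩

/-- The Sobolev space `W^{s,∞}(𝕋) = {u : ⟨∂ₓ⟩^s u ∈ L^∞(𝕋)}`. -/
def SobolevInfty (s : ℝ) : Type := ↥(sobolevSubmodule s)

namespace SobolevInfty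

variable {s : ℝ}

instance instAddCommGroup : AddCommGroup (SobolevInfty s) :=
  inferInstanceAs (AddCommGroup ↥(sobolevSubmodule s))

instance instModule : Module ℂ (SobolevInfty s) :=
  inferInstanceAs (Module ℂ ↥(sobolevSubmodule s))

/-- The Fourier coefficients of an element of `W^{s,∞}(𝕋)`. -/
def coeff (u : SobolevInfty s) : ℤ → ℂ := u.1

lemma coeff_injective : Function.Injective (coeff (s := s)) := Subtype.val_injective

lemma exists_bessel (u : SobolevInfty s) : ∃ h : LInfty, IsBesselPotential s u.coeff h := u.2

/-- The operator `⟨∂ₓ⟩^s : W^{s,∞}(𝕋) → L^∞(𝕋)`. -/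
def bessel : SobolevInfty s →ₗ[ℂ] LInfty where
  toFun u := (exists_bessel u).choose
  map_add' u v := (exists_bessel (u + v)).choose_spec.unique
    ((exists_bessel u).choose_spec.add (exists_bessel v).choose_spec)
  map_smul' c u := (exists_bessel (c • u)).choose_spec.unique
    ((exists_bessel u).choose_spec.smul c)

lemma bessel_spec (u : SobolevInfty s) : IsBesselPotential s u.coeff (bessel u) :=
  (exists_bessel u).choose_spec

lemma bessel_injective : Function.Injective (bessel (s := s)) := by
  intro u v h
  apply coeff_injective
  funext n
  have hu := bessel_spec u n
  rw [h, bessel_spec v n] at hu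
  have : ((japanese n ^ s : ℝ) : ℂ) ≠ 0 :=
    Complex.ofReal_ne_zero.mpr (Real.rpow_pos_of_pos (japanese_pos n) s).ne'
  exact (mul_left_cancel₀ this hu).symm

/-- The norm `‖u‖_{W^{s,∞}} = ‖⟨∂ₓ⟩^s u‖_{L^∞}`. -/
instance instNormedAddCommGroup : NormedAddCommGroup (SobolevInfty s) :=
  NormedAddCommGroup.induced (SobolevInfty s) LInfty bessel bessel_injective

instance instNormedSpace : NormedSpace ℂ (SobolevInfty s) :=
  NormedSpace.induced ℂ (SobolevInfty s) LInfty bessel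

lemma norm_def (u : SobolevInfty s) : ‖u‖ = ‖bessel u‖ := rfl

/-- The element of `W^{s,∞}(𝕋)` given by a distribution `u` with `⟨∂ₓ⟩^s u = h ∈ L^∞(𝕋)`. -/
def mk (u : ℤ → ℂ) (h : LInfty) (H : IsBesselPotential s u h) : SobolevInfty s :=
  (⟨u, h, H⟩ : ↥(sobolevSubmodule s))

lemma coeff_mk (u : ℤ → ℂ) (h : LInfty) (H : IsBesselPotential s u h) :
    (mk u h H).coeff = u := rfl

lemma norm_mk (u : ℤ → ℂ) (h : LInfty) (H : IsBesselPotential s u h) :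
    ‖mk u h H‖ = ‖h‖ := by
  rw [norm_def, (bessel_spec (mk u h H)).unique H]

end SobolevInfty

/-- The Banach space `C([0,T]; W^{s,∞}(𝕋))` with the norm `sup_{t ∈ [0,T]} ‖F t‖_{W^{s,∞}}`. -/
abbrev CW (T s : ℝ) : Type := C(Set.Icc (0 : ℝ) T, SobolevInfty s)

/-- `F ∈ C([0,T]; W^{s,∞}(𝕋))` is the time dependent distribution `u` (restricted to `[0,T]`). -/
def IsPath (T s : ℝ) (u : ℝ → ℤ → ℂ) (F : CW T s) : Prop :=
  ∀ (t : Set.Icc (0 : ℝ) T) (n : ℤ), (F t).coeff n = u t n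

/-- The time dependent distribution `u` belongs to `C([0,T]; W^{s,∞}(𝕋))`. -/
def MemCW (T s : ℝ) (u : ℝ → ℤ → ℂ) : Prop := ∃ F : CW T s, IsPath T s u F

open Classical in
/-- The time dependent distribution `u`, viewed as an element of `C([0,T]; W^{s,∞}(𝕋))`
if it belongs to that space (and `0` otherwise). -/
def toCW (T s : ℝ) (u : ℝ → ℤ → ℂ) : CW T s :=
  if h : MemCW T s u then h.choose else 0

lemma isPath_toCW {T s : ℝ} {u : ℝ → ℤ → ℂ} (h : MemCW T s u) : IsPath T s u (toCW T s u) := by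
  rw [toCW, dif_pos h]
  exact h.choose_spec

/-! ### The equation -/

/-- The symbol `φ(n) = n / (1 + n²)`. -/
def phi (n : ℤ) : ℝ := (n : ℝ) / (1 + (n : ℝ) ^ 2)

/-- The linear propagator `S(t) = exp (-i t φ(D_x))`. -/
def propagator (u : ℤ → ℂ) (t : ℝ) (n : ℤ) : ℂ :=
  Complex.exp (-(Complex.I * (t : ℂ) * (phi n : ℂ))) * u n

/-- The nonlinearity
`N(u) = ∑_{n ≠ 0} φ(n) e^{inx} ∑_{n₁ + n₂ = n} u(n₁) u(n₂)`.
The inner sum is the limit of the sums over `|n₁| ≤ M` as `M → ∞`; it agrees with the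
unconditional sum whenever the latter exists. -/
def nonlin (u : ℤ → ℂ) (n : ℤ) : ℂ :=
  if n = 0 then 0
  else (phi n : ℂ) * ∑'[SummationFilter.symmetricIcc ℤ] m : ℤ, u m * u (n - m)

/-- The inner sums in the definition of `nonlin u` converge. -/
def NonlinDefined (u : ℤ → ℂ) : Prop :=
  ∀ n : ℤ, n ≠ 0 → Summable (fun m : ℤ => u m * u (n - m)) (SummationFilter.symmetricIcc ℤ)

/-! ### Regularisations -/

/-- Mollification kernels: continuous, nonnegative, of integral one, and supported in the
fundamental domain `(-π, π]` of `𝕋`. -/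
structure IsMollifier (ρ : ℝ → ℝ) : Prop where
  continuous : Continuous ρ
  nonneg : ∀ x, 0 ≤ ρ x
  support_subset : Function.support ρ ⊆ Set.Ioc (-Real.pi) Real.pi
  integral_eq_one : ∫ x, ρ x = 1

/-- `∫ ρ_k(y) e^{-iny} dy` for `ρ_k(y) = k ρ(k y)`. Convolution with `ρ_k`,
`(u * ρ_k)(x) = ∫ u(x - y) ρ_k(y) dy`, multiplies the `n`-th Fourier coefficient of `u` by this
number. -/
def mollifierSymbol (ρ : ℝ → ℝ) (k : ℕ) (n : ℤ) : ℂ :=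
  ∫ y : ℝ, (((k : ℝ) * ρ ((k : ℝ) * y) : ℝ) : ℂ) *
    Complex.exp (-(Complex.I * (n : ℂ) * (y : ℂ)))

/-- The symbol of the Dirichlet projection onto the frequencies `|n| ≤ N`. -/
def dirichletSymbol (N : ℕ) (n : ℤ) : ℂ := if |n| ≤ (N : ℤ) then 1 else 0

/-- The sequences of Fourier multipliers used to regularise the initial data: convolution with
`ρ_k` for a mollification kernel `ρ`, and the Dirichlet projections. -/
def IsRegularisation (m : ℕ → ℤ → ℂ) : Prop :=
  (∃ ρ : ℝ → ℝ, IsMollifier ρ ∧ m = mollifierSymbol ρ) ∨ m = dirichletSymbol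

/-! ### The random data -/

/-- The law of a standard complex Gaussian: the real and imaginary parts are independent
centred Gaussians of variance `1/2`. -/
def stdComplexGaussian : Measure ℂ :=
  ((gaussianReal 0 (1 / 2)).prod (gaussianReal 0 (1 / 2))).map
    (fun p : ℝ × ℝ => (p.1 : ℂ) + (p.2 : ℂ) * Complex.I)

/-- `(g_n)_{n ∈ ℤ}` is a sequence of standard Gaussians which are independent up to the reality
condition `g_{-n} = conj g_n`: `g_0, g_1, g_2, …` are independent, `g_n` is a standard complex
Gaussian for `n ≥ 1`, and `g_0` is a standard real Gaussian. -/
structure IsGaussianSequence {Ω : Type*} [MeasurableSpace Ω] (P : Measure Ω)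
    (g : ℤ → Ω → ℂ) : Prop where
  measurable : ∀ n, Measurable (g n)
  law_pos : ∀ n : ℤ, 0 < n → P.map (g n) = stdComplexGaussian
  law_zero : P.map (g 0) = (gaussianReal 0 1).map (fun x : ℝ => (x : ℂ))
  reality : ∀ n : ℤ, ∀ᵐ ω ∂P, g (-n) ω = (starRingEnd ℂ) (g n ω)
  indep : iIndepFun (fun n : ℕ => g (n : ℤ)) P

/-- The random initial data `u₀^ω = ∑ₙ g_n(ω) ⟨n⟩^{-α} e^{inx}`. -/
def initialData {Ω : Type*} (α : ℝ) (g : ℤ → Ω → ℂ) (ω : Ω) (n : ℤ) : ℂ :=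
  g n ω / ((japanese n ^ α : ℝ) : ℂ)

/-- The random linear solution `z = S(t) u₀^ω`. -/
def linSol {Ω : Type*} (α : ℝ) (g : ℤ → Ω → ℂ) (ω : Ω) : ℝ → ℤ → ℂ :=
  propagator (initialData α g ω)

/-- The linear solution `S(t) (m(D_x) u₀^ω)` with data regularised by the multiplier `m`. -/
def regLinSol {Ω : Type*} (α : ℝ) (g : ℤ → Ω → ℂ) (m : ℤ → ℂ) (ω : Ω) : ℝ → ℤ → ℂ :=
  propagator (fun n => initialData α g ω n * m n)

/-- The pair `(u, N(u))` belongs to `C([0,T]; W^{s₁,∞}) × C([0,T]; W^{s₂,∞})`, the sums defining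
`N(u(t))` being convergent for every `t ∈ [0,T]`. -/
def EnhancedMem (T s₁ s₂ : ℝ) (u : ℝ → ℤ → ℂ) : Prop :=
  (∀ t ∈ Set.Icc (0 : ℝ) T, NonlinDefined (u t)) ∧
    MemCW T s₁ u ∧ MemCW T s₂ (fun t => nonlin (u t))

/-- The pair `(u, N(u))` as an element of `C([0,T]; W^{s₁,∞}) × C([0,T]; W^{s₂,∞})`. -/
def enhanced (T s₁ s₂ : ℝ) (u : ℝ → ℤ → ℂ) : CW T s₁ × CW T s₂ :=
  (toCW T s₁ u, toCW T s₂ (fun t => nonlin (u t)))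

end BBM

end

noncomputable section

namespace BBM

/-! ### Exponential moments of Gaussian chaoses -/

/-! Frequency by frequency, `z` is a first-order and `N(z)` a second-order polynomial in the
Gaussians. The product needs no renormalisation: `E (g_a g_l)` is nonzero only when `a + l = 0`, and
that output mode is removed by `φ(0) = 0`. Hence `N(z)` has mean zero and its size is governed by
its variance.

Two variance computations give the regularity thresholds. The variance of `⟨∂ₓ⟩^{s₁} z` at a point
is `∑ ⟨n⟩^{2s₁ - 2α}`, finite when `s₁ < α - 1/2`. For `⟨∂ₓ⟩^{s₂} N(z)` it is controlled by `∑ₙ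
⟨n⟩^{2s₂ - 2} ∑ₐ ⟨a⟩^{-2α} ⟨n - a⟩^{-2α}`. The inner sum is at most a constant times `⟨n⟩^{-γ}` for
`0 ≤ γ < 4α - 1` (`sum_japanese_conv_le`), which is where `1/4 < α ≤ 1/2` enters, and the total is
finite when `s₂ < 2α`. Both conditions are open, so small powers of `⟨n⟩` can be spent elsewhere.

Variances become exponential moments through Gaussianity. For the second chaos, a rotation by `π/4`
of two independent copies turns the quadratic form into a bilinear one, which is Gaussian in one
copy conditionally on the other (`lintegral_exp_re_bilin_le`). Exponential moments at a fixed point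
and time become exponential moments of the norm in `C([0,T]; W^{s,∞})`
(`lintegral_exp_norm_path_le`). In space, a dyadic block is controlled by its values on a grid of
exponentially many points, and a spare factor `2^{δj}` pays for the union. In time, a path is
controlled by its initial value and its derivative; the derivative costs nothing because `φ` is
bounded.

All of this is applied to the difference of two regularisations with multipliers `m`, `m'`
satisfying `|m - m'| ≤ κ ⟨n⟩^θ`, with a bound linear in `κ` (`lintegral_exp_regPath_sub_le`). This
one estimate gives convergence of the truncations (`κ = (M + 1)^{-θ}`), convergence of mollified and
Dirichlet data to the same limit (`κ` proportional to `(k + 1)^{-θ}`), and, by comparison with `m' =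
0`, the moments and the tail bound. The limit is identified with the actual nonlinearity coefficient
by coefficient, using that the random coefficients almost surely tend to zero
(`enhancedMem_of_tendsto`). -/

/-- Multiplying the density of variance `v` by `exp (x²)` gives a multiple of the density of
variance `v / (1 - 2v)`, the multiple being the ratio of the normalising constants. -/
lemma lintegral_exp_sq_gaussianReal_le (v : NNReal) (hv : (v : ℝ) ≤ 1 / 4) :
    ∫⁻ x, ENNReal.ofReal (Real.exp (x ^ 2)) ∂(gaussianReal 0 v) ≤ 2 := by
  rcases eq_or_ne v 0 with rfl | h0
  · simp
  have hvpos : 0 < (v : ℝ) := by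
    have := v.2
    rcases this.lt_or_eq with h | h
    · exact h
    · exact absurd (NNReal.coe_eq_zero.mp h.symm) h0
  have h12 : 0 < 1 - 2 * (v : ℝ) := by linarith
  -- Chosen so that `-1/(2v) + 1 = -1/(2w)`. Since `w ≤ 4v`, the normalising constants differ by a
  -- factor at most `2`.
  set w : NNReal := ⟨(v : ℝ) / (1 - 2 * v), by positivity⟩ with hw
  have hwv : (w : ℝ) = (v : ℝ) / (1 - 2 * v) := rfl
  have hw0 : w ≠ 0 := by
    intro h
    have : (w : ℝ) = 0 := by rw [h]; rfl
    rw [hwv] at this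
    have h2 : 0 < (v : ℝ) / (1 - 2 * v) := by positivity
    linarith
  rw [gaussianReal_of_var_ne_zero 0 h0, lintegral_withDensity_eq_lintegral_mul _
    (measurable_gaussianPDF 0 v) (by fun_prop)]
  calc ∫⁻ x, (gaussianPDF 0 v * fun x : ℝ => ENNReal.ofReal (Real.exp (x ^ 2))) x
      ≤ ∫⁻ x, 2 * gaussianPDF 0 w x := by
        refine lintegral_mono fun x => ?_
        simp only [Pi.mul_apply, gaussianPDF]
        rw [show (2 : ℝ≥0∞) = ENNReal.ofReal 2 by simp, ← ENNReal.ofReal_mul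
          (gaussianPDFReal_nonneg _ _ _), ← ENNReal.ofReal_mul (by norm_num)]
        apply ENNReal.ofReal_le_ofReal
        simp only [gaussianPDFReal, sub_zero]
        have e1 : Real.exp (-x ^ 2 / (2 * v)) * Real.exp (x ^ 2) = Real.exp (-x ^ 2 / (2 * w)) := by
          rw [← Real.exp_add, hwv]
          congr 1
          field_simp
          ring
        rw [mul_assoc, e1, ← mul_assoc]
        apply mul_le_mul_of_nonneg_right _ (Real.exp_pos _).le
        have e2 : Real.sqrt (2 * Real.pi * w) ≤ 2 * Real.sqrt (2 * Real.pi * v) := by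
          rw [show (2 : ℝ) * Real.sqrt (2 * Real.pi * v) = Real.sqrt (2 ^ 2 * (2 * Real.pi * v)) by
            rw [Real.sqrt_mul (sq_nonneg 2), Real.sqrt_sq zero_le_two]]
          apply Real.sqrt_le_sqrt
          have : (w : ℝ) ≤ 4 * v := by
            rw [hwv, div_le_iff₀ h12]
            nlinarith
          nlinarith [Real.pi_pos]
        have p1 : 0 < Real.sqrt (2 * Real.pi * w) := Real.sqrt_pos.mpr (by
          rw [hwv]; have := Real.pi_pos; positivity)
        have p2 : 0 < Real.sqrt (2 * Real.pi * v) := Real.sqrt_pos.mpr (by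
          have := Real.pi_pos; positivity)
        rw [← one_div, ← one_div, mul_one_div, div_le_div_iff₀ p2 p1]
        linarith
    _ = 2 := by
        rw [lintegral_const_mul _ (measurable_gaussianPDF 0 w), lintegral_gaussianPDF_eq_one 0 hw0,
          mul_one]

lemma ofReal_integral_le_lintegral_ofReal {X : Type*} [MeasurableSpace X] (μ : Measure X)
    {f : X → ℝ} (hf : Integrable f μ) :
    ENNReal.ofReal (∫ x, f x ∂μ) ≤ ∫⁻ x, ENNReal.ofReal (f x) ∂μ := by
  rw [integral_eq_lintegral_pos_part_sub_lintegral_neg_part hf]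
  refine (ENNReal.ofReal_le_ofReal (sub_le_self _ ENNReal.toReal_nonneg)).trans ?_
  exact ENNReal.ofReal_toReal_le

/-- A centred Gaussian vector with values in `ι → ℂ` (Gaussian over `ℝ`), whose complex covariance
is dominated by the identity. -/
structure IsStdGaussianVector {ι : Type*} [Fintype ι] (μ : Measure (ι → ℂ)) : Prop where
  isGaussian : IsGaussian μ
  integral_eval : ∀ i, ∫ x, x i ∂μ = 0
  integral_normSq_le : ∀ d : ι → ℂ, ∫ x, ‖∑ i, d i * x i‖ ^ 2 ∂μ ≤ ∑ i, ‖d i‖ ^ 2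

/-- The real linear functional `x ↦ Re ∑ dᵢ xᵢ`. -/
def reFunctional {ι : Type*} [Fintype ι] (d : ι → ℂ) : StrongDual ℝ (ι → ℂ) :=
  ∑ i, Complex.reCLM.comp ((ContinuousLinearMap.mul ℝ ℂ (d i)).comp (ContinuousLinearMap.proj i))

lemma reFunctional_apply {ι : Type*} [Fintype ι] (d x : ι → ℂ) :
    reFunctional d x = (∑ i, d i * x i).re := by
  simp [reFunctional]

namespace IsStdGaussianVector

variable {ι : Type*} [Fintype ι] {μ : Measure (ι → ℂ)}

lemma memLp_eval (h : IsStdGaussianVector μ) (i : ι) (p : ℝ≥0∞) (hp : p ≠ ∞) :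
    MemLp (fun x : ι → ℂ => x i) p μ := by
  have := h.isGaussian
  exact (IsGaussian.hasGaussianLaw_id (μ := μ)).map_fun
    (ContinuousLinearMap.proj (R := ℝ) (φ := fun _ : ι => ℂ) i) |>.memLp hp

lemma integral_dual (h : IsStdGaussianVector μ) (L : StrongDual ℝ (ι → ℂ)) :
    ∫ x, L x ∂μ = 0 := by
  classical
  have := h.isGaussian
  have hi : ∀ i, Integrable (fun x : ι → ℂ => x i) μ := fun i =>
    (h.memLp_eval i 1 (by simp)).integrable le_rfl
  have hint : Integrable (fun x : ι → ℂ => x) μ := Integrable.of_eval hi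
  rw [L.integral_comp_comm hint]
  have : ∫ x, x ∂μ = 0 := by
    ext i
    rw [← ContinuousLinearMap.proj_apply (R := ℝ) (φ := fun _ : ι => ℂ) i (∫ x, x ∂μ),
      ← ContinuousLinearMap.integral_comp_comm _ hint]
    exact h.integral_eval i
  rw [this, map_zero]

lemma map_reFunctional (h : IsStdGaussianVector μ) (d : ι → ℂ) :
    ∃ v : NNReal, (v : ℝ) ≤ ∑ i, ‖d i‖ ^ 2 ∧
      μ.map (fun x : ι → ℂ => (∑ i, d i * x i).re) = gaussianReal 0 v := by
  have := h.isGaussian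
  have hG := IsGaussian.map_eq_gaussianReal (μ := μ) (reFunctional d)
  have h2 : MemLp (fun x : ι → ℂ => ∑ i, d i * x i) 2 μ :=
    memLp_finsetSum _ fun i _ => (h.memLp_eval i 2 (by simp)).const_mul _
  refine ⟨Var[reFunctional d; μ].toNNReal, ?_, ?_⟩
  rotate_left
  · rw [h.integral_dual] at hG
    rw [← hG]
    congr 1
    funext x
    rw [reFunctional_apply]
  · rw [Real.coe_toNNReal _ (variance_nonneg _ _)]
    refine le_trans ?_ (h.integral_normSq_le d)
    rw [variance_of_integral_eq_zero (by fun_prop) (h.integral_dual _)]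
    refine integral_mono_of_nonneg (Eventually.of_forall fun x => by positivity)
      (h2.integrable_norm_pow (by norm_num)) (Eventually.of_forall fun x => ?_)
    simp only [reFunctional_apply]
    rw [← sq_abs]
    exact pow_le_pow_left₀ (abs_nonneg _) (Complex.abs_re_le_norm _) 2

lemma lintegral_exp_re_le (h : IsStdGaussianVector μ) (d : ι → ℂ) :
    ∫⁻ x, ENNReal.ofReal (Real.exp (∑ i, d i * x i).re) ∂μ ≤
      ENNReal.ofReal (Real.exp ((∑ i, ‖d i‖ ^ 2) / 2)) := by
  obtain ⟨v, hv, hmap⟩ := h.map_reFunctional d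
  have hm : Measurable (fun x : ι → ℂ => (∑ i, d i * x i).re) := by fun_prop
  rw [← lintegral_map (f := fun y : ℝ => ENNReal.ofReal (Real.exp y)) (by fun_prop) hm, hmap,
    ← ofReal_integral_eq_lintegral_ofReal]
  · apply ENNReal.ofReal_le_ofReal
    have := congrFun (mgf_id_gaussianReal (μ := 0) (v := v)) 1
    simp only [mgf, id, one_mul, zero_add, one_pow, mul_one] at this
    rw [this]
    apply Real.exp_le_exp.mpr
    linarith
  · simpa using integrable_exp_mul_gaussianReal (μ := 0) (v := v) 1
  · exact Eventually.of_forall fun _ => (Real.exp_pos _).le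

lemma lintegral_exp_re_sq_le (h : IsStdGaussianVector μ) (d : ι → ℂ)
    (hd : ∑ i, ‖d i‖ ^ 2 ≤ 1 / 4) :
    ∫⁻ x, ENNReal.ofReal (Real.exp ((∑ i, d i * x i).re ^ 2)) ∂μ ≤ 2 := by
  obtain ⟨v, hv, hmap⟩ := h.map_reFunctional d
  have hm : Measurable (fun x : ι → ℂ => (∑ i, d i * x i).re) := by fun_prop
  rw [← lintegral_map (f := fun y : ℝ => ENNReal.ofReal (Real.exp (y ^ 2))) (by fun_prop) hm, hmap]
  exact lintegral_exp_sq_gaussianReal_le v (hv.trans hd)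

lemma exp_half_add_le (a b : ℝ) :
    Real.exp ((a + b) / 2) ≤ (Real.exp a + Real.exp b) / 2 := by
  have h1 : Real.exp a = Real.exp (a / 2) ^ 2 := by rw [← Real.exp_nat_mul]; ring_nf
  have h2 : Real.exp b = Real.exp (b / 2) ^ 2 := by rw [← Real.exp_nat_mul]; ring_nf
  rw [add_div, Real.exp_add, h1, h2]
  nlinarith [sq_nonneg (Real.exp (a / 2) - Real.exp (b / 2))]

/-- `|z|²` is the average of `2 (Re z)²` and `2 (Im z)²`, so convexity of `exp` reduces to real
functionals. The factors `√2` and `-i√2` put both in the form `(Re ∑ d'ᵢ xᵢ)²`, at the price of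
halving the admissible size of `d`. -/
lemma lintegral_exp_norm_sq_le (h : IsStdGaussianVector μ) (d : ι → ℂ)
    (hd : ∑ i, ‖d i‖ ^ 2 ≤ 1 / 8) :
    ∫⁻ x, ENNReal.ofReal (Real.exp (‖∑ i, d i * x i‖ ^ 2)) ∂μ ≤ 2 := by
  have hs : ((Real.sqrt 2 : ℝ) : ℂ) ^ 2 = 2 := by
    rw [← Complex.ofReal_pow, Real.sq_sqrt (by norm_num)]; norm_num
  have hn : ‖((Real.sqrt 2 : ℝ) : ℂ)‖ ^ 2 = 2 := by
    rw [Complex.norm_real, Real.norm_eq_abs, sq_abs, Real.sq_sqrt (by norm_num)]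
  have e1 := h.lintegral_exp_re_sq_le (fun i => (Real.sqrt 2 : ℝ) * d i) (by
    simp only [norm_mul, mul_pow, hn, ← Finset.mul_sum]; linarith)
  have e2 := h.lintegral_exp_re_sq_le (fun i => (-Complex.I * (Real.sqrt 2 : ℝ)) * d i) (by
    simp only [norm_mul, mul_pow, hn, ← Finset.mul_sum, norm_neg, Complex.norm_I, one_mul]
    linarith)
  have s1 : ∀ x : ι → ℂ, (∑ i, ((Real.sqrt 2 : ℝ) : ℂ) * d i * x i).re ^ 2 =
      2 * (∑ i, d i * x i).re ^ 2 := by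
    intro x
    simp only [mul_assoc, ← Finset.mul_sum]
    rw [Complex.re_ofReal_mul, mul_pow, Real.sq_sqrt (by norm_num)]
  have s2 : ∀ x : ι → ℂ, (∑ i, (-Complex.I * (Real.sqrt 2 : ℝ)) * d i * x i).re ^ 2 =
      2 * (∑ i, d i * x i).im ^ 2 := by
    intro x
    simp only [mul_assoc, ← Finset.mul_sum]
    rw [neg_mul, Complex.neg_re, Complex.I_mul_re, neg_neg, Complex.im_ofReal_mul, mul_pow,
      Real.sq_sqrt (by norm_num)]
  simp only [s1] at e1
  simp only [s2] at e2
  calc ∫⁻ x, ENNReal.ofReal (Real.exp (‖∑ i, d i * x i‖ ^ 2)) ∂μ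
      ≤ ∫⁻ x, (ENNReal.ofReal (1 / 2) * ENNReal.ofReal (Real.exp (2 * (∑ i, d i * x i).re ^ 2)) +
          ENNReal.ofReal (1 / 2) * ENNReal.ofReal (Real.exp (2 * (∑ i, d i * x i).im ^ 2))) ∂μ := by
        refine lintegral_mono fun x => ?_
        rw [← ENNReal.ofReal_mul (by norm_num), ← ENNReal.ofReal_mul (by norm_num),
          ← ENNReal.ofReal_add (by positivity) (by positivity)]
        apply ENNReal.ofReal_le_ofReal
        have := exp_half_add_le (2 * (∑ i, d i * x i).re ^ 2) (2 * (∑ i, d i * x i).im ^ 2)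
        rw [Complex.sq_norm, Complex.normSq_apply]
        calc _ = _ := by congr 1; ring
          _ ≤ _ := this
          _ = _ := by ring
    _ ≤ ENNReal.ofReal (1 / 2) * 2 + ENNReal.ofReal (1 / 2) * 2 := by
        rw [lintegral_add_left (by fun_prop), lintegral_const_mul _ (by fun_prop),
          lintegral_const_mul _ (by fun_prop)]
        gcongr
    _ = 2 := by
        rw [show (2 : ℝ≥0∞) = ENNReal.ofReal 2 by simp, ← ENNReal.ofReal_mul (by norm_num),
          ← ENNReal.ofReal_add (by norm_num) (by norm_num)]
        norm_num

lemma lintegral_exp_norm_le (h : IsStdGaussianVector μ) (d : ι → ℂ)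
    (hd : ∑ i, ‖d i‖ ^ 2 ≤ 1) :
    ∫⁻ x, ENNReal.ofReal (Real.exp ‖∑ i, d i * x i‖) ∂μ ≤ ENNReal.ofReal (2 * Real.exp 2) := by
  have hs : (Real.sqrt 8)⁻¹ ^ 2 = 1 / 8 := by rw [inv_pow, Real.sq_sqrt (by norm_num)]; norm_num
  have hn : ‖(((Real.sqrt 8)⁻¹ : ℝ) : ℂ)‖ ^ 2 = 1 / 8 := by
    rw [Complex.norm_real, Real.norm_eq_abs, sq_abs, hs]
  have e1 := h.lintegral_exp_norm_sq_le (fun i => ((Real.sqrt 8)⁻¹ : ℝ) * d i) (by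
    simp only [norm_mul, mul_pow, hn, ← Finset.mul_sum]; linarith)
  calc _ ≤ ∫⁻ x, ENNReal.ofReal (Real.exp 2) * ENNReal.ofReal (Real.exp
        (‖∑ i, (((Real.sqrt 8)⁻¹ : ℝ) : ℂ) * d i * x i‖ ^ 2)) ∂μ := by
        refine lintegral_mono fun x => ?_
        rw [← ENNReal.ofReal_mul (Real.exp_pos _).le, ← Real.exp_add]
        apply ENNReal.ofReal_le_ofReal
        apply Real.exp_le_exp.mpr
        simp only [mul_assoc, ← Finset.mul_sum]
        rw [norm_mul, mul_pow, hn]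
        -- `u ≤ u²/8 + 2`, which is `(u - 4)² ≥ 0`.
        nlinarith [sq_nonneg (‖∑ i, d i * x i‖ - 4)]
    _ ≤ ENNReal.ofReal (Real.exp 2) * 2 := by
        rw [lintegral_const_mul _ (by fun_prop)]
        gcongr
    _ = _ := by
        rw [show (2 : ℝ≥0∞) = ENNReal.ofReal 2 by simp, ← ENNReal.ofReal_mul (Real.exp_pos _).le,
          mul_comm]

end IsStdGaussianVector

/-! ### Exponential moments of the second chaos -/

namespace IsStdGaussianVector

variable {ι : Type*} [Fintype ι] {μ : Measure (ι → ℂ)}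

/-- Polarisation: under a rotation by `π/4` the difference of two values of a quadratic form becomes
the bilinear form evaluated at the pair. -/
lemma bilin_rotation (b : ι → ι → ℂ) (hb : ∀ i j, b i j = b j i) (c : ℝ) (hc : c ^ 2 = 1 / 2)
    (x y : ι → ℂ) :
    (∑ i, ∑ j, b i j * (c • x + c • y) i * (c • x + c • y) j) -
      ∑ i, ∑ j, b i j * (-c • x + c • y) i * (-c • x + c • y) j =
      ∑ j, (2 * ∑ i, b i j * x i) * y j := by
  have hc' : (c : ℂ) ^ 2 = 1 / 2 := by rw [← Complex.ofReal_pow, hc]; norm_num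
  have e : ∀ i j, b i j * (c • x + c • y) i * (c • x + c • y) j -
      b i j * (-c • x + c • y) i * (-c • x + c • y) j = b i j * x i * y j + b i j * x j * y i := by
    intro i j
    simp only [Pi.add_apply, Pi.smul_apply, Complex.real_smul, Complex.ofReal_neg]
    linear_combination (2 * b i j * (x i * y j + x j * y i)) * hc'
  rw [← Finset.sum_sub_distrib]
  simp only [← Finset.sum_sub_distrib, e, Finset.sum_add_distrib]
  have s : ∑ i, ∑ j, b i j * x j * y i = ∑ i, ∑ j, b i j * x i * y j := by
    rw [Finset.sum_comm]
    refine Finset.sum_congr rfl fun i _ => Finset.sum_congr rfl fun j _ => ?_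
    rw [hb]
  rw [s, Finset.sum_comm]
  simp only [Finset.mul_sum, Finset.sum_mul, ← Finset.sum_add_distrib]
  refine Finset.sum_congr rfl fun i _ => Finset.sum_congr rfl fun j _ => ?_
  ring

/-- Each form is rescaled to the common variance `S`, the total variance, and weighted by its share
of `S`. The sum of squares is then a convex combination of squares to which
`lintegral_exp_norm_sq_le` applies, and Jensen concludes without loss in the number of forms. -/
lemma lintegral_exp_sum_norm_sq_le (h : IsStdGaussianVector μ) {κ : Type*} [Fintype κ]
    (b : ι → κ → ℂ) (hb : ∑ j, ∑ i, ‖b i j‖ ^ 2 ≤ 1 / 8) :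
    ∫⁻ x, ENNReal.ofReal (Real.exp (∑ j, ‖∑ i, b i j * x i‖ ^ 2)) ∂μ ≤ 2 := by
  have := h.isGaussian
  set β : κ → ℝ := fun j => ∑ i, ‖b i j‖ ^ 2 with hβ
  have hβ0 : ∀ j, 0 ≤ β j := fun j => by positivity
  set S : ℝ := ∑ j, β j with hS
  rcases (Finset.sum_nonneg fun j _ => hβ0 j : 0 ≤ S).eq_or_lt with h0 | hpos
  · have hz : ∀ i j, b i j = 0 := by
      intro i j
      have h1 := (Finset.sum_eq_zero_iff_of_nonneg fun j _ => hβ0 j).mp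
        h0.symm j (Finset.mem_univ j)
      have h2 := (Finset.sum_eq_zero_iff_of_nonneg fun i _ => by positivity).mp h1 i
        (Finset.mem_univ i)
      simpa using h2
    simp [hz]
  set w : κ → ℝ := fun j => β j / S
  have hw0 : ∀ j, 0 ≤ w j := fun j => div_nonneg (hβ0 j) hpos.le
  have hw1 : ∑ j, w j = 1 := by
    rw [← Finset.sum_div, div_self hpos.ne']
  have hsq : ∀ j, ‖(((Real.sqrt (w j))⁻¹ : ℝ) : ℂ)‖ ^ 2 = (w j)⁻¹ := by
    intro j
    rw [Complex.norm_real, Real.norm_eq_abs, sq_abs, inv_pow, Real.sq_sqrt (hw0 j)]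
  have hterm : ∀ j (x : ι → ℂ), w j * ‖∑ i, (((Real.sqrt (w j))⁻¹ : ℝ) : ℂ) * b i j * x i‖ ^ 2 =
      ‖∑ i, b i j * x i‖ ^ 2 := by
    intro j x
    simp only [mul_assoc, ← Finset.mul_sum]
    rw [norm_mul, mul_pow, hsq]
    -- A form of zero weight vanishes identically, so the value `0⁻¹ = 0` in the rescaling is
    -- harmless.
    rcases eq_or_ne (w j) 0 with hz | hz
    · have hβz : β j = 0 := by
        rcases div_eq_zero_iff.mp hz with h | h
        · exact h
        · exact absurd h hpos.ne'
      have : ∀ i, b i j = 0 := fun i => by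
        have := (Finset.sum_eq_zero_iff_of_nonneg fun i _ => by positivity).mp hβz i
          (Finset.mem_univ i)
        simpa using this
      simp [this]
    · rw [← mul_assoc, mul_inv_cancel₀ hz, one_mul]
  have hj : ∀ j, ∫⁻ x, ENNReal.ofReal (Real.exp
      (‖∑ i, (((Real.sqrt (w j))⁻¹ : ℝ) : ℂ) * b i j * x i‖ ^ 2)) ∂μ ≤ 2 := by
    intro j
    apply h.lintegral_exp_norm_sq_le
    simp only [norm_mul, mul_pow, hsq, ← Finset.mul_sum]
    change (w j)⁻¹ * β j ≤ 1 / 8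
    rcases eq_or_ne (β j) 0 with hz | hz
    · rw [hz]; norm_num
    · simp only [w]
      rw [inv_div, div_mul_cancel₀ _ hz]
      exact hb
  calc _ ≤ ∫⁻ x, ∑ j, ENNReal.ofReal (w j) * ENNReal.ofReal (Real.exp
      (‖∑ i, (((Real.sqrt (w j))⁻¹ : ℝ) : ℂ) * b i j * x i‖ ^ 2)) ∂μ := by
        refine lintegral_mono fun x => ?_
        simp only [← ENNReal.ofReal_mul (hw0 _)]
        rw [← ENNReal.ofReal_sum_of_nonneg fun j _ => mul_nonneg (hw0 j) (Real.exp_pos _).le]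
        apply ENNReal.ofReal_le_ofReal
        have := convexOn_exp.map_sum_le (t := Finset.univ) (w := w)
          (p := fun j => ‖∑ i, (((Real.sqrt (w j))⁻¹ : ℝ) : ℂ) * b i j * x i‖ ^ 2)
          (fun j _ => hw0 j) hw1 (fun _ _ => Set.mem_univ _)
        simp only [smul_eq_mul, hterm] at this
        exact this
    _ = ∑ j, ENNReal.ofReal (w j) * ∫⁻ x, ENNReal.ofReal (Real.exp
      (‖∑ i, (((Real.sqrt (w j))⁻¹ : ℝ) : ℂ) * b i j * x i‖ ^ 2)) ∂μ := by
        rw [lintegral_finsetSum _ fun j _ => by fun_prop]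
        refine Finset.sum_congr rfl fun j _ => ?_
        rw [lintegral_const_mul _ (by fun_prop)]
    _ ≤ ∑ j, ENNReal.ofReal (w j) * 2 := by gcongr with j; exact hj j
    _ = 2 := by
        rw [← Finset.sum_mul, ← ENNReal.ofReal_sum_of_nonneg fun j _ => hw0 j, hw1]
        simp

lemma integrable_bilin (h : IsStdGaussianVector μ) (b : ι → ι → ℂ) :
    Integrable (fun x : ι → ℂ => ∑ i, ∑ j, b i j * x i * x j) μ := by
  refine integrable_finsetSum _ fun i _ => integrable_finsetSum _ fun j _ => ?_
  have := (h.memLp_eval i 2 (by simp)).integrable_mul (h.memLp_eval j 2 (by simp))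
  simpa [mul_assoc] using this.const_mul (b i j)

/-- Decoupling. Mean zero and Jensen give `E exp(-Re Q(y)) ≥ 1`, so an independent copy may be
subtracted in the exponent. The law of the pair is invariant under rotation, which turns `Q(x) -
Q(y)` into twice the bilinear form. Integrating in `y` with `x` fixed is a linear Gaussian
computation and leaves the exponential of a sum of squares of linear forms in `x`. -/
lemma lintegral_exp_re_bilin_le (h : IsStdGaussianVector μ) (b : ι → ι → ℂ)
    (hb : ∀ i j, b i j = b j i) (hmean : ∫ x, ∑ i, ∑ j, b i j * x i * x j ∂μ = 0)
    (hsum : ∑ i, ∑ j, ‖b i j‖ ^ 2 ≤ 1 / 16) :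
    ∫⁻ x, ENNReal.ofReal (Real.exp (∑ i, ∑ j, b i j * x i * x j).re) ∂μ ≤ 2 := by
  have hG := h.isGaussian
  set Q : (ι → ℂ) → ℂ := fun x => ∑ i, ∑ j, b i j * x i * x j with hQ
  have hQm : Measurable Q := by fun_prop
  have hQi : Integrable Q μ := h.integrable_bilin b
  have hone : 1 ≤ ∫⁻ y, ENNReal.ofReal (Real.exp (-(Q y).re)) ∂μ := by
    have hr : Integrable (fun y => (Q y).re) μ := hQi.re
    have hi : Integrable (fun y => 1 - (Q y).re) μ := (integrable_const 1).sub hr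
    have hre : ∫ y, (Q y).re ∂μ = 0 := by
      have : ∫ y, RCLike.re (Q y) ∂μ = RCLike.re (∫ y, Q y ∂μ) := integral_re hQi
      rw [hmean] at this
      simpa using this
    have := ofReal_integral_le_lintegral_ofReal μ hi
    rw [integral_sub (integrable_const 1) hr, hre] at this
    simp only [integral_const, probReal_univ, smul_eq_mul, mul_one, sub_zero,
      ENNReal.ofReal_one] at this
    refine this.trans (lintegral_mono fun y => ENNReal.ofReal_le_ofReal ?_)
    have := Real.add_one_le_exp (-(Q y).re)
    linarith
  have hrot := IsGaussian.map_rotation_eq_self_of_forall_strongDual_eq_zero (μ := μ)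
    h.integral_dual (Real.pi / 4)
  set c : ℝ := Real.sqrt 2 / 2
  have hc : c ^ 2 = 1 / 2 := by
    simp only [c]; rw [div_pow, Real.sq_sqrt (by norm_num)]; norm_num
  calc ∫⁻ x, ENNReal.ofReal (Real.exp (Q x).re) ∂μ
      ≤ ∫⁻ x, ENNReal.ofReal (Real.exp (Q x).re) *
          ∫⁻ y, ENNReal.ofReal (Real.exp (-(Q y).re)) ∂μ ∂μ :=
        lintegral_mono fun x => le_mul_of_one_le_right (by positivity) hone
    _ = ∫⁻ x, ∫⁻ y, ENNReal.ofReal (Real.exp ((Q x - Q y).re)) ∂μ ∂μ := by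
        refine lintegral_congr fun x => ?_
        rw [← lintegral_const_mul _ (by fun_prop)]
        refine lintegral_congr fun y => ?_
        rw [← ENNReal.ofReal_mul (Real.exp_pos _).le, ← Real.exp_add, Complex.sub_re,
          sub_eq_add_neg]
    _ = ∫⁻ p, ENNReal.ofReal (Real.exp ((Q p.1 - Q p.2).re)) ∂(μ.prod μ) := by
        rw [lintegral_prod _ (by fun_prop)]
    _ = ∫⁻ p, ENNReal.ofReal (Real.exp ((∑ j, (2 * ∑ i, b i j * p.1 i) * p.2 j).re))
          ∂(μ.prod μ) := by
        conv_lhs => rw [← hrot]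
        rw [lintegral_map (by fun_prop) (by fun_prop)]
        refine lintegral_congr fun p => ?_
        rw [ContinuousLinearMap.rotation_apply, Real.cos_pi_div_four, Real.sin_pi_div_four]
        simp only [hQ]
        rw [bilin_rotation b hb c hc]
    _ = ∫⁻ x, ∫⁻ y, ENNReal.ofReal (Real.exp ((∑ j, (2 * ∑ i, b i j * x i) * y j).re)) ∂μ ∂μ := by
        rw [lintegral_prod _ (by fun_prop)]
    -- The Gaussian integral yields `|2u|²/2 = |√2 u|²`. The factor `2` turns the hypothesis `1/16`
    -- into the `1/8` needed for the last step.
    _ ≤ ∫⁻ x, ENNReal.ofReal (Real.exp (∑ j, ‖∑ i, ((Real.sqrt 2 : ℝ) * b i j) * x i‖ ^ 2)) ∂μ := by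
        refine lintegral_mono fun x => (h.lintegral_exp_re_le _).trans (le_of_eq ?_)
        congr 2
        rw [Finset.sum_div]
        refine Finset.sum_congr rfl fun j _ => ?_
        simp only [mul_assoc, ← Finset.mul_sum]
        rw [norm_mul, norm_mul, mul_pow, mul_pow, Complex.norm_real, Real.norm_eq_abs, sq_abs,
          Real.sq_sqrt (by norm_num)]
        norm_num
        ring
    _ ≤ 2 := by
        apply h.lintegral_exp_sum_norm_sq_le
        simp only [norm_mul, mul_pow, ← Finset.mul_sum]
        rw [Complex.norm_real, Real.norm_eq_abs, sq_abs, Real.sq_sqrt (by norm_num),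
          Finset.sum_comm]
        linarith

lemma exp_norm_le_sum (z : ℂ) : Real.exp (‖z‖ / 2) ≤
    Real.exp z.re + Real.exp (-z.re) + Real.exp z.im + Real.exp (-z.im) := by
  have h1 : ‖z‖ / 2 ≤ max |z.re| |z.im| := by
    have := Complex.norm_le_abs_re_add_abs_im z
    have := le_max_left |z.re| |z.im|
    have := le_max_right |z.re| |z.im|
    linarith
  refine (Real.exp_le_exp.mpr h1).trans ?_
  have p1 := Real.exp_pos z.re
  have p2 := Real.exp_pos (-z.re)
  have p3 := Real.exp_pos z.im
  have p4 := Real.exp_pos (-z.im)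
  rcases max_choice |z.re| |z.im| with h | h <;> rw [h]
  · rcases abs_choice z.re with h | h <;> rw [h] <;> linarith
  · rcases abs_choice z.im with h | h <;> rw [h] <;> linarith

/-- The modulus is controlled by the real parts of the form multiplied by `±1` and `±i`. Dividing
the form by `4` brings the sum of squares below `1/16`, and `exp_norm_le_sum` costs another factor
`2`, hence the `8` in the exponent. -/
lemma lintegral_exp_norm_bilin_le (h : IsStdGaussianVector μ) (b : ι → ι → ℂ)
    (hb : ∀ i j, b i j = b j i) (hmean : ∫ x, ∑ i, ∑ j, b i j * x i * x j ∂μ = 0)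
    (hsum : ∑ i, ∑ j, ‖b i j‖ ^ 2 ≤ 1) :
    ∫⁻ x, ENNReal.ofReal (Real.exp (‖∑ i, ∑ j, b i j * x i * x j‖ / 8)) ∂μ ≤ 8 := by
  have key : ∀ ζ : ℂ, ‖ζ‖ = 1 →
      ∫⁻ x, ENNReal.ofReal (Real.exp (ζ / 4 * ∑ i, ∑ j, b i j * x i * x j).re) ∂μ ≤ 2 := by
    intro ζ hζ
    have e : ∀ x : ι → ℂ, ∑ i, ∑ j, (ζ / 4 * b i j) * x i * x j =
        ζ / 4 * ∑ i, ∑ j, b i j * x i * x j := by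
      intro x
      simp only [Finset.mul_sum, mul_assoc]
    have := h.lintegral_exp_re_bilin_le (fun i j => ζ / 4 * b i j) (fun i j => by rw [hb])
      (by simp only [e]; rw [integral_const_mul, hmean, mul_zero])
      (by
        simp only [norm_mul, mul_pow, ← Finset.mul_sum, norm_div, hζ]
        norm_num
        linarith)
    simpa only [e] using this
  have k1 := key 1 (by simp)
  have k2 := key (-1) (by simp)
  have k3 := key (-Complex.I) (by simp)
  have k4 := key (Complex.I) (by simp)
  set Q : (ι → ℂ) → ℂ := fun x => ∑ i, ∑ j, b i j * x i * x j with hQ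
  have hQm : Measurable Q := by fun_prop
  calc ∫⁻ x, ENNReal.ofReal (Real.exp (‖Q x‖ / 8)) ∂μ
      ≤ ∫⁻ x, (ENNReal.ofReal (Real.exp (1 / 4 * Q x).re) +
          ENNReal.ofReal (Real.exp (-1 / 4 * Q x).re) +
          ENNReal.ofReal (Real.exp (-Complex.I / 4 * Q x).re) +
          ENNReal.ofReal (Real.exp (Complex.I / 4 * Q x).re)) ∂μ := by
        refine lintegral_mono fun x => ?_
        rw [← ENNReal.ofReal_add (by positivity) (by positivity),
          ← ENNReal.ofReal_add (by positivity) (by positivity),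
          ← ENNReal.ofReal_add (by positivity) (by positivity)]
        apply ENNReal.ofReal_le_ofReal
        have := exp_norm_le_sum (1 / 4 * Q x)
        have n : ‖1 / 4 * Q x‖ / 2 = ‖Q x‖ / 8 := by rw [norm_mul]; norm_num; ring
        rw [n] at this
        have e1 : (-1 / 4 * Q x).re = -(1 / 4 * Q x).re := by rw [← Complex.neg_re]; ring_nf
        have e2 : (-Complex.I / 4 * Q x).re = (1 / 4 * Q x).im := by
          rw [show -Complex.I / 4 * Q x = -(Complex.I * (1 / 4 * Q x)) by ring, Complex.neg_re,
            Complex.I_mul_re, neg_neg]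
        have e3 : (Complex.I / 4 * Q x).re = -(1 / 4 * Q x).im := by
          rw [show Complex.I / 4 * Q x = (Complex.I * (1 / 4 * Q x)) by ring, Complex.I_mul_re]
        rw [e1, e2, e3]
        exact this
    _ ≤ 2 + 2 + 2 + 2 := by
        rw [lintegral_add_left (by fun_prop), lintegral_add_left (by fun_prop),
          lintegral_add_left (by fun_prop)]
        gcongr
    _ = 8 := by norm_num

end IsStdGaussianVector

/-- `(x, y) ↦ x + i y` as a continuous linear map. -/
def toComplexCLM : ℝ × ℝ →L[ℝ] ℂ := Complex.equivRealProdCLM.symm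

lemma stdComplexGaussian_eq : stdComplexGaussian =
    ((gaussianReal 0 (1 / 2)).prod (gaussianReal 0 (1 / 2))).map toComplexCLM := by
  unfold stdComplexGaussian
  congr 1
  funext p
  apply Complex.ext <;> simp [toComplexCLM]

instance isGaussian_stdComplexGaussian : IsGaussian stdComplexGaussian := by
  rw [stdComplexGaussian_eq]
  infer_instance

lemma integrable_pow_gaussianReal (v : NNReal) (k : ℕ) :
    Integrable (fun x : ℝ => x ^ k) (gaussianReal 0 v) := by
  have h := (memLp_id_gaussianReal' (μ := 0) (v := v) (k : ℝ≥0∞) (by simp)).integrable_norm_pow'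
  refine h.mono (by fun_prop) (Eventually.of_forall fun x => ?_)
  simp

lemma integral_sq_gaussianReal (v : NNReal) : ∫ x, x ^ 2 ∂(gaussianReal 0 v) = v := by
  have h := variance_fun_id_gaussianReal (μ := 0) (v := v)
  rw [variance_of_integral_eq_zero (by fun_prop) (by simp)] at h
  exact h

/-- One computation covering the first moment and both second moments `E g²` and `E |g|²`: linear
and mixed terms integrate to zero, and each square contributes the variance `1/2`. -/
lemma integral_stdComplexGaussian_poly (f : ℂ → ℂ) (hf : Measurable f) (a b c d e : ℂ)
    (h : ∀ x y : ℝ, f (x + y * Complex.I) = a * x + b * y + c * x ^ 2 + d * y ^ 2 + e * (x * y)) :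
    ∫ z, f z ∂stdComplexGaussian = (c + d) / 2 := by
  set γ := gaussianReal 0 (1 / 2) with hγ
  have i1 : Integrable (fun x : ℝ => (x : ℂ)) γ := by
    have := (integrable_pow_gaussianReal (1 / 2) 1).ofReal (𝕜 := ℂ)
    simp only [pow_one] at this
    exact this
  have i2 : Integrable (fun x : ℝ => (x : ℂ) ^ 2) γ := by
    have := (integrable_pow_gaussianReal (1 / 2) 2).ofReal (𝕜 := ℂ)
    push_cast at this
    exact this
  have v1 : ∫ x : ℝ, (x : ℂ) ∂γ = 0 := by rw [integral_complex_ofReal]; simp [hγ]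
  have v2 : ∫ x : ℝ, (x : ℂ) ^ 2 ∂γ = 1 / 2 := by
    simp only [← Complex.ofReal_pow]
    rw [integral_complex_ofReal, integral_sq_gaussianReal]
    simp
  unfold stdComplexGaussian
  rw [integral_map (by fun_prop) hf.aestronglyMeasurable]
  simp only [h]
  have j1 : Integrable (fun p : ℝ × ℝ => a * (p.1 : ℂ)) (γ.prod γ) := (i1.comp_fst γ).const_mul a
  have j2 : Integrable (fun p : ℝ × ℝ => b * (p.2 : ℂ)) (γ.prod γ) := (i1.comp_snd γ).const_mul b
  have j3 : Integrable (fun p : ℝ × ℝ => c * (p.1 : ℂ) ^ 2) (γ.prod γ) :=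
    (i2.comp_fst γ).const_mul c
  have j4 : Integrable (fun p : ℝ × ℝ => d * (p.2 : ℂ) ^ 2) (γ.prod γ) :=
    (i2.comp_snd γ).const_mul d
  have j5 : Integrable (fun p : ℝ × ℝ => e * ((p.1 : ℂ) * (p.2 : ℂ))) (γ.prod γ) :=
    (i1.mul_prod i1).const_mul e
  rw [← hγ, integral_add (by exact ((j1.add j2).add j3).add j4) j5,
    integral_add (by exact (j1.add j2).add j3) j4, integral_add (by exact j1.add j2) j3,
    integral_add j1 j2]
  simp only [integral_const_mul]
  rw [integral_prod_mul (fun x : ℝ => (x : ℂ)) (fun y : ℝ => (y : ℂ)),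
    integral_fun_fst (fun x : ℝ => (x : ℂ)), integral_fun_snd (fun x : ℝ => (x : ℂ)),
    integral_fun_fst (fun x : ℝ => (x : ℂ) ^ 2), integral_fun_snd (fun x : ℝ => (x : ℂ) ^ 2),
    v1, v2]
  simp
  ring

/-! ### The Gaussian sequence: covariances and truncated laws -/

namespace IsGaussianSequence

variable {Ω : Type*} [MeasurableSpace Ω] {P : Measure Ω} {g : ℤ → Ω → ℂ}

lemma integral_comp_pos (hg : IsGaussianSequence P g) {n : ℤ} (hn : 0 < n) (f : ℂ → ℂ)
    (hf : Measurable f) : ∫ ω, f (g n ω) ∂P = ∫ z, f z ∂stdComplexGaussian := by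
  rw [← hg.law_pos n hn, integral_map (hg.measurable n).aemeasurable hf.aestronglyMeasurable]

lemma integral_comp_zero (hg : IsGaussianSequence P g) (f : ℂ → ℂ)
    (hf : Measurable f) : ∫ ω, f (g 0 ω) ∂P = ∫ x : ℝ, f x ∂(gaussianReal 0 1) := by
  rw [← integral_map (φ := fun x : ℝ => (x : ℂ)) (by fun_prop) hf.aestronglyMeasurable,
    ← hg.law_zero, integral_map (hg.measurable 0).aemeasurable hf.aestronglyMeasurable]

lemma hasGaussianLaw_nat (hg : IsGaussianSequence P g) (n : ℕ) :
    HasGaussianLaw (g (n : ℤ)) P where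
  isGaussian_map := by
    rcases Nat.eq_zero_or_pos n with rfl | h
    · rw [Nat.cast_zero, hg.law_zero]
      exact isGaussian_map (μ := gaussianReal 0 1) Complex.ofRealCLM
    · rw [hg.law_pos n (by exact_mod_cast h)]
      infer_instance

/-- The real-linear map (identity or conjugation) which turns `g |n|` into `g n`. -/
def signCLM (n : ℤ) : ℂ →L[ℝ] ℂ :=
  if 0 ≤ n then ContinuousLinearMap.id ℝ ℂ else (Complex.conjCLE : ℂ →L[ℝ] ℂ)

lemma ae_eq_signCLM (hg : IsGaussianSequence P g) (n : ℤ) :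
    g n =ᵐ[P] fun ω => signCLM n (g (n.natAbs : ℤ) ω) := by
  unfold signCLM
  split_ifs with h
  · rw [Int.natAbs_of_nonneg h]
    simp
  · have := hg.reality (n.natAbs : ℤ)
    rw [Int.ofNat_natAbs_of_nonpos (by omega), neg_neg] at this
    rw [Int.ofNat_natAbs_of_nonpos (by omega)]
    filter_upwards [this] with ω hω
    rw [hω]
    simp

lemma memLp (hg : IsGaussianSequence P g) (n : ℤ) {p : ℝ≥0∞} (hp : p ≠ ∞) :
    MemLp (g n) p P := by
  have := ((hg.hasGaussianLaw_nat n.natAbs).map_fun (signCLM n)).memLp hp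
  exact this.ae_eq (hg.ae_eq_signCLM n).symm

lemma integrable (hg : IsGaussianSequence P g) (n : ℤ) : Integrable (g n) P := by
  have := (hg.hasGaussianLaw_nat 0).isProbabilityMeasure
  exact (hg.memLp n (p := 1) (by simp)).integrable le_rfl

lemma integrable_mul (hg : IsGaussianSequence P g) (a l : ℤ) :
    Integrable (fun ω => g a ω * g l ω) P :=
  (hg.memLp a (p := 2) (by simp)).integrable_mul (hg.memLp l (p := 2) (by simp))

lemma integral_nat_eq_zero (hg : IsGaussianSequence P g) (n : ℕ) :
    ∫ ω, g (n : ℤ) ω ∂P = 0 := by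
  rcases Nat.eq_zero_or_pos n with rfl | h
  · rw [Nat.cast_zero, hg.integral_comp_zero (fun z => z) measurable_id, integral_complex_ofReal]
    simp
  · rw [hg.integral_comp_pos (by exact_mod_cast h) (fun z => z) measurable_id,
      integral_stdComplexGaussian_poly (fun z => z) measurable_id 1 Complex.I 0 0 0
        (fun x y => by ring)]
    simp

lemma integral_eq_zero (hg : IsGaussianSequence P g) (n : ℤ) : ∫ ω, g n ω ∂P = 0 := by
  rw [integral_congr_ae (hg.ae_eq_signCLM n),
    ContinuousLinearMap.integral_comp_comm _ (hg.integrable _), hg.integral_nat_eq_zero, map_zero]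

lemma integral_mul_of_natAbs_ne (hg : IsGaussianSequence P g) {a l : ℤ}
    (h : a.natAbs ≠ l.natAbs) : ∫ ω, g a ω * g l ω ∂P = 0 := by
  have hind := (hg.indep.indepFun h).comp (φ := signCLM a) (ψ := signCLM l)
    (signCLM a).measurable (signCLM l).measurable
  have e : (fun ω => g a ω * g l ω) =ᵐ[P] fun ω => signCLM a (g (a.natAbs : ℤ) ω) *
      signCLM l (g (l.natAbs : ℤ) ω) := by
    filter_upwards [hg.ae_eq_signCLM a, hg.ae_eq_signCLM l] with ω h1 h2
    rw [h1, h2]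
  rw [integral_congr_ae e]
  have := hind.integral_mul_eq_mul_integral
    ((signCLM a).continuous.comp_aestronglyMeasurable (hg.measurable _).aestronglyMeasurable)
    ((signCLM l).continuous.comp_aestronglyMeasurable (hg.measurable _).aestronglyMeasurable)
  simp only [Pi.mul_def, Function.comp_def] at this
  rw [this, ContinuousLinearMap.integral_comp_comm _ (hg.integrable _), hg.integral_nat_eq_zero]
  simp

lemma integral_mul_self_pos (hg : IsGaussianSequence P g) {n : ℤ} (hn : 0 < n) :
    ∫ ω, g n ω * g n ω ∂P = 0 := by
  rw [hg.integral_comp_pos hn (fun z => z * z) (by fun_prop),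
    integral_stdComplexGaussian_poly _ (by fun_prop) 0 0 1 (-1) (2 * Complex.I) (fun x y => by
      linear_combination ((y : ℂ) ^ 2) * Complex.I_sq)]
  simp

lemma integral_mul_conj_pos (hg : IsGaussianSequence P g) {n : ℤ} (hn : 0 < n) :
    ∫ ω, g n ω * (starRingEnd ℂ) (g n ω) ∂P = 1 := by
  rw [hg.integral_comp_pos hn (fun z => z * (starRingEnd ℂ) z) (by fun_prop),
    integral_stdComplexGaussian_poly _ (by fun_prop) 0 0 1 1 0 (fun x y => by
      simp only [map_add, map_mul, Complex.conj_ofReal, Complex.conj_I]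
      linear_combination (-(y : ℂ) ^ 2) * Complex.I_sq)]
  norm_num

/-- Different `|a|`, `|l|` are independent and centred. For equal moduli the reality condition
reduces to `E g_n² = 0` and `E |g_n|² = 1` for `n > 0`, and to the real variance at `0`. Only
resonant pairs `a + l = 0` correlate. -/
lemma integral_mul (hg : IsGaussianSequence P g) (a l : ℤ) :
    ∫ ω, g a ω * g l ω ∂P = if a + l = 0 then 1 else 0 := by
  by_cases h : a.natAbs = l.natAbs
  swap
  · rw [hg.integral_mul_of_natAbs_ne h, if_neg (by omega)]
  have hneg : ∀ n : ℤ, 0 < n → ∫ ω, g n ω * g (-n) ω ∂P = 1 := fun n hn => by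
    rw [← hg.integral_mul_conj_pos hn]
    refine integral_congr_ae ?_
    filter_upwards [hg.reality n] with ω hω
    rw [hω]
  rcases lt_trichotomy a 0 with ha | rfl | ha
  · by_cases hl : a + l = 0
    · rw [if_pos hl]
      have := hneg l (by omega)
      rw [show -l = a by omega] at this
      rw [← this]
      refine integral_congr_ae (Eventually.of_forall fun ω => mul_comm _ _)
    · rw [if_neg hl]
      obtain rfl : l = a := by omega
      have hn : 0 < -l := by omega
      have e : (fun ω => g l ω * g l ω) =ᵐ[P]
          fun ω => Complex.conjCLE (g (-l) ω * g (-l) ω) := by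
        have := hg.reality (-l)
        rw [neg_neg] at this
        filter_upwards [this] with ω hω
        rw [hω]
        simp
      rw [integral_congr_ae e, ContinuousLinearEquiv.integral_comp_comm,
        hg.integral_mul_self_pos hn, map_zero]
  · obtain rfl : l = 0 := by omega
    rw [hg.integral_comp_zero (fun z => z * z) (by fun_prop)]
    simp only [← pow_two, ← Complex.ofReal_pow]
    rw [integral_complex_ofReal, integral_sq_gaussianReal]
    simp
  · by_cases hl : a + l = 0
    · rw [if_pos hl, show l = -a by omega, hneg a ha]
    · rw [if_neg hl]
      obtain rfl : l = a := by omega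
      exact hg.integral_mul_self_pos ha

/-- The law of `(g_n)_{|n| ≤ N}`. -/
def truncLaw (P : Measure Ω) (g : ℤ → Ω → ℂ) (N : ℕ) :
    Measure (↥(Finset.Icc (-(N : ℤ)) N) → ℂ) :=
  P.map fun ω i => g i ω

lemma measurable_trunc (hg : IsGaussianSequence P g) (N : ℕ) :
    Measurable fun ω => fun i : ↥(Finset.Icc (-(N : ℤ)) N) => g i ω :=
  measurable_pi_lambda _ fun i => hg.measurable i

/-- The vector is almost surely the image of the independent Gaussians `g_0, …, g_N` under a map
which is linear only over `ℝ`, as it conjugates the negative modes. -/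
lemma isGaussian_truncLaw (hg : IsGaussianSequence P g) (N : ℕ) :
    IsGaussian (truncLaw P g N) := by
  have h1 := iIndepFun.hasGaussianLaw (fun i : Fin (N + 1) => hg.hasGaussianLaw_nat i)
    (hg.indep.precomp (g := fun i : Fin (N + 1) => (i : ℕ)) Fin.val_injective)
  let L : (Fin (N + 1) → ℂ) →L[ℝ] (↥(Finset.Icc (-(N : ℤ)) N) → ℂ) :=
    ContinuousLinearMap.pi fun i => (signCLM i).comp (ContinuousLinearMap.proj
      (⟨(i : ℤ).natAbs, by have := Finset.mem_Icc.mp i.2; omega⟩ : Fin (N + 1)))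
  have h2 := h1.map_fun L
  refine (h2.congr ?_).isGaussian_map
  have : ∀ᵐ ω ∂P, ∀ i : ↥(Finset.Icc (-(N : ℤ)) N),
      g i ω = signCLM i (g ((i : ℤ).natAbs : ℤ) ω) :=
    ae_all_iff.mpr fun i => hg.ae_eq_signCLM i
  filter_upwards [this] with ω hω
  funext i
  rw [hω i]
  rfl

/-- Although `g_n` and `g_{-n}` are dependent, `E (g_i conj g_j)` is the identity matrix, so the
covariance bound is an equality. -/
lemma isStdGaussianVector (hg : IsGaussianSequence P g) (N : ℕ) :
    IsStdGaussianVector (truncLaw P g N) where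
  isGaussian := hg.isGaussian_truncLaw N
  integral_eval i := by
    rw [truncLaw, integral_map (hg.measurable_trunc N).aemeasurable
      (Measurable.aestronglyMeasurable (by fun_prop))]
    exact hg.integral_eq_zero i
  integral_normSq_le d := by
    rw [truncLaw, integral_map (hg.measurable_trunc N).aemeasurable
      (Measurable.aestronglyMeasurable (by fun_prop))]
    apply le_of_eq
    have hc : ∀ᵐ ω ∂P, ∀ i : ↥(Finset.Icc (-(N : ℤ)) N),
        (starRingEnd ℂ) (g i ω) = g (-i) ω :=
      ae_all_iff.mpr fun i => (hg.reality i).mono fun ω h => h.symm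
    have e : (fun ω => ((‖∑ i : ↥(Finset.Icc (-(N : ℤ)) N), d i * g i ω‖ ^ 2 : ℝ) : ℂ)) =ᵐ[P]
        fun ω => ∑ i : ↥(Finset.Icc (-(N : ℤ)) N), ∑ j : ↥(Finset.Icc (-(N : ℤ)) N),
          (d i * (starRingEnd ℂ) (d j)) * (g i ω * g (-j) ω) := by
      filter_upwards [hc] with ω hω
      rw [Complex.ofReal_pow, ← Complex.mul_conj', map_sum, Finset.sum_mul_sum]
      refine Finset.sum_congr rfl fun i _ => Finset.sum_congr rfl fun j _ => ?_
      rw [map_mul, hω j]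
      ring
    have key : ((∫ ω, ‖∑ i : ↥(Finset.Icc (-(N : ℤ)) N), d i * g i ω‖ ^ 2 ∂P : ℝ) : ℂ) =
        ((∑ i, ‖d i‖ ^ 2 : ℝ) : ℂ) := by
      rw [← integral_complex_ofReal, integral_congr_ae e, integral_finsetSum _ fun i _ =>
        integrable_finsetSum _ fun j _ => (hg.integrable_mul _ _).const_mul _]
      push_cast
      refine Finset.sum_congr rfl fun i _ => ?_
      rw [integral_finsetSum _ fun j _ => (hg.integrable_mul _ _).const_mul _]
      simp only [integral_const_mul, hg.integral_mul]
      rw [Finset.sum_eq_single i]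
      · simp [Complex.mul_conj']
      · intro j _ hj
        rw [if_neg, mul_zero]
        intro h
        exact hj (Subtype.ext (by omega))
      · simp
    exact_mod_cast key

lemma lintegral_exp_chaos_one_le (hg : IsGaussianSequence P g) (N : ℕ) (d : ℤ → ℂ) {A : ℝ}
    (hA : 0 < A) (hd : ∑ n ∈ Finset.Icc (-(N : ℤ)) N, ‖d n‖ ^ 2 ≤ A ^ 2) :
    ∫⁻ ω, ENNReal.ofReal (Real.exp (‖∑ n ∈ Finset.Icc (-(N : ℤ)) N, d n * g n ω‖ / (8 * A))) ∂P
      ≤ 16 := by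
  have h := (hg.isStdGaussianVector N).lintegral_exp_norm_le (fun i => (A : ℂ)⁻¹ * d i) (by
    simp only [norm_mul, mul_pow, ← Finset.mul_sum]
    rw [Finset.sum_coe_sort _ (fun n => ‖d n‖ ^ 2), norm_inv, Complex.norm_real, Real.norm_eq_abs,
      inv_pow, sq_abs, inv_mul_le_iff₀ (by positivity)]
    linarith)
  rw [truncLaw, lintegral_map (by fun_prop) (hg.measurable_trunc N)] at h
  calc _ ≤ _ := lintegral_mono fun ω => ENNReal.ofReal_le_ofReal (Real.exp_le_exp.mpr ?_)
    _ ≤ _ := h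
    _ ≤ 16 := ?_
  · simp only [mul_assoc, ← Finset.mul_sum]
    rw [Finset.sum_coe_sort _ (fun n => d n * g n ω), norm_mul, norm_inv, Complex.norm_real,
      Real.norm_eq_abs, abs_of_pos hA, inv_mul_eq_div]
    gcongr
    linarith
  · rw [show (16 : ℝ≥0∞) = ENNReal.ofReal 16 by simp]
    apply ENNReal.ofReal_le_ofReal
    have h1 := Real.exp_one_lt_d9
    have h2 : Real.exp 2 = Real.exp 1 * Real.exp 1 := by rw [← Real.exp_add]; norm_num
    rw [h2]
    nlinarith [Real.exp_pos 1]

/-- Vanishing on the resonant pairs `a + l = 0` is what makes the chaos centred; the rest is scaling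
by `A`. -/
lemma lintegral_exp_chaos_two_le (hg : IsGaussianSequence P g) (N : ℕ) (b : ℤ → ℤ → ℂ) {A : ℝ}
    (hA : 0 < A) (hb : ∀ a l, b a l = b l a) (hb0 : ∀ a l, a + l = 0 → b a l = 0)
    (hd : ∑ a ∈ Finset.Icc (-(N : ℤ)) N, ∑ l ∈ Finset.Icc (-(N : ℤ)) N, ‖b a l‖ ^ 2 ≤ A ^ 2) :
    ∫⁻ ω, ENNReal.ofReal (Real.exp (‖∑ a ∈ Finset.Icc (-(N : ℤ)) N,
      ∑ l ∈ Finset.Icc (-(N : ℤ)) N, b a l * g a ω * g l ω‖ / (8 * A))) ∂P ≤ 16 := by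
  have hscale : ∀ x : ↥(Finset.Icc (-(N : ℤ)) N) → ℂ,
      ∑ i : ↥(Finset.Icc (-(N : ℤ)) N), ∑ j : ↥(Finset.Icc (-(N : ℤ)) N),
        ((A : ℂ)⁻¹ * b i j) * x i * x j = (A : ℂ)⁻¹ * ∑ i : ↥(Finset.Icc (-(N : ℤ)) N),
        ∑ j : ↥(Finset.Icc (-(N : ℤ)) N), b i j * x i * x j := by
    intro x
    simp only [Finset.mul_sum, mul_assoc]
  have hsub : ∀ f : ℤ → ℤ → ℂ, ∑ i : ↥(Finset.Icc (-(N : ℤ)) N),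
      ∑ j : ↥(Finset.Icc (-(N : ℤ)) N), f i j =
      ∑ a ∈ Finset.Icc (-(N : ℤ)) N, ∑ l ∈ Finset.Icc (-(N : ℤ)) N, f a l := by
    intro f
    simp only [Finset.sum_coe_sort _ (f _)]
    exact Finset.sum_coe_sort _ (fun a => ∑ l ∈ Finset.Icc (-(N : ℤ)) N, f a l)
  have hsub' : ∀ f : ℤ → ℤ → ℝ, ∑ i : ↥(Finset.Icc (-(N : ℤ)) N),
      ∑ j : ↥(Finset.Icc (-(N : ℤ)) N), f i j =
      ∑ a ∈ Finset.Icc (-(N : ℤ)) N, ∑ l ∈ Finset.Icc (-(N : ℤ)) N, f a l := by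
    intro f
    simp only [Finset.sum_coe_sort _ (f _)]
    exact Finset.sum_coe_sort _ (fun a => ∑ l ∈ Finset.Icc (-(N : ℤ)) N, f a l)
  have hmean : ∫ x, ∑ i : ↥(Finset.Icc (-(N : ℤ)) N), ∑ j : ↥(Finset.Icc (-(N : ℤ)) N),
      ((A : ℂ)⁻¹ * b i j) * x i * x j ∂(truncLaw P g N) = 0 := by
    rw [truncLaw, integral_map (hg.measurable_trunc N).aemeasurable
      (Measurable.aestronglyMeasurable (by fun_prop))]
    simp only [mul_assoc]
    rw [integral_finsetSum _ fun i _ => integrable_finsetSum _ fun j _ =>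
      ((hg.integrable_mul _ _).const_mul _).const_mul _]
    refine Finset.sum_eq_zero fun i _ => ?_
    rw [integral_finsetSum _ fun j _ => ((hg.integrable_mul _ _).const_mul _).const_mul _]
    refine Finset.sum_eq_zero fun j _ => ?_
    rw [integral_const_mul, integral_const_mul, hg.integral_mul]
    split_ifs with hij
    · rw [hb0 _ _ hij, zero_mul, mul_zero]
    · rw [mul_zero, mul_zero]
  have h := (hg.isStdGaussianVector N).lintegral_exp_norm_bilin_le (fun i j => (A : ℂ)⁻¹ * b i j)
    (fun i j => by rw [hb]) hmean
    (by
      simp only [norm_mul, mul_pow, ← Finset.mul_sum]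
      rw [hsub' fun a l => ‖b a l‖ ^ 2, norm_inv, Complex.norm_real, Real.norm_eq_abs,
        inv_pow, sq_abs, inv_mul_le_iff₀ (by positivity)]
      linarith)
  rw [truncLaw, lintegral_map (by fun_prop) (hg.measurable_trunc N)] at h
  calc _ ≤ _ := lintegral_mono fun ω => ENNReal.ofReal_le_ofReal (Real.exp_le_exp.mpr ?_)
    _ ≤ _ := h
    _ ≤ 16 := by norm_num
  rw [hscale, hsub fun a l => b a l * g a ω * g l ω, norm_mul, norm_inv, Complex.norm_real,
    Real.norm_eq_abs, abs_of_pos hA, inv_mul_eq_div, div_div, mul_comm A]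

end IsGaussianSequence

/-! ### Trigonometric polynomials -/

lemma norm_fourier_apply (n : ℤ) (x : Torus) : ‖fourier n x‖ = 1 := by
  rw [fourier_apply]; exact Circle.norm_coe _

lemma fourier_coe_two_pi (n : ℤ) (y : ℝ) :
    fourier n (y : Torus) = Complex.exp (Complex.I * ((n * y : ℝ) : ℂ)) := by
  rw [fourier_coe_apply]
  congr 1
  have : (Real.pi : ℂ) ≠ 0 := by exact_mod_cast Real.pi_ne_zero
  push_cast
  field_simp

lemma norm_fourier_sub_le (n : ℤ) (y y' : ℝ) :
    ‖fourier n (y : Torus) - fourier n (y' : Torus)‖ ≤ |(n : ℝ)| * |y - y'| := by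
  have e : fourier n (y : Torus) - fourier n (y' : Torus) =
      Complex.exp (Complex.I * ((n * y' : ℝ) : ℂ)) *
        (Complex.exp (Complex.I * ((n * (y - y') : ℝ) : ℂ)) - 1) := by
    rw [fourier_coe_two_pi, fourier_coe_two_pi, mul_sub, ← Complex.exp_add, mul_one]
    congr 2
    push_cast; ring
  rw [e, norm_mul, Complex.norm_exp_I_mul_ofReal, one_mul, ← abs_mul]
  exact Real.norm_exp_I_mul_ofReal_sub_one_le

lemma continuous_trigPoly (S : Finset ℤ) (c : ℤ → ℂ) :
    Continuous fun x : Torus => ∑ n ∈ S, c n * fourier n x := by fun_prop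

lemma integrable_of_continuous {f : Torus → ℂ} (hf : Continuous f) :
    Integrable f (AddCircle.haarAddCircle : Measure Torus) :=
  hf.integrable_of_hasCompactSupport (HasCompactSupport.of_compactSpace f)

lemma fourierCoeff_trigPoly (S : Finset ℤ) (c : ℤ → ℂ) (m : ℤ) :
    fourierCoeff (fun x : Torus => ∑ n ∈ S, c n * fourier n x) m = if m ∈ S then c m else 0 := by
  have e : (fun x : Torus => ∑ n ∈ S, c n * fourier n x) =
      ∑ n ∈ S, fun x : Torus => c n * fourier n x := by
    funext x; simp
  rw [e, fourierCoeff.sum _ _ fun n _ => integrable_of_continuous (by fun_prop)]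
  simp only [Finset.sum_apply, fourierCoeff.const_mul, fourierCoeff_fourier, Pi.single_apply,
    mul_ite, mul_one, mul_zero, Finset.sum_ite_eq]

lemma norm_fourierCoeff_le {f : Torus → ℂ} {M : ℝ} (hf : ∀ x, ‖f x‖ ≤ M) (n : ℤ) :
    ‖fourierCoeff f n‖ ≤ M := by
  have h := norm_integral_le_of_norm_le_const (μ := (AddCircle.haarAddCircle : Measure Torus))
    (f := fun t => fourier (-n) t • f t) (C := M)
    (Eventually.of_forall fun x => by rw [norm_smul, norm_fourier_apply, one_mul]; exact hf x)
  simpa [fourierCoeff] using h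

/-- A trigonometric polynomial of degree `D` is controlled by its values on a fine grid. -/
lemma norm_trigPoly_le_of_grid (S : Finset ℤ) (c : ℤ → ℂ) (D L : ℕ) (hD : 1 ≤ D)
    (hS : ∀ n ∈ S, n.natAbs ≤ D) (hL : 40 * D ^ 2 ≤ L) {B : ℝ}
    (hB : ∀ l : ℕ, l < L → ‖∑ n ∈ S, c n * fourier n ((2 * Real.pi * l / L : ℝ) : Torus)‖ ≤ B)
    (x : Torus) : ‖∑ n ∈ S, c n * fourier n x‖ ≤ 2 * B := by
  -- A crude Bernstein argument: every coefficient is at most the maximum `M`, so moving from a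
  -- maximum point to the nearest grid point on its left changes the polynomial by at most `(2D + 1)
  -- D M · 2π/L ≤ M/2`, and this is absorbed.
  obtain ⟨x₀, -, hx₀⟩ := isCompact_univ.exists_isMaxOn (Set.univ_nonempty (α := Torus))
    (continuous_trigPoly S c).norm.continuousOn
  set M : ℝ := ‖∑ n ∈ S, c n * fourier n x₀‖ with hM
  have hmax : ∀ x : Torus, ‖∑ n ∈ S, c n * fourier n x‖ ≤ M := fun x => hx₀ (Set.mem_univ x)
  have hc : ∀ n ∈ S, ‖c n‖ ≤ M := by
    intro n hn
    have := norm_fourierCoeff_le hmax n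
    rwa [fourierCoeff_trigPoly, if_pos hn] at this
  obtain ⟨y, hy, rfl⟩ : ∃ y ∈ Set.Ico (0 : ℝ) (2 * Real.pi), (y : Torus) = x₀ := by
    have := AddCircle.coe_equivIco (p := 2 * Real.pi) (a := 0) (y := x₀)
    exact ⟨_, by simpa using (AddCircle.equivIco (2 * Real.pi) 0 x₀).2, this⟩
  have hL0 : 0 < L := by nlinarith
  have hLr : (0 : ℝ) < L := by exact_mod_cast hL0
  have hpi := Real.pi_pos
  set l : ℕ := ⌊y * L / (2 * Real.pi)⌋₊ with hl
  have hl1 : (l : ℝ) ≤ y * L / (2 * Real.pi) := Nat.floor_le (by have := hy.1; positivity)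
  have hl2 : y * L / (2 * Real.pi) < l + 1 := Nat.lt_floor_add_one _
  have hlL : l < L := by
    have : (l : ℝ) < L := by
      refine hl1.trans_lt ?_
      rw [div_lt_iff₀ (by positivity)]
      nlinarith [hy.2]
    exact_mod_cast this
  have hdist : |y - 2 * Real.pi * l / L| ≤ 2 * Real.pi / L := by
    rw [le_div_iff₀ (by positivity)] at hl1
    rw [div_lt_iff₀ (by positivity)] at hl2
    rw [abs_of_nonneg]
    · rw [sub_le_iff_le_add, ← add_div, le_div_iff₀ hLr]
      nlinarith
    · rw [sub_nonneg, div_le_iff₀ hLr]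
      nlinarith
  have hcard : (S.card : ℝ) ≤ 2 * D + 1 := by
    have : S ⊆ Finset.Icc (-(D : ℤ)) D := fun n hn => by
      have := hS n hn
      rw [Finset.mem_Icc]; omega
    have := Finset.card_le_card this
    rw [Int.card_Icc] at this
    have h3 : S.card ≤ 2 * D + 1 := by omega
    exact_mod_cast h3
  have hM0 : 0 ≤ M := norm_nonneg _
  have hdiff : ‖(∑ n ∈ S, c n * fourier n (y : Torus)) -
      ∑ n ∈ S, c n * fourier n ((2 * Real.pi * l / L : ℝ) : Torus)‖ ≤ M / 2 := by
    rw [← Finset.sum_sub_distrib]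
    calc _ ≤ ∑ n ∈ S, M * (D * (2 * Real.pi / L)) := by
          refine norm_sum_le_of_le _ fun n hn => ?_
          rw [← mul_sub, norm_mul]
          refine mul_le_mul (hc n hn) ((norm_fourier_sub_le _ _ _).trans ?_) (norm_nonneg _) hM0
          refine mul_le_mul ?_ hdist (abs_nonneg _) (by positivity)
          have := hS n hn
          rw [← Int.cast_abs, Int.abs_eq_natAbs]
          exact_mod_cast this
      _ = S.card * (M * (D * (2 * Real.pi / L))) := by rw [Finset.sum_const, nsmul_eq_mul]
      _ ≤ (2 * D + 1) * (M * (D * (2 * Real.pi / L))) := by gcongr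
      _ = M * ((2 * D + 1) * D * (2 * Real.pi) / L) := by ring
      _ ≤ M * (1 / 2) := by
          apply mul_le_mul_of_nonneg_left _ hM0
          rw [div_le_div_iff₀ hLr (by norm_num)]
          have h1 : (40 : ℝ) * D ^ 2 ≤ L := by exact_mod_cast hL
          have h2 : (1 : ℝ) ≤ D := by exact_mod_cast hD
          have h3 := Real.pi_lt_d2
          have h4 : (2 * (D : ℝ) + 1) * D ≤ 3 * D ^ 2 := by nlinarith
          have h5 : (2 * (D : ℝ) + 1) * D * (2 * Real.pi) ≤ 3 * D ^ 2 * (2 * 3.15) := by gcongr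
          nlinarith
      _ = M / 2 := by ring
  have hfin : M ≤ M / 2 + B := by
    calc M = ‖((∑ n ∈ S, c n * fourier n (y : Torus)) -
        ∑ n ∈ S, c n * fourier n ((2 * Real.pi * l / L : ℝ) : Torus)) +
        ∑ n ∈ S, c n * fourier n ((2 * Real.pi * l / L : ℝ) : Torus)‖ := by rw [sub_add_cancel]
      _ ≤ _ := (norm_add_le _ _).trans (add_le_add hdiff (hB l hlL))
  linarith [hmax x]

/-! ### Trigonometric polynomials as elements of the Sobolev space -/

namespace SobolevInfty

variable {s : ℝ}

lemma coeff_smul (c : ℂ) (u : SobolevInfty s) : (c • u).coeff = c • u.coeff := rfl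

/-- `coeff` as a linear map. -/
def coeffLM (s : ℝ) : SobolevInfty s →ₗ[ℂ] (ℤ → ℂ) where
  toFun := coeff
  map_add' _ _ := rfl
  map_smul' _ _ := rfl

lemma isBesselPotential_trig (s : ℝ) (S : Finset ℤ) (c : ℤ → ℂ) :
    IsBesselPotential s (fun n => if n ∈ S then c n else 0)
      (ContinuousMap.toLp (E := ℂ) ∞ (AddCircle.haarAddCircle : Measure Torus) ℂ
      (∑ n ∈ S, (((japanese n ^ s : ℝ) : ℂ) * c n) • fourier n)) := by
  intro m
  rw [fourierCoeff_congr_ae (ContinuousMap.coeFn_toLp _ _)]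
  have := fourierCoeff_trigPoly S (fun n => ((japanese n ^ s : ℝ) : ℂ) * c n) m
  simp only [ContinuousMap.coe_sum, ContinuousMap.coe_smul]
  convert this using 2
  · funext x; simp
  · split_ifs <;> simp

/-- The trigonometric polynomial with coefficients `c n`, `n ∈ S`. -/
def trig (s : ℝ) (S : Finset ℤ) (c : ℤ → ℂ) : SobolevInfty s :=
  mk _ _ (isBesselPotential_trig s S c)

lemma coeff_trig (S : Finset ℤ) (c : ℤ → ℂ) (n : ℤ) :
    (trig s S c).coeff n = if n ∈ S then c n else 0 := rfl

lemma norm_trig_le (S : Finset ℤ) (c : ℤ → ℂ) {M : ℝ}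
    (hM : ∀ x : Torus, ‖∑ n ∈ S, (((japanese n ^ s : ℝ) : ℂ) * c n) * fourier n x‖ ≤ M) :
    ‖trig s S c‖ ≤ M := by
  have hM0 : 0 ≤ M := (norm_nonneg _).trans (hM 0)
  rw [trig, norm_mk]
  refine (Lp.norm_le_of_ae_bound hM0 ?_).trans (le_of_eq ?_)
  · filter_upwards [ContinuousMap.coeFn_toLp (p := ∞) (𝕜 := ℂ)
      (AddCircle.haarAddCircle : Measure Torus)
      (∑ n ∈ S, (((japanese n ^ s : ℝ) : ℂ) * c n) • fourier n)] with x hx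
    rw [hx]
    simpa using hM x
  · simp

/-- Continuity of the Fourier coefficients, by which limits in norm are later identified. -/
lemma norm_coeff_le (u : SobolevInfty s) (n : ℤ) :
    ‖u.coeff n‖ ≤ (japanese n ^ s)⁻¹ * ‖u‖ := by
  have hp : 0 < japanese n ^ s := Real.rpow_pos_of_pos (japanese_pos n) s
  have h := bessel_spec u n
  have h2 : ‖fourierCoeff (bessel u : Torus → ℂ) n‖ ≤ ‖bessel u‖ := by
    have hb : ∀ᵐ x ∂(AddCircle.haarAddCircle : Measure Torus),
        ‖(bessel u : Torus → ℂ) x‖ ≤ ‖bessel u‖ := by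
      have htop := (Lp.memLp (bessel u)).2.ne
      filter_upwards [ae_le_eLpNormEssSup (f := (bessel u : Torus → ℂ))] with x hx
      rw [Lp.norm_def, ← toReal_enorm]
      refine ENNReal.toReal_mono htop ?_
      rwa [eLpNorm_exponent_top]
    have h := norm_integral_le_of_norm_le_const (μ := (AddCircle.haarAddCircle : Measure Torus))
      (f := fun t => fourier (-n) t • (bessel u : Torus → ℂ) t) (C := ‖bessel u‖)
      (hb.mono fun x hx => by rw [norm_smul, norm_fourier_apply, one_mul]; exact hx)
    simpa [fourierCoeff] using h
  rw [h, norm_mul, Complex.norm_real, Real.norm_eq_abs, abs_of_pos hp, ← norm_def] at h2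
  rw [← div_eq_inv_mul, le_div_iff₀ hp, mul_comm]
  exact h2

end SobolevInfty

/-! ### Exponential moments of random trigonometric paths -/

/-- The fundamental theorem of calculus bounds `‖f t‖` by the integral of `‖f 0‖`, `‖f'‖` against a
Dirac mass plus Lebesgue measure on `[0,T]`. The total mass is `1 + T`, so Jensen applies after
normalisation. The right side no longer involves `t`, so no supremum in time has to be integrated.
-/
lemma exp_norm_le_average {f f' : ℝ → ℂ} (hf : ∀ t, HasDerivAt f (f' t) t) (hf' : Continuous f')
    {a T t : ℝ} (ha : 0 ≤ a) (hT : 0 < T) (ht : t ∈ Set.Icc 0 T) :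
    Real.exp (a * ‖f t‖ / (1 + T)) ≤
      (Real.exp (a * ‖f 0‖) + ∫ s in (0 : ℝ)..T, Real.exp (a * ‖f' s‖)) / (1 + T) := by
  have hbound : ‖f t‖ ≤ ‖f 0‖ + ∫ s in (0 : ℝ)..T, ‖f' s‖ := by
    have h1 : ∫ s in (0 : ℝ)..t, f' s = f t - f 0 :=
      intervalIntegral.integral_eq_sub_of_hasDerivAt (fun s _ => hf s)
        (hf'.intervalIntegrable _ _)
    have h2 : ‖f t - f 0‖ ≤ ∫ s in (0 : ℝ)..t, ‖f' s‖ := by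
      rw [← h1]; exact intervalIntegral.norm_integral_le_integral_norm ht.1
    have h3 : ∫ s in (0 : ℝ)..t, ‖f' s‖ ≤ ∫ s in (0 : ℝ)..T, ‖f' s‖ := by
      refine intervalIntegral.integral_mono_interval le_rfl ht.1 ht.2
        (Eventually.of_forall fun s => norm_nonneg _) (hf'.norm.intervalIntegrable _ _)
    have h4 := norm_sub_norm_le (f t) (f 0)
    linarith
  have hT1 : 0 < 1 + T := by linarith
  set m : ℝ := (a * ‖f 0‖ + ∫ s in (0 : ℝ)..T, a * ‖f' s‖) / (1 + T) with hm
  have hle : a * ‖f t‖ / (1 + T) ≤ m := by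
    rw [hm, intervalIntegral.integral_const_mul, ← mul_add]
    gcongr
  refine (Real.exp_le_exp.mpr hle).trans ?_
  rw [le_div_iff₀ hT1]
  -- Jensen by hand: the tangent line of `exp` at the mean `m` is integrated against the Dirac mass
  -- and Lebesgue measure separately.
  have tangent : ∀ y : ℝ, Real.exp m * (1 + y - m) ≤ Real.exp y := by
    intro y
    have := Real.add_one_le_exp (y - m)
    calc Real.exp m * (1 + y - m) ≤ Real.exp m * Real.exp (y - m) := by gcongr; linarith
      _ = Real.exp y := by rw [← Real.exp_add]; ring_nf
  have h1 := tangent (a * ‖f 0‖)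
  have h2 : ∫ s in (0 : ℝ)..T, Real.exp m * (1 + a * ‖f' s‖ - m) ≤
      ∫ s in (0 : ℝ)..T, Real.exp (a * ‖f' s‖) := by
    refine intervalIntegral.integral_mono_on hT.le ?_ ?_ fun s _ => tangent _
    · exact Continuous.intervalIntegrable (by fun_prop) _ _
    · exact Continuous.intervalIntegrable (by fun_prop) _ _
  have h3 : ∫ s in (0 : ℝ)..T, Real.exp m * (1 + a * ‖f' s‖ - m) =
      Real.exp m * (T * (1 - m) + ∫ s in (0 : ℝ)..T, a * ‖f' s‖) := by
    rw [intervalIntegral.integral_const_mul]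
    congr 1
    have : ∀ s, 1 + a * ‖f' s‖ - m = (1 - m) + a * ‖f' s‖ := fun s => by ring
    simp only [this]
    rw [intervalIntegral.integral_add (by simp)
      (Continuous.intervalIntegrable (by fun_prop) _ _)]
    simp
    ring
  rw [h3] at h2
  have h4 : m * (1 + T) = a * ‖f 0‖ + ∫ s in (0 : ℝ)..T, a * ‖f' s‖ := by
    rw [hm, div_mul_cancel₀ _ hT1.ne']
  calc Real.exp m * (1 + T) = Real.exp m * (1 + a * ‖f 0‖ - m) +
      Real.exp m * (T * (1 - m) + ∫ s in (0 : ℝ)..T, a * ‖f' s‖) := by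
        linear_combination (Real.exp m) * h4
    _ ≤ _ := add_le_add h1 h2

/-- The frequencies of `S` in the `j`-th dyadic block. -/
def block (S : Finset ℤ) (j : ℕ) : Finset ℤ := S.filter fun n => Nat.log 2 n.natAbs = j

/-- The constant `∑ⱼ (j + 1) q⁻ʲ`. -/
def blockConst (q : ℝ) : ℝ := ∑' j : ℕ, ((j : ℝ) + 1) * q⁻¹ ^ j

lemma summable_blockConst {q : ℝ} (hq : 1 < q) :
    Summable fun j : ℕ => ((j : ℝ) + 1) * q⁻¹ ^ j := by
  have hr : ‖q⁻¹‖ < 1 := by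
    rw [norm_inv, Real.norm_eq_abs, abs_of_pos (by linarith)]
    exact inv_lt_one_of_one_lt₀ hq
  have h1 := summable_pow_mul_geometric_of_norm_lt_one 1 hr
  have h0 := summable_pow_mul_geometric_of_norm_lt_one 0 hr
  refine (h1.add h0).congr fun j => ?_
  simp; ring

lemma sum_le_blockConst {q : ℝ} (hq : 1 < q) (J : ℕ) :
    ∑ j ∈ Finset.range J, ((j : ℝ) + 1) * q⁻¹ ^ j ≤ blockConst q :=
  (summable_blockConst hq).sum_le_tsum _ fun j _ => by
    have : 0 < q := by linarith
    positivity

lemma one_le_blockConst {q : ℝ} (hq : 1 < q) : 1 ≤ blockConst q := by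
  simpa using sum_le_blockConst hq 1

lemma sum_pow_le_blockConst {q : ℝ} (hq : 1 < q) (J : ℕ) :
    ∑ j ∈ Finset.range J, q⁻¹ ^ j ≤ blockConst q := by
  have : 0 < q := by linarith
  refine le_trans (Finset.sum_le_sum fun j _ => ?_) (sum_le_blockConst hq J)
  exact le_mul_of_one_le_left (by positivity) (by linarith [(Nat.cast_nonneg j : (0 : ℝ) ≤ j)])

lemma sum_block {M : Type*} [AddCommMonoid M] (S : Finset ℤ) (J : ℕ)
    (hJ : ∀ n ∈ S, Nat.log 2 n.natAbs < J) (f : ℤ → M) :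
    ∑ j ∈ Finset.range J, ∑ n ∈ block S j, f n = ∑ n ∈ S, f n :=
  Finset.sum_fiberwise_of_maps_to (fun n hn => Finset.mem_range.mpr (hJ n hn)) f

/-- Grid points used for the `j`-th block. -/
def gridPoint (j l : ℕ) : Torus := ((2 * Real.pi * l / (256 ^ (j + 1) : ℕ) : ℝ) : Torus)

lemma norm_block_le_of_grid (S : Finset ℤ) (c : ℤ → ℂ) (j : ℕ) {B : ℝ}
    (hB : ∀ l ∈ Finset.range (256 ^ (j + 1)),
      ‖∑ n ∈ block S j, c n * fourier n (gridPoint j l)‖ ≤ B) (x : Torus) :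
    ‖∑ n ∈ block S j, c n * fourier n x‖ ≤ 2 * B := by
  refine norm_trigPoly_le_of_grid (block S j) c (2 ^ (j + 1)) (256 ^ (j + 1)) Nat.one_le_two_pow
    (fun n hn => ?_) ?_ (fun l hl => hB l (Finset.mem_range.mpr hl)) x
  · have h := (Finset.mem_filter.mp hn).2
    have := Nat.lt_pow_succ_log_self (b := 2) (by norm_num) n.natAbs
    rw [h] at this
    exact this.le
  · have h1 : (256 : ℕ) ^ (j + 1) = 64 ^ (j + 1) * (2 ^ (j + 1)) ^ 2 := by
      rw [← pow_mul, mul_comm (j + 1) 2, pow_mul, ← mul_pow]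
      norm_num
    rw [h1]
    gcongr
    calc 40 ≤ 64 ^ 1 := by norm_num
      _ ≤ 64 ^ (j + 1) := Nat.pow_le_pow_right (by norm_num) (by omega)

/-- A single `G j` dominates the exponentials at all `256^{j+1}` grid points, so block `j` has sup
norm at most `2 (1 + T) q⁻ʲ log (G j)`. The union over the grid costs `(j + 1) log 256`, which
remains summable against `q⁻ʲ`. The remaining logarithms are averaged with weights `q⁻ʲ / blockConst
q`, so that `exp` turns them into a linear expression in the `G j`, whose expectation is accessible.
-/
lemma exp_norm_le_of_blocks {q : ℝ} (hq : 1 < q) {T s : ℝ} (hT : 0 < T) (S : Finset ℤ)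
    (c : ℝ → ℤ → ℂ) (F : CW T s)
    (hF : ∀ t n, (F t).coeff n = if n ∈ S then c t n else 0) (J : ℕ)
    (hJ : ∀ n ∈ S, Nat.log 2 n.natAbs < J) (G : ℕ → ℝ)
    (hG : ∀ j, ∀ l ∈ Finset.range (256 ^ (j + 1)), ∀ t ∈ Set.Icc 0 T,
      Real.exp (q ^ j * ‖∑ n ∈ block S j, (((japanese n ^ s : ℝ) : ℂ) * c t n) *
        fourier n (gridPoint j l)‖ / (1 + T)) ≤ G j) :
    Real.exp (‖F‖ / (2 * (1 + T) * blockConst q)) ≤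
      256 * (1 + ∑ j ∈ Finset.range J, (q⁻¹ ^ j / blockConst q) *
        (1 + G j / 256 ^ (j + 1))) := by
  -- `V j` below is `G j` divided by the number of grid points, plus `1` to keep its logarithm
  -- nonnegative.
  have hq0 : 0 < q := by linarith
  have hT1 : 0 < 1 + T := by linarith
  set W := blockConst q with hW
  have hW1 : 1 ≤ W := one_le_blockConst hq
  have hG1 : ∀ j, 1 ≤ G j := fun j => by
    refine le_trans (Real.one_le_exp (by positivity)) (hG j 0 (by simp) 0 ⟨le_rfl, hT.le⟩)
  set V : ℕ → ℝ := fun j => 1 + G j / 256 ^ (j + 1) with hV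
  have hV0 : ∀ j, 0 < V j := fun j => by
    have := hG1 j
    simp only [V]; positivity
  have hlog : ∀ j, Real.log (G j) ≤ (j + 1) * Real.log 256 + Real.log (V j) := by
    intro j
    have h0 : (0 : ℝ) < 256 ^ (j + 1) := by positivity
    have : G j ≤ 256 ^ (j + 1) * V j := by
      simp only [V]
      rw [mul_add, mul_div_cancel₀ _ h0.ne']
      linarith
    calc Real.log (G j) ≤ Real.log (256 ^ (j + 1) * V j) :=
          Real.log_le_log (by linarith [hG1 j]) this
      _ = _ := by
          rw [Real.log_mul h0.ne' (hV0 j).ne', Real.log_pow]; push_cast; ring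
  have hblock : ∀ j, ∀ t ∈ Set.Icc 0 T, ∀ x : Torus,
      ‖∑ n ∈ block S j, (((japanese n ^ s : ℝ) : ℂ) * c t n) * fourier n x‖ ≤
        2 * ((1 + T) * (q⁻¹ ^ j * Real.log (G j))) := by
    intro j t ht x
    refine norm_block_le_of_grid S _ j (fun l hl => ?_) x
    have h := hG j l hl t ht
    rw [← Real.le_log_iff_exp_le (by linarith [hG1 j]), div_le_iff₀ hT1] at h
    rw [inv_pow, ← mul_assoc, mul_comm (1 + T), mul_assoc, ← div_eq_inv_mul,
      le_div_iff₀ (by positivity)]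
    linarith
  have hnorm : ‖F‖ ≤ 2 * (1 + T) * (W * Real.log 256 +
      ∑ j ∈ Finset.range J, q⁻¹ ^ j * Real.log (V j)) := by
    have hsum : ∑ j ∈ Finset.range J, 2 * ((1 + T) * (q⁻¹ ^ j * Real.log (G j))) ≤
        2 * (1 + T) * (W * Real.log 256 + ∑ j ∈ Finset.range J, q⁻¹ ^ j * Real.log (V j)) := by
      simp only [← mul_assoc 2 (1 + T)]
      rw [← Finset.mul_sum]
      refine mul_le_mul_of_nonneg_left ?_ (by positivity)
      calc ∑ j ∈ Finset.range J, q⁻¹ ^ j * Real.log (G j)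
          ≤ ∑ j ∈ Finset.range J, (((j : ℝ) + 1) * q⁻¹ ^ j * Real.log 256 +
              q⁻¹ ^ j * Real.log (V j)) := by
            refine Finset.sum_le_sum fun j _ => ?_
            have : q⁻¹ ^ j * Real.log (G j) ≤
              q⁻¹ ^ j * ((j + 1) * Real.log 256 + Real.log (V j)) := by gcongr; exact hlog j
            linarith
        _ ≤ _ := by
            rw [Finset.sum_add_distrib, ← Finset.sum_mul]
            have := sum_le_blockConst hq J
            have h2 : 0 ≤ Real.log 256 := Real.log_nonneg (by norm_num)
            gcongr
    have hnn : 0 ≤ ∑ j ∈ Finset.range J, 2 * ((1 + T) * (q⁻¹ ^ j * Real.log (G j))) :=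
      Finset.sum_nonneg fun j _ => by
        have := Real.log_nonneg (hG1 j)
        positivity
    refine ((ContinuousMap.norm_le _ hnn).mpr fun t => ?_).trans hsum
    have hFt : F t = SobolevInfty.trig s S (c t) := by
      apply SobolevInfty.coeff_injective
      funext n
      rw [hF, SobolevInfty.coeff_trig]
    rw [hFt]
    refine SobolevInfty.norm_trig_le _ _ fun x => ?_
    rw [← sum_block S J hJ]
    exact norm_sum_le_of_le _ fun j _ => hblock j t t.2 x
  have hpsum : ∑ j ∈ Finset.range J, q⁻¹ ^ j / W ≤ 1 := by
    rw [← Finset.sum_div, div_le_one (by linarith)]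
    exact sum_pow_le_blockConst hq J
  have hdiv : ‖F‖ / (2 * (1 + T) * W) ≤ Real.log 256 +
      ∑ j ∈ Finset.range J, (q⁻¹ ^ j / W) * Real.log (V j) := by
    rw [div_le_iff₀ (by positivity)]
    refine hnorm.trans (le_of_eq ?_)
    simp only [div_mul_eq_mul_div]
    rw [← Finset.sum_div]
    have : W ≠ 0 := by linarith
    field_simp
  refine (Real.exp_le_exp.mpr hdiv).trans ?_
  rw [Real.exp_add, Real.exp_log (by norm_num)]
  gcongr
  -- The weights sum to at most `1`; the missing mass is placed at the point `0`, where `exp` is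
  -- `1`.
  have hj := convexOn_exp.map_add_sum_le (t := Finset.range J) (w := fun j => q⁻¹ ^ j / W)
    (v := 1 - ∑ j ∈ Finset.range J, q⁻¹ ^ j / W) (q := 0) (p := fun j => Real.log (V j))
    (fun j _ => by positivity) (by ring) (fun _ _ => Set.mem_univ _) (by linarith)
    (Set.mem_univ _)
  simp only [smul_eq_mul, mul_zero, zero_add, Real.exp_zero, mul_one, Real.exp_log (hV0 _)] at hj
  refine hj.trans ?_
  have : 0 ≤ ∑ j ∈ Finset.range J, q⁻¹ ^ j / W := Finset.sum_nonneg fun j _ => by positivity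
  linarith

/-- From pointwise exponential moments to the norm of a path. `H` is the Jensen average in time at
one point, with expectation at most `16`, and `G` sums it over the grid of a block. After division
by the number of grid points each block contributes at most `17`, whence `256 · (1 + 17) = 4608`,
independently of `S`. -/
theorem lintegral_exp_norm_path_le {Ω : Type*} [MeasurableSpace Ω] (P : Measure Ω)
    [IsProbabilityMeasure P] {q : ℝ} (hq : 1 < q) {T s : ℝ} (hT : 0 < T) (S : Finset ℤ)
    (c c' : Ω → ℝ → ℤ → ℂ) (hderiv : ∀ ω n t, HasDerivAt (fun t => c ω t n) (c' ω t n) t)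
    (hcont : ∀ ω n, Continuous fun t => c' ω t n)
    (hm0 : ∀ n, Measurable fun ω => c ω 0 n)
    (hm : ∀ n, Measurable fun p : Ω × ℝ => c' p.1 p.2 n)
    (h0 : ∀ j (x : Torus), ∫⁻ ω, ENNReal.ofReal (Real.exp (q ^ j * ‖∑ n ∈ block S j,
      (((japanese n ^ s : ℝ) : ℂ) * c ω 0 n) * fourier n x‖)) ∂P ≤ 16)
    (h1 : ∀ t j (x : Torus), ∫⁻ ω, ENNReal.ofReal (Real.exp (q ^ j * ‖∑ n ∈ block S j,
      (((japanese n ^ s : ℝ) : ℂ) * c' ω t n) * fourier n x‖)) ∂P ≤ 16)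
    (F : Ω → CW T s) (hF : ∀ ω t n, (F ω t).coeff n = if n ∈ S then c ω t n else 0) :
    ∫⁻ ω, ENNReal.ofReal (Real.exp (‖F ω‖ / (2 * (1 + T) * blockConst q))) ∂P ≤ 4608 := by
  have hq0 : 0 < q := by linarith
  have hT1 : 0 < 1 + T := by linarith
  have hW1 : 1 ≤ blockConst q := one_le_blockConst hq
  set f : Ω → ℝ → ℕ → Torus → ℂ := fun ω t j x => ∑ n ∈ block S j,
      (((japanese n ^ s : ℝ) : ℂ) * c ω t n) * fourier n x with hf
  set f' : Ω → ℝ → ℕ → Torus → ℂ := fun ω t j x => ∑ n ∈ block S j,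
      (((japanese n ^ s : ℝ) : ℂ) * c' ω t n) * fourier n x with hf'
  have hd : ∀ ω j x t, HasDerivAt (fun t => f ω t j x) (f' ω t j x) t := fun ω j x t =>
    HasDerivAt.fun_sum fun n _ => ((hderiv ω n t).const_mul _).mul_const _
  have hc' : ∀ ω j x, Continuous fun t => f' ω t j x := fun ω j x =>
    continuous_finsetSum _ fun n _ => (continuous_const.mul (hcont ω n)).mul continuous_const
  have hfm : ∀ j x, Measurable fun ω => f ω 0 j x := fun j x =>
    Finset.measurable_fun_sum _ fun n _ => ((hm0 n).const_mul _).mul_const _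
  have hfm' : ∀ j x, Measurable fun p : Ω × ℝ => f' p.1 p.2 j x := fun j x =>
    Finset.measurable_fun_sum _ fun n _ => ((hm n).const_mul _).mul_const _
  set H : Ω → ℕ → Torus → ℝ := fun ω j x => (Real.exp (q ^ j * ‖f ω 0 j x‖) +
    ∫ t in (0 : ℝ)..T, Real.exp (q ^ j * ‖f' ω t j x‖)) / (1 + T) with hH
  have hI0 : ∀ ω j x, 0 ≤ ∫ t in (0 : ℝ)..T, Real.exp (q ^ j * ‖f' ω t j x‖) := fun ω j x =>
    intervalIntegral.integral_nonneg hT.le fun t _ => (Real.exp_pos _).le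
  have hH0 : ∀ ω j x, 0 ≤ H ω j x := fun ω j x => by
    have := hI0 ω j x
    simp only [hH]
    positivity
  have hHe : ∀ ω j x, ENNReal.ofReal (H ω j x) = ENNReal.ofReal (1 + T)⁻¹ *
      (ENNReal.ofReal (Real.exp (q ^ j * ‖f ω 0 j x‖)) +
        ∫⁻ t in Set.Ioc 0 T, ENNReal.ofReal (Real.exp (q ^ j * ‖f' ω t j x‖))) := by
    intro ω j x
    simp only [hH]
    rw [div_eq_inv_mul, ENNReal.ofReal_mul (by positivity),
      ENNReal.ofReal_add (Real.exp_pos _).le (hI0 ω j x), intervalIntegral.integral_of_le hT.le,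
      ofReal_integral_eq_lintegral_ofReal]
    · have h := hc' ω j x
      have : Continuous fun t => Real.exp (q ^ j * ‖f' ω t j x‖) := by fun_prop
      exact (this.intervalIntegrable 0 T).1
    · exact Eventually.of_forall fun t => (Real.exp_pos _).le
  have hHm : ∀ j x, Measurable fun ω => ENNReal.ofReal (H ω j x) := by
    intro j x
    simp only [hHe]
    have hfm1 := hfm j x
    have hfm2 := hfm' j x
    have hu : Measurable (Function.uncurry fun (ω : Ω) (t : ℝ) =>
      ENNReal.ofReal (Real.exp (q ^ j * ‖f' ω t j x‖))) := by
      change Measurable fun p : Ω × ℝ => ENNReal.ofReal (Real.exp (q ^ j * ‖f' p.1 p.2 j x‖))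
      fun_prop
    have := hu.lintegral_prod_right' (ν := volume.restrict (Set.Ioc 0 T))
    exact Measurable.const_mul (Measurable.add (by fun_prop) this) _
  have hHint : ∀ j x, ∫⁻ ω, ENNReal.ofReal (H ω j x) ∂P ≤ 16 := by
    intro j x
    simp only [hHe]
    have hfm1 := hfm j x
    have hfm2 := hfm' j x
    have hu : Measurable (Function.uncurry fun (ω : Ω) (t : ℝ) =>
      ENNReal.ofReal (Real.exp (q ^ j * ‖f' ω t j x‖))) := by
      change Measurable fun p : Ω × ℝ => ENNReal.ofReal (Real.exp (q ^ j * ‖f' p.1 p.2 j x‖))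
      fun_prop
    have hum := hu.lintegral_prod_right' (ν := volume.restrict (Set.Ioc 0 T))
    have hm1 : Measurable fun ω => ENNReal.ofReal (Real.exp (q ^ j * ‖f ω 0 j x‖)) := by fun_prop
    have hsum : Measurable fun ω => ENNReal.ofReal (Real.exp (q ^ j * ‖f ω 0 j x‖)) +
        ∫⁻ t in Set.Ioc 0 T, ENNReal.ofReal (Real.exp (q ^ j * ‖f' ω t j x‖)) := hm1.add hum
    rw [lintegral_const_mul _ hsum, lintegral_add_left hm1,
      lintegral_lintegral_swap hu.aemeasurable]
    calc _ ≤ ENNReal.ofReal (1 + T)⁻¹ * (16 + ∫⁻ t in Set.Ioc 0 T, 16) := by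
          gcongr with t
          · exact h0 j x
          · exact h1 t j x
      _ = 16 := by
          rw [setLIntegral_const, Real.volume_Ioc, sub_zero, ← mul_one_add,
            show (1 : ℝ≥0∞) = ENNReal.ofReal 1 by simp, ← ENNReal.ofReal_add (by norm_num) hT.le,
            mul_left_comm, ← ENNReal.ofReal_mul (by positivity), inv_mul_cancel₀ hT1.ne']
          simp
  set G : Ω → ℕ → ℝ := fun ω j => ∑ l ∈ Finset.range (256 ^ (j + 1)), H ω j (gridPoint j l) with hG
  have hGe : ∀ ω j, ENNReal.ofReal (G ω j) = ∑ l ∈ Finset.range (256 ^ (j + 1)),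
      ENNReal.ofReal (H ω j (gridPoint j l)) := fun ω j =>
    ENNReal.ofReal_sum_of_nonneg fun l _ => hH0 _ _ _
  have hGint : ∀ j, ∫⁻ ω, ENNReal.ofReal (G ω j) ∂P ≤ 256 ^ (j + 1) * 16 := by
    intro j
    simp only [hGe]
    rw [lintegral_finsetSum _ fun l _ => hHm _ _]
    calc _ ≤ ∑ l ∈ Finset.range (256 ^ (j + 1)), (16 : ℝ≥0∞) :=
          Finset.sum_le_sum fun l _ => hHint _ _
      _ = _ := by simp
  have hGm : ∀ j, Measurable fun ω => ENNReal.ofReal (G ω j) := fun j => by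
    simp only [hGe]
    exact Finset.measurable_fun_sum _ fun l _ => hHm _ _
  have hG0 : ∀ ω j, 0 ≤ G ω j := fun ω j => Finset.sum_nonneg fun l _ => hH0 _ _ _
  set J : ℕ := (S.sup fun n => Nat.log 2 n.natAbs) + 1 with hJ
  have hJS : ∀ n ∈ S, Nat.log 2 n.natAbs < J := fun n hn =>
    Nat.lt_succ_of_le (Finset.le_sup (f := fun n : ℤ => Nat.log 2 n.natAbs) hn)
  have hp0 : ∀ j : ℕ, 0 ≤ q⁻¹ ^ j / blockConst q := fun j => by positivity
  have hpoint : ∀ ω, ENNReal.ofReal (Real.exp (‖F ω‖ / (2 * (1 + T) * blockConst q))) ≤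
      256 * (1 + ∑ j ∈ Finset.range J, ENNReal.ofReal (q⁻¹ ^ j / blockConst q) *
        (1 + ENNReal.ofReal ((256 ^ (j + 1))⁻¹) * ENNReal.ofReal (G ω j))) := by
    intro ω
    have h := exp_norm_le_of_blocks hq hT S (c ω) (F ω) (hF ω) J hJS (G ω) (fun j l hl t ht => by
      refine (exp_norm_le_average (hd ω j (gridPoint j l)) (hc' ω j (gridPoint j l))
        (by positivity) hT ht).trans ?_
      exact Finset.single_le_sum (f := fun l => H ω j (gridPoint j l))
        (fun l _ => hH0 _ _ _) hl)
    refine (ENNReal.ofReal_le_ofReal h).trans (le_of_eq ?_)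
    have hterm : ∀ j, 0 ≤ (q⁻¹ ^ j / blockConst q) * (1 + G ω j / 256 ^ (j + 1)) := fun j => by
      have := hG0 ω j
      have := hp0 j
      positivity
    rw [ENNReal.ofReal_mul (by norm_num), ENNReal.ofReal_add (by norm_num)
      (Finset.sum_nonneg fun j _ => hterm j), ENNReal.ofReal_sum_of_nonneg fun j _ => hterm j]
    simp only [ENNReal.ofReal_one, ENNReal.ofReal_ofNat]
    congr 2
    refine Finset.sum_congr rfl fun j _ => ?_
    rw [ENNReal.ofReal_mul (hp0 j), ENNReal.ofReal_add (by norm_num)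
      (div_nonneg (hG0 ω j) (by positivity)), div_eq_inv_mul (G ω j),
      ENNReal.ofReal_mul (by positivity), ENNReal.ofReal_one]
  have hone : ∀ j : ℕ, ENNReal.ofReal (((256 : ℝ) ^ (j + 1))⁻¹) * (256 ^ (j + 1) * 16) = 16 := by
    intro j
    rw [ENNReal.ofReal_inv_of_pos (by positivity), ENNReal.ofReal_pow (by norm_num),
      ENNReal.ofReal_ofNat, ← mul_assoc, ENNReal.inv_mul_cancel (by positivity) (by finiteness),
      one_mul]
  calc _ ≤ ∫⁻ ω, 256 * (1 + ∑ j ∈ Finset.range J, ENNReal.ofReal (q⁻¹ ^ j / blockConst q) *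
        (1 + ENNReal.ofReal ((256 ^ (j + 1))⁻¹) * ENNReal.ofReal (G ω j))) ∂P :=
        lintegral_mono hpoint
    _ = 256 * (1 + ∑ j ∈ Finset.range J, ENNReal.ofReal (q⁻¹ ^ j / blockConst q) *
        (1 + ENNReal.ofReal ((256 ^ (j + 1))⁻¹) * ∫⁻ ω, ENNReal.ofReal (G ω j) ∂P)) := by
        have hmj : ∀ j, Measurable fun ω =>
            1 + ENNReal.ofReal ((256 ^ (j + 1))⁻¹) * ENNReal.ofReal (G ω j) := fun j =>
          measurable_const.add ((hGm j).const_mul _)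
        have hsm : Measurable fun ω => ∑ j ∈ Finset.range J,
            ENNReal.ofReal (q⁻¹ ^ j / blockConst q) *
              (1 + ENNReal.ofReal ((256 ^ (j + 1))⁻¹) * ENNReal.ofReal (G ω j)) :=
          Finset.measurable_fun_sum _ fun j _ => (hmj j).const_mul _
        rw [lintegral_const_mul _ (measurable_const.fun_add hsm),
          lintegral_add_left measurable_const,
          lintegral_finsetSum _ fun j _ => (hmj j).const_mul _]
        simp only [lintegral_const, measure_univ, mul_one]
        congr 2
        refine Finset.sum_congr rfl fun j _ => ?_
        rw [lintegral_const_mul _ (hmj j), lintegral_add_left measurable_const,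
          lintegral_const_mul _ (hGm j)]
        simp
    _ ≤ 256 * (1 + ∑ j ∈ Finset.range J, ENNReal.ofReal (q⁻¹ ^ j / blockConst q) * (1 + 16)) := by
        gcongr with j
        exact (mul_le_mul_right (hGint j) _).trans (hone j).le
    _ ≤ 256 * (1 + 1 * (1 + 16)) := by
        rw [← Finset.sum_mul]
        gcongr
        rw [← ENNReal.ofReal_sum_of_nonneg fun j _ => hp0 j, ENNReal.ofReal_le_one,
          ← Finset.sum_div, div_le_one (by linarith)]
        exact sum_pow_le_blockConst hq J
    _ = 4608 := by norm_num

/-! ### Sums of Japanese brackets -/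

lemma one_le_japanese (n : ℤ) : 1 ≤ japanese n := by
  rw [japanese, Real.one_le_sqrt]
  nlinarith [sq_nonneg (n : ℝ)]

lemma abs_le_japanese (n : ℤ) : |(n : ℝ)| ≤ japanese n := by
  rw [japanese, ← Real.sqrt_sq_eq_abs]
  exact Real.sqrt_le_sqrt (by linarith)

lemma japanese_sq (n : ℤ) : japanese n ^ 2 = 1 + (n : ℝ) ^ 2 := by
  rw [japanese, Real.sq_sqrt (by positivity)]

lemma japanese_add_le (a l : ℤ) : japanese (a + l) ≤ japanese a + japanese l := by
  have ha := japanese_pos a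
  have hl := japanese_pos l
  rw [japanese, Real.sqrt_le_left (by positivity)]
  have h1 := japanese_sq a
  have h2 := japanese_sq l
  have h3 : (a : ℝ) * l ≤ japanese a * japanese l := by
    calc (a : ℝ) * l ≤ |(a : ℝ) * l| := le_abs_self _
      _ = |(a : ℝ)| * |(l : ℝ)| := abs_mul _ _
      _ ≤ _ := mul_le_mul (abs_le_japanese a) (abs_le_japanese l) (abs_nonneg _) ha.le
  push_cast
  nlinarith

lemma phi_zero : phi 0 = 0 := by simp [phi]

lemma abs_phi_le (n : ℤ) : |phi n| ≤ (japanese n)⁻¹ := by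
  have h := japanese_pos n
  rw [phi, ← japanese_sq, abs_div, abs_of_pos (by positivity : 0 < japanese n ^ 2),
    div_le_iff₀ (by positivity), pow_two, inv_mul_cancel_left₀ h.ne']
  exact abs_le_japanese n

lemma abs_phi_le_half (n : ℤ) : |phi n| ≤ 1 / 2 := by
  rw [phi, abs_div, abs_of_pos (by positivity : 0 < 1 + (n : ℝ) ^ 2), div_le_iff₀ (by positivity)]
  nlinarith [sq_nonneg (|(n : ℝ)| - 1), sq_abs (n : ℝ)]

lemma summable_japanese_rpow {p : ℝ} (hp : p < -1) : Summable fun n : ℤ => japanese n ^ p := by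
  have h1 := Real.summable_abs_int_rpow (b := -p) (by linarith)
  have h2 : Summable fun n : ℤ => if n = 0 then (1 : ℝ) else 0 :=
    (hasSum_ite_eq (0 : ℤ) (1 : ℝ)).summable
  refine Summable.of_nonneg_of_le (fun n => Real.rpow_nonneg (japanese_pos n).le _)
    (fun n => ?_) (h1.add h2)
  rcases eq_or_ne n 0 with rfl | hn
  · have : japanese 0 = 1 := by simp [japanese]
    rw [this, Real.one_rpow, if_pos rfl, neg_neg]
    have : 0 ≤ |((0 : ℤ) : ℝ)| ^ p := Real.rpow_nonneg (abs_nonneg _) _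
    linarith
  · rw [if_neg hn, add_zero, neg_neg]
    exact Real.rpow_le_rpow_of_nonpos (abs_pos.mpr (by exact_mod_cast hn)) (abs_le_japanese n)
      (by linarith)

/-- `∑ₙ ⟨n⟩^p`. -/
def japaneseSum (p : ℝ) : ℝ := ∑' n : ℤ, japanese n ^ p

lemma sum_japanese_le {p : ℝ} (hp : p < -1) (I : Finset ℤ) :
    ∑ n ∈ I, japanese n ^ p ≤ japaneseSum p :=
  (summable_japanese_rpow hp).sum_le_tsum I fun n _ => Real.rpow_nonneg (japanese_pos n).le _

lemma japaneseSum_pos {p : ℝ} (hp : p < -1) : 0 < japaneseSum p := by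
  have := sum_japanese_le hp {0}
  rw [Finset.sum_singleton] at this
  exact (Real.rpow_pos_of_pos (japanese_pos 0) p).trans_le this

/-- The bracket of a sum is at most twice the larger bracket. Its power `γ` is absorbed by the
larger factor, and since `γ - p ≤ 0` what is left there is at most the same power of the smaller
bracket. -/
lemma japanese_conv_pointwise {p γ : ℝ} (hγ : 0 ≤ γ) (hγp : γ ≤ p) (a l : ℤ) :
    japanese (a + l) ^ γ * (japanese a ^ (-p) * japanese l ^ (-p)) ≤
      2 ^ γ * (japanese a ^ (γ - 2 * p) + japanese l ^ (γ - 2 * p)) := by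
  have key : ∀ n : ℤ, ∀ X Y : ℝ, 0 < X → X ≤ Y → japanese n ≤ X + Y →
      japanese n ^ γ * (X ^ (-p) * Y ^ (-p)) ≤ 2 ^ γ * X ^ (γ - 2 * p) := by
    intro n X Y hX hXY hn
    have hY : 0 < Y := hX.trans_le hXY
    calc japanese n ^ γ * (X ^ (-p) * Y ^ (-p)) ≤ (2 * Y) ^ γ * (X ^ (-p) * Y ^ (-p)) := by
          gcongr
          · exact (japanese_pos n).le
          · linarith
      _ = 2 ^ γ * (X ^ (-p) * Y ^ (γ - p)) := by
          rw [Real.mul_rpow (by norm_num) hY.le, sub_eq_add_neg, Real.rpow_add hY]; ring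
      _ ≤ 2 ^ γ * (X ^ (-p) * X ^ (γ - p)) := by
          have := Real.rpow_le_rpow_of_nonpos hX hXY (by linarith : γ - p ≤ 0)
          gcongr
      _ = _ := by rw [← Real.rpow_add hX]; ring_nf
  have h2 : 0 < (2 : ℝ) ^ γ := by positivity
  have pa := Real.rpow_pos_of_pos (japanese_pos a) (γ - 2 * p)
  have pl := Real.rpow_pos_of_pos (japanese_pos l) (γ - 2 * p)
  rcases le_total (japanese a) (japanese l) with h | h
  · refine (key (a + l) _ _ (japanese_pos a) h (japanese_add_le a l)).trans ?_
    nlinarith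
  · rw [mul_comm (japanese a ^ (-p))]
    refine (key (a + l) _ _ (japanese_pos l) h (by linarith [japanese_add_le a l])).trans ?_
    nlinarith

lemma sum_japanese_conv_le {p γ : ℝ} (hγ : 0 ≤ γ) (hγp : γ ≤ p) (hp : γ - 2 * p < -1)
    (I : Finset ℤ) (n : ℤ) :
    ∑ a ∈ I, japanese a ^ (-p) * japanese (n - a) ^ (-p) ≤
      2 ^ γ * (2 * japaneseSum (γ - 2 * p)) * japanese n ^ (-γ) := by
  have hn : 0 < japanese n ^ γ := Real.rpow_pos_of_pos (japanese_pos n) γ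
  rw [Real.rpow_neg (japanese_pos n).le, ← div_eq_mul_inv, le_div_iff₀ hn, Finset.sum_mul]
  have hinv : ∑ a ∈ I, japanese (n - a) ^ (γ - 2 * p) ≤ japaneseSum (γ - 2 * p) := by
    have := sum_japanese_le hp (I.image fun a => n - a)
    rwa [Finset.sum_image fun a _ b _ h => by simpa using h] at this
  calc ∑ a ∈ I, japanese a ^ (-p) * japanese (n - a) ^ (-p) * japanese n ^ γ
      ≤ ∑ a ∈ I, 2 ^ γ * (japanese a ^ (γ - 2 * p) + japanese (n - a) ^ (γ - 2 * p)) := by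
        refine Finset.sum_le_sum fun a _ => ?_
        have := japanese_conv_pointwise hγ hγp a (n - a)
        rw [add_sub_cancel] at this
        linarith
    _ ≤ _ := by
        rw [← Finset.mul_sum, Finset.sum_add_distrib]
        have := sum_japanese_le hp I
        gcongr
        linarith

lemma pow_le_japanese_rpow {δ : ℝ} (hδ : 0 < δ) {n : ℤ} {j : ℕ} (hj : Nat.log 2 n.natAbs = j) :
    ((2 : ℝ) ^ δ) ^ j ≤ japanese n ^ δ := by
  rw [← Real.rpow_natCast, ← Real.rpow_mul (by norm_num), mul_comm, Real.rpow_mul (by norm_num),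
    Real.rpow_natCast]
  refine Real.rpow_le_rpow (by positivity) ?_ hδ.le
  -- The zero frequency lies in block `0`, because `Nat.log 2 0 = 0`.
  rcases eq_or_ne n 0 with rfl | hn
  · have : j = 0 := by simpa using hj.symm
    rw [this, pow_zero]
    exact one_le_japanese 0
  · have h := Nat.pow_log_le_self 2 (Int.natAbs_ne_zero.mpr hn)
    rw [hj] at h
    have h2 : ((2 ^ j : ℕ) : ℝ) ≤ (n.natAbs : ℝ) := by exact_mod_cast h
    rw [Nat.cast_natAbs, Int.cast_abs] at h2
    push_cast at h2
    exact h2.trans (abs_le_japanese n)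

/-! ### Random linear and bilinear paths -/

/-- The phase `t ↦ e^{-itr}`. -/
def phase (r : ℝ) : C(ℝ, ℂ) :=
  ⟨fun t => Complex.exp (-(Complex.I * (t : ℂ) * (r : ℂ))), by fun_prop⟩

lemma phase_apply (r t : ℝ) : phase r t = Complex.exp (-(Complex.I * (t : ℂ) * (r : ℂ))) := rfl

lemma norm_phase (r t : ℝ) : ‖phase r t‖ = 1 := by
  rw [phase_apply, show -(Complex.I * (t : ℂ) * (r : ℂ)) = Complex.I * ((-(t * r) : ℝ) : ℂ) by
    push_cast; ring]
  exact Complex.norm_exp_I_mul_ofReal _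

lemma hasDerivAt_phase (r t : ℝ) : HasDerivAt (phase r) (-(Complex.I * r) * phase r t) t := by
  have h : HasDerivAt (fun t : ℝ => -(Complex.I * (t : ℂ) * (r : ℂ))) (-(Complex.I * r)) t := by
    have := (((hasDerivAt_id t).ofReal_comp.const_mul Complex.I).mul_const (r : ℂ)).fun_neg
    simpa using this
  have := h.cexp
  rw [mul_comm] at this
  exact this

lemma phase_add (r r' t : ℝ) : phase (r + r') t = phase r t * phase r' t := by
  rw [phase_apply, phase_apply, phase_apply, ← Complex.exp_add]
  push_cast; ring_nf

/-- The path `t ↦ f t e^{inx}`. -/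
def modePath (T s : ℝ) (n : ℤ) (f : C(ℝ, ℂ)) : CW T s :=
  ⟨fun t => f t • SobolevInfty.trig s {n} 1, by fun_prop⟩

lemma coeff_modePath (T s : ℝ) (n : ℤ) (f : C(ℝ, ℂ)) (t : Set.Icc (0 : ℝ) T) (k : ℤ) :
    (modePath T s n f t).coeff k = if k = n then f t else 0 := by
  change (f t • SobolevInfty.trig s {n} 1).coeff k = _
  rw [SobolevInfty.coeff_smul, Pi.smul_apply, SobolevInfty.coeff_trig]
  simp

lemma coeff_sum_smul {ι : Type*} {T s : ℝ} (I : Finset ι) (c : ι → ℂ) (F : ι → CW T s)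
    (t : Set.Icc (0 : ℝ) T) (k : ℤ) :
    ((∑ i ∈ I, c i • F i) t).coeff k = ∑ i ∈ I, c i * (F i t).coeff k := by
  rw [ContinuousMap.sum_apply]
  change (SobolevInfty.coeffLM s (∑ i ∈ I, (c i • F i) t)) k = _
  rw [map_sum, Finset.sum_apply]
  rfl

section Paths

variable {Ω : Type*} (T s : ℝ) (g : ℤ → Ω → ℂ) (N : ℕ)

/-- The path with Fourier coefficients `e^{-itφ(n)} e(n) g_n`, `|n| ≤ N`. -/
def linPath (e : ℤ → ℂ) (ω : Ω) : CW T s :=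
  ∑ n ∈ Finset.Icc (-(N : ℤ)) N, (e n * g n ω) • modePath T s n (phase (phi n))

/-- The path with Fourier coefficients
`φ(n) ∑_{a + l = n} e^{-it(φ(a) + φ(l))} e(a, l) g_a g_l`, `|a|, |l| ≤ N`. -/
def biPath (e : ℤ → ℤ → ℂ) (ω : Ω) : CW T s :=
  ∑ p ∈ Finset.Icc (-(N : ℤ)) N ×ˢ Finset.Icc (-(N : ℤ)) N,
    ((phi (p.1 + p.2) : ℂ) * e p.1 p.2 * g p.1 ω * g p.2 ω) •
      modePath T s (p.1 + p.2) (phase (phi p.1 + phi p.2))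

variable {T s g N}

lemma coeff_linPath (e : ℤ → ℂ) (ω : Ω) (t : Set.Icc (0 : ℝ) T) (k : ℤ) :
    (linPath T s g N e ω t).coeff k =
      if k ∈ Finset.Icc (-(N : ℤ)) N then e k * g k ω * phase (phi k) t else 0 := by
  rw [linPath, coeff_sum_smul]
  simp only [coeff_modePath, mul_ite, mul_zero, Finset.sum_ite_eq]

lemma coeff_biPath (e : ℤ → ℤ → ℂ) (ω : Ω) (t : Set.Icc (0 : ℝ) T) (k : ℤ) :
    (biPath T s g N e ω t).coeff k =
      ∑ p ∈ Finset.Icc (-(N : ℤ)) N ×ˢ Finset.Icc (-(N : ℤ)) N, if k = p.1 + p.2 then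
        (phi (p.1 + p.2) : ℂ) * e p.1 p.2 * g p.1 ω * g p.2 ω *
          phase (phi p.1 + phi p.2) t else 0 := by
  rw [biPath, coeff_sum_smul]
  simp only [coeff_modePath, mul_ite, mul_zero]

lemma linPath_sub (e e' : ℤ → ℂ) (ω : Ω) :
    linPath T s g N e ω - linPath T s g N e' ω = linPath T s g N (e - e') ω := by
  simp only [linPath, ← Finset.sum_sub_distrib, ← sub_smul, Pi.sub_apply, sub_mul]

lemma biPath_sub (e e' : ℤ → ℤ → ℂ) (ω : Ω) :
    biPath T s g N e ω - biPath T s g N e' ω = biPath T s g N (e - e') ω := by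
  simp only [biPath, ← Finset.sum_sub_distrib, ← sub_smul, Pi.sub_apply, mul_sub, sub_mul]

end Paths

lemma scale_div_eq (Q X K : ℝ) :
    Q * X / (8 * K) = X / (8 * (Q⁻¹ * K)) := by
  rw [mul_left_comm 8, ← div_div X, div_inv_eq_mul, mul_comm X Q]

/-! ### Pointwise exponential moments of dyadic blocks -/

section Bounds

lemma sum_block_lin {Ω : Type*} {g : ℤ → Ω → ℂ} (S : Finset ℤ) (j : ℕ) (s : ℝ)
    (d : ℤ → ℂ) (x : Torus)
    (ω : Ω) : ∑ n ∈ block S j, (((japanese n ^ s : ℝ) : ℂ) * (d n * g n ω)) * fourier n x =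
      ∑ n ∈ S, (if Nat.log 2 n.natAbs = j then
        ((japanese n ^ s : ℝ) : ℂ) * d n * fourier n x else 0) * g n ω := by
  rw [block, Finset.sum_filter]
  refine Finset.sum_congr rfl fun n _ => ?_
  split_ifs
  · ring
  · rw [zero_mul]

variable {Ω : Type*} [MeasurableSpace Ω] {P : Measure Ω} {g : ℤ → Ω → ℂ}

/-- On block `j` the factor `2^{δj}` is at most `⟨n⟩^δ`, so it is hidden in the variance sum, which
converges because of the spare `2δ` in the exponent. -/
lemma lintegral_exp_block_lin_le (hg : IsGaussianSequence P g) {s β δ κ : ℝ} (hδ : 0 < δ)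
    (hs : 2 * s - 2 * β + 2 * δ < -1) (hκ : 0 < κ) (N : ℕ) (d : ℤ → ℂ)
    (hd : ∀ n, ‖d n‖ ≤ κ * japanese n ^ (-β)) (j : ℕ) (x : Torus) :
    ∫⁻ ω, ENNReal.ofReal (Real.exp (((2 : ℝ) ^ δ) ^ j * ‖∑ n ∈ block (Finset.Icc (-(N : ℤ)) N) j,
      (((japanese n ^ s : ℝ) : ℂ) * (d n * g n ω)) * fourier n x‖ /
        (8 * (κ * Real.sqrt (japaneseSum (2 * s - 2 * β + 2 * δ)))))) ∂P ≤ 16 := by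
  set Z := japaneseSum (2 * s - 2 * β + 2 * δ) with hZ
  have hZ0 : 0 < Z := japaneseSum_pos hs
  set Q : ℝ := ((2 : ℝ) ^ δ) ^ j with hQ
  have hQ0 : 0 < Q := by positivity
  simp only [sum_block_lin]
  have hmain := hg.lintegral_exp_chaos_one_le N (fun n => if Nat.log 2 n.natAbs = j then
        ((japanese n ^ s : ℝ) : ℂ) * d n * fourier n x else 0) (A := Q⁻¹ * (κ * Real.sqrt Z))
        (by positivity) (by
    rw [mul_pow, mul_pow, Real.sq_sqrt hZ0.le, ← mul_assoc]
    calc _ ≤ ∑ n ∈ Finset.Icc (-(N : ℤ)) N, (Q⁻¹ ^ 2 * κ ^ 2) *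
          japanese n ^ (2 * s - 2 * β + 2 * δ) := by
          refine Finset.sum_le_sum fun n _ => ?_
          have hn := japanese_pos n
          split_ifs with h
          · have h1 := pow_le_japanese_rpow hδ h
            rw [← hQ] at h1
            have h2 := hd n
            rw [norm_mul, norm_mul, norm_fourier_apply, mul_one, Complex.norm_real,
              Real.norm_eq_abs, abs_of_pos (Real.rpow_pos_of_pos hn s)]
            have h3 : japanese n ^ s * ‖d n‖ ≤
                Q⁻¹ * κ * (japanese n ^ s * japanese n ^ (-β) * japanese n ^ δ) := by
              calc japanese n ^ s * ‖d n‖ ≤ japanese n ^ s * (κ * japanese n ^ (-β)) * 1 := by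
                    rw [mul_one]; gcongr
                _ ≤ japanese n ^ s * (κ * japanese n ^ (-β)) * (Q⁻¹ * japanese n ^ δ) := by
                    gcongr
                    rwa [← div_eq_inv_mul, one_le_div hQ0]
                _ = _ := by ring
            rw [← Real.rpow_add hn, ← Real.rpow_add hn] at h3
            calc (japanese n ^ s * ‖d n‖) ^ 2 ≤ (Q⁻¹ * κ * japanese n ^ (s + -β + δ)) ^ 2 := by
                  gcongr
              _ = _ := by
                  rw [mul_pow, mul_pow, ← Real.rpow_mul_natCast hn.le]
                  congr 2
                  push_cast; ring
          · rw [norm_zero, zero_pow two_ne_zero]; positivity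
      _ ≤ _ := by
          rw [← Finset.mul_sum]
          gcongr
          exact sum_japanese_le hs _)
  refine le_trans (lintegral_mono fun ω => ?_) hmain
  exact ENNReal.ofReal_le_ofReal (Real.exp_le_exp.mpr (scale_div_eq _ _ _).le)

lemma sum_block_bi {Ω : Type*} {g : ℤ → Ω → ℂ} (S I : Finset ℤ)
    (hS : ∀ a ∈ I, ∀ l ∈ I, a + l ∈ S) (j : ℕ) (s : ℝ)
    (d : ℤ → ℤ → ℂ) (x : Torus) (ω : Ω) :
    ∑ n ∈ block S j, (((japanese n ^ s : ℝ) : ℂ) * ∑ p ∈ I ×ˢ I, if n = p.1 + p.2 then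
        (phi (p.1 + p.2) : ℂ) * d p.1 p.2 * g p.1 ω * g p.2 ω else 0) * fourier n x =
      ∑ a ∈ I, ∑ l ∈ I, (if Nat.log 2 (a + l).natAbs = j then
        ((japanese (a + l) ^ s : ℝ) : ℂ) * ((phi (a + l) : ℂ) * d a l) * fourier (a + l) x else 0) *
          g a ω * g l ω := by
  rw [← Finset.sum_product']
  simp only [Finset.mul_sum, Finset.sum_mul]
  rw [Finset.sum_comm]
  refine Finset.sum_congr rfl fun p hp => ?_
  simp only [mul_ite, ite_mul, mul_zero, zero_mul]
  rw [Finset.sum_ite_eq']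
  have hpS := hS p.1 (Finset.mem_product.mp hp).1 p.2 (Finset.mem_product.mp hp).2
  simp only [block, Finset.mem_filter, hpS, true_and]
  split_ifs
  · ring
  · rfl

lemma sum_sum_le_sum_conv (N : ℕ) (f : ℤ → ℤ → ℝ) (hf : ∀ a l, 0 ≤ f a l) :
    ∑ a ∈ Finset.Icc (-(N : ℤ)) N, ∑ l ∈ Finset.Icc (-(N : ℤ)) N, f a l ≤
      ∑ n ∈ Finset.Icc (-(2 * N : ℤ)) (2 * N), ∑ a ∈ Finset.Icc (-(N : ℤ)) N, f a (n - a) := by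
  rw [Finset.sum_comm (s := Finset.Icc (-(2 * N : ℤ)) (2 * N))]
  refine Finset.sum_le_sum fun a ha => ?_
  have ha' := Finset.mem_Icc.mp ha
  calc ∑ l ∈ Finset.Icc (-(N : ℤ)) N, f a l
      = ∑ n ∈ (Finset.Icc (-(N : ℤ)) N).image (fun l => a + l), f a (n - a) := by
        rw [Finset.sum_image fun l _ l' _ h => by simpa using h]
        simp
    _ ≤ _ := by
        refine Finset.sum_le_sum_of_subset_of_nonneg (fun n hn => ?_) fun n _ _ => hf _ _
        obtain ⟨l, hl, rfl⟩ := Finset.mem_image.mp hn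
        have hl' := Finset.mem_Icc.mp hl
        rw [Finset.mem_Icc]
        omega

/-- The constant in the bound of the second chaos. -/
def biConst (s β γ δ : ℝ) : ℝ :=
  Real.sqrt (2 ^ γ * (2 * japaneseSum (γ - 2 * (2 * β))) * japaneseSum (2 * s - 2 - γ + 2 * δ))

lemma biConst_pos {s β γ δ : ℝ} (hγβ : γ - 2 * (2 * β) < -1)
    (hs : 2 * s - 2 - γ + 2 * δ < -1) : 0 < biConst s β γ δ := by
  have h1 := japaneseSum_pos hγβ
  have h2 := japaneseSum_pos hs
  exact Real.sqrt_pos.mpr (by positivity)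

/-- The sum of squared coefficients is reorganised by output frequency. `|φ(n)| ≤ ⟨n⟩⁻¹` gains one
derivative and the convolution of the weights `⟨·⟩^{-2β}` gains `⟨n⟩^{-γ}`, leaving the convergent
sum of `⟨n⟩^{2s - 2 - γ + 2δ}`. -/
lemma lintegral_exp_block_bi_le (hg : IsGaussianSequence P g) {s β γ δ κ : ℝ} (hδ : 0 < δ)
    (hγ : 0 ≤ γ) (hγ2 : γ ≤ 2 * β) (hγβ : γ - 2 * (2 * β) < -1)
    (hs : 2 * s - 2 - γ + 2 * δ < -1) (hκ : 0 < κ) (N : ℕ) (d : ℤ → ℤ → ℂ)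
    (hsymm : ∀ a l, d a l = d l a)
    (hd : ∀ a l, ‖d a l‖ ≤ κ * (japanese a ^ (-β) * japanese l ^ (-β))) (j : ℕ) (x : Torus) :
    ∫⁻ ω, ENNReal.ofReal (Real.exp (((2 : ℝ) ^ δ) ^ j *
      ‖∑ n ∈ block (Finset.Icc (-(2 * N : ℤ)) (2 * N)) j,
      (((japanese n ^ s : ℝ) : ℂ) * ∑ p ∈ Finset.Icc (-(N : ℤ)) N ×ˢ Finset.Icc (-(N : ℤ)) N,
        if n = p.1 + p.2 then (phi (p.1 + p.2) : ℂ) * d p.1 p.2 * g p.1 ω * g p.2 ω else 0) *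
          fourier n x‖ / (8 * (κ * biConst s β γ δ)))) ∂P ≤ 16 := by
  have hC0 : 0 < biConst s β γ δ := biConst_pos hγβ hs
  have hZ1 := japaneseSum_pos hγβ
  have hZ2 := japaneseSum_pos hs
  set Q : ℝ := ((2 : ℝ) ^ δ) ^ j with hQ
  have hQ0 : 0 < Q := by positivity
  have hsum := fun ω => sum_block_bi (g := g) (Finset.Icc (-(2 * N : ℤ)) (2 * N))
    (Finset.Icc (-(N : ℤ)) N) (fun a ha l hl => by
      rw [Finset.mem_Icc] at *; omega) j s d x ω
  simp only [hsum]
  set b : ℤ → ℤ → ℂ := fun a l => if Nat.log 2 (a + l).natAbs = j then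
        ((japanese (a + l) ^ s : ℝ) : ℂ) * ((phi (a + l) : ℂ) * d a l) * fourier (a + l) x else 0
        with hb
  have hbb : ∀ a l, ‖b a l‖ ^ 2 ≤ (Q⁻¹ ^ 2 * κ ^ 2) * (japanese (a + l) ^ (2 * s - 2 + 2 * δ) *
      (japanese a ^ (-(2 * β)) * japanese l ^ (-(2 * β)))) := by
    intro a l
    have hn := japanese_pos (a + l)
    have ha := japanese_pos a
    have hl := japanese_pos l
    simp only [hb]
    split_ifs with h
    · have h1 := pow_le_japanese_rpow hδ h
      rw [← hQ] at h1
      have h2 := hd a l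
      have hphi := abs_phi_le (a + l)
      rw [norm_mul, norm_mul, norm_mul, norm_fourier_apply, mul_one, Complex.norm_real,
        Complex.norm_real, Real.norm_eq_abs, Real.norm_eq_abs,
        abs_of_pos (Real.rpow_pos_of_pos hn s)]
      have h3 : japanese (a + l) ^ s * (|phi (a + l)| * ‖d a l‖) ≤
          Q⁻¹ * κ * ((japanese (a + l) ^ s * japanese (a + l) ^ (-1 : ℝ) * japanese (a + l) ^ δ) *
            (japanese a ^ (-β) * japanese l ^ (-β))) := by
        rw [Real.rpow_neg_one]
        calc japanese (a + l) ^ s * (|phi (a + l)| * ‖d a l‖)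
            ≤ japanese (a + l) ^ s * ((japanese (a + l))⁻¹ *
                (κ * (japanese a ^ (-β) * japanese l ^ (-β)))) * 1 := by
              rw [mul_one]; gcongr
          _ ≤ japanese (a + l) ^ s * ((japanese (a + l))⁻¹ *
                (κ * (japanese a ^ (-β) * japanese l ^ (-β)))) *
                (Q⁻¹ * japanese (a + l) ^ δ) := by
              gcongr
              rwa [← div_eq_inv_mul, one_le_div hQ0]
          _ = _ := by ring
      rw [← Real.rpow_add hn, ← Real.rpow_add hn] at h3
      calc (japanese (a + l) ^ s * (|phi (a + l)| * ‖d a l‖)) ^ 2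
          ≤ (Q⁻¹ * κ * (japanese (a + l) ^ (s + -1 + δ) *
            (japanese a ^ (-β) * japanese l ^ (-β)))) ^ 2 := by gcongr
        _ = _ := by
            rw [mul_pow, mul_pow, mul_pow, mul_pow, ← Real.rpow_mul_natCast hn.le,
              ← Real.rpow_mul_natCast ha.le, ← Real.rpow_mul_natCast hl.le]
            push_cast
            ring_nf
    · rw [norm_zero, zero_pow two_ne_zero]; positivity
  -- The resonant coefficients vanish because `φ(0) = 0`: this is the absence of renormalisation.
  have hmain := hg.lintegral_exp_chaos_two_le N b (A := Q⁻¹ * (κ * biConst s β γ δ))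
    (by positivity) (fun a l => by simp only [hb]; rw [add_comm a l, hsymm a l])
    (fun a l hal => by simp [hb, hal, phi_zero]) (by
    rw [mul_pow, mul_pow, biConst, Real.sq_sqrt (by positivity), ← mul_assoc]
    calc _ ≤ ∑ a ∈ Finset.Icc (-(N : ℤ)) N, ∑ l ∈ Finset.Icc (-(N : ℤ)) N, (Q⁻¹ ^ 2 * κ ^ 2) *
          (japanese (a + l) ^ (2 * s - 2 + 2 * δ) *
            (japanese a ^ (-(2 * β)) * japanese l ^ (-(2 * β)))) :=
          Finset.sum_le_sum fun a _ => Finset.sum_le_sum fun l _ => hbb a l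
      _ ≤ (Q⁻¹ ^ 2 * κ ^ 2) * ∑ n ∈ Finset.Icc (-(2 * N : ℤ)) (2 * N),
          ∑ a ∈ Finset.Icc (-(N : ℤ)) N, japanese n ^ (2 * s - 2 + 2 * δ) *
            (japanese a ^ (-(2 * β)) * japanese (n - a) ^ (-(2 * β))) := by
          simp only [← Finset.mul_sum]
          have := sum_sum_le_sum_conv N (fun a l => japanese (a + l) ^ (2 * s - 2 + 2 * δ) *
            (japanese a ^ (-(2 * β)) * japanese l ^ (-(2 * β)))) (fun a l => by
              have := japanese_pos (a + l)
              have := japanese_pos a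
              have := japanese_pos l
              positivity)
          simp only [add_sub_cancel, ← Finset.mul_sum] at this
          gcongr
      _ ≤ (Q⁻¹ ^ 2 * κ ^ 2) * ∑ n ∈ Finset.Icc (-(2 * N : ℤ)) (2 * N),
          (2 ^ γ * (2 * japaneseSum (γ - 2 * (2 * β)))) *
            japanese n ^ (2 * s - 2 - γ + 2 * δ) := by
          gcongr with n
          have hn := japanese_pos n
          rw [← Finset.mul_sum]
          have := sum_japanese_conv_le hγ hγ2 hγβ (Finset.Icc (-(N : ℤ)) N) n
          calc _ ≤ japanese n ^ (2 * s - 2 + 2 * δ) *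
              (2 ^ γ * (2 * japaneseSum (γ - 2 * (2 * β))) * japanese n ^ (-γ)) := by gcongr
            _ = (2 ^ γ * (2 * japaneseSum (γ - 2 * (2 * β)))) *
              (japanese n ^ (2 * s - 2 + 2 * δ) * japanese n ^ (-γ)) := by ring
            _ = _ := by rw [← Real.rpow_add hn]; ring_nf
      _ ≤ _ := by
          rw [← Finset.mul_sum]
          gcongr
          exact sum_japanese_le hs _)
  refine le_trans (lintegral_mono fun ω => ?_) hmain
  exact ENNReal.ofReal_le_ofReal (Real.exp_le_exp.mpr (scale_div_eq _ _ _).le)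

end Bounds

lemma lintegral_exp_norm_path_le_of_scale {Ω : Type*} [MeasurableSpace Ω] (P : Measure Ω)
    [IsProbabilityMeasure P] {q : ℝ} (hq : 1 < q) {T s K : ℝ} (hT : 0 < T) (hK : 0 < K)
    (S : Finset ℤ)
    (c c' : Ω → ℝ → ℤ → ℂ) (hderiv : ∀ ω n t, HasDerivAt (fun t => c ω t n) (c' ω t n) t)
    (hcont : ∀ ω n, Continuous fun t => c' ω t n)
    (hm0 : ∀ n, Measurable fun ω => c ω 0 n)
    (hm : ∀ n, Measurable fun p : Ω × ℝ => c' p.1 p.2 n)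
    (h0 : ∀ j (x : Torus), ∫⁻ ω, ENNReal.ofReal (Real.exp (q ^ j * ‖∑ n ∈ block S j,
      (((japanese n ^ s : ℝ) : ℂ) * c ω 0 n) * fourier n x‖ / K)) ∂P ≤ 16)
    (h1 : ∀ t j (x : Torus), ∫⁻ ω, ENNReal.ofReal (Real.exp (q ^ j * ‖∑ n ∈ block S j,
      (((japanese n ^ s : ℝ) : ℂ) * c' ω t n) * fourier n x‖ / K)) ∂P ≤ 16)
    (F : Ω → CW T s) (hF : ∀ ω t n, (F ω t).coeff n = if n ∈ S then c ω t n else 0) :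
    ∫⁻ ω, ENNReal.ofReal (Real.exp (‖F ω‖ / (K * (2 * (1 + T) * blockConst q)))) ∂P ≤ 4608 := by
  have hKn : ‖((K⁻¹ : ℝ) : ℂ)‖ = K⁻¹ := by
    rw [Complex.norm_real, Real.norm_eq_abs, abs_of_pos (inv_pos.mpr hK)]
  have hsc : ∀ (d : ℤ → ℂ) j (x : Torus), q ^ j * ‖∑ n ∈ block S j,
      (((japanese n ^ s : ℝ) : ℂ) * (((K⁻¹ : ℝ) : ℂ) * d n)) * fourier n x‖ =
      q ^ j * ‖∑ n ∈ block S j, (((japanese n ^ s : ℝ) : ℂ) * d n) * fourier n x‖ / K := by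
    intro d j x
    have : ∑ n ∈ block S j,
      (((japanese n ^ s : ℝ) : ℂ) * (((K⁻¹ : ℝ) : ℂ) * d n)) * fourier n x =
      ((K⁻¹ : ℝ) : ℂ) * ∑ n ∈ block S j, (((japanese n ^ s : ℝ) : ℂ) * d n) * fourier n x := by
      rw [Finset.mul_sum]
      exact Finset.sum_congr rfl fun n _ => by ring
    rw [this, norm_mul, hKn]
    ring
  have h := lintegral_exp_norm_path_le P hq hT S (fun ω t n => ((K⁻¹ : ℝ) : ℂ) * c ω t n)
    (fun ω t n => ((K⁻¹ : ℝ) : ℂ) * c' ω t n) (fun ω n t => (hderiv ω n t).const_mul _)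
    (fun ω n => continuous_const.mul (hcont ω n)) (fun n => (hm0 n).const_mul _)
    (fun n => (hm n).const_mul _) (s := s) (by simpa only [hsc] using h0)
    (by simpa only [hsc] using h1) (fun ω => ((K⁻¹ : ℝ) : ℂ) • F ω) (fun ω t n => by
      change ((((K⁻¹ : ℝ) : ℂ) • F ω t)).coeff n = _
      rw [SobolevInfty.coeff_smul, Pi.smul_apply, hF, smul_eq_mul, mul_ite, mul_zero])
  simp only [norm_smul, hKn] at h
  convert h using 5
  rw [div_mul_eq_div_div, div_eq_inv_mul _ K]

/-! ### Exponential moments of the linear and bilinear paths -/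

section PathBounds

variable {Ω : Type*} [MeasurableSpace Ω] {P : Measure Ω} {g : ℤ → Ω → ℂ}

/-- Differentiating the phase multiplies the coefficient by `-iφ(n)`, of modulus at most `1/2`, so
the derivative satisfies the same block bound as the path. -/
lemma lintegral_exp_linPath_le [IsProbabilityMeasure P] (hg : IsGaussianSequence P g)
    {s β δ κ T : ℝ} (hδ : 0 < δ)
    (hs : 2 * s - 2 * β + 2 * δ < -1) (hκ : 0 < κ) (hT : 0 < T) (N : ℕ) (e : ℤ → ℂ)
    (he : ∀ n, ‖e n‖ ≤ κ * japanese n ^ (-β)) :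
    ∫⁻ ω, ENNReal.ofReal (Real.exp (‖linPath T s g N e ω‖ /
      (8 * (κ * Real.sqrt (japaneseSum (2 * s - 2 * β + 2 * δ))) *
        (2 * (1 + T) * blockConst (2 ^ δ))))) ∂P ≤ 4608 := by
  have hZ := Real.sqrt_pos.mpr (japaneseSum_pos hs)
  have hgm := hg.measurable
  refine lintegral_exp_norm_path_le_of_scale P (Real.one_lt_rpow (by norm_num) hδ) hT
    (by positivity) (Finset.Icc (-(N : ℤ)) N) (fun ω t n => (e n * phase (phi n) t) * g n ω)
    (fun ω t n => (e n * (-(Complex.I * phi n) * phase (phi n) t)) * g n ω)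
    (fun ω n t => ((hasDerivAt_phase _ _).const_mul _).mul_const _)
    (fun ω n => by fun_prop) (fun n => by fun_prop) (fun n => ?_) (fun j x => ?_)
    (fun t j x => ?_) _ (fun ω t n => ?_)
  · have : Measurable fun p : Ω × ℝ => g n p.1 := (hgm n).comp measurable_fst
    fun_prop
  · refine lintegral_exp_block_lin_le hg hδ hs hκ N (fun n => e n * phase (phi n) 0)
      (fun n => ?_) j x
    rw [norm_mul, norm_phase, mul_one]
    exact he n
  · refine lintegral_exp_block_lin_le hg hδ hs hκ N
      (fun n => e n * (-(Complex.I * phi n) * phase (phi n) t)) (fun n => ?_) j x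
    rw [norm_mul, norm_mul, norm_phase, mul_one, norm_neg, norm_mul, Complex.norm_I, one_mul,
      Complex.norm_real, Real.norm_eq_abs]
    refine (mul_le_of_le_one_right (norm_nonneg _) ?_).trans (he n)
    linarith [abs_phi_le_half n]
  · rw [coeff_linPath]
    split_ifs
    · ring
    · rfl

/-- The time derivative again costs nothing, since `|φ(a) + φ(l)| ≤ 1`. Output frequencies range up
to `2N`. -/
lemma lintegral_exp_biPath_le [IsProbabilityMeasure P] (hg : IsGaussianSequence P g)
    {s β γ δ κ T : ℝ} (hδ : 0 < δ)
    (hγ : 0 ≤ γ) (hγ2 : γ ≤ 2 * β) (hγβ : γ - 2 * (2 * β) < -1)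
    (hs : 2 * s - 2 - γ + 2 * δ < -1) (hκ : 0 < κ) (hT : 0 < T) (N : ℕ) (e : ℤ → ℤ → ℂ)
    (hsymm : ∀ a l, e a l = e l a)
    (he : ∀ a l, ‖e a l‖ ≤ κ * (japanese a ^ (-β) * japanese l ^ (-β))) :
    ∫⁻ ω, ENNReal.ofReal (Real.exp (‖biPath T s g N e ω‖ /
      (8 * (κ * biConst s β γ δ) * (2 * (1 + T) * blockConst (2 ^ δ))))) ∂P ≤ 4608 := by
  have hZ : 0 < biConst s β γ δ := biConst_pos hγβ hs
  have hgm := hg.measurable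
  refine lintegral_exp_norm_path_le_of_scale P (Real.one_lt_rpow (by norm_num) hδ) hT
    (by positivity) (Finset.Icc (-(2 * N : ℤ)) (2 * N))
    (fun ω t n => ∑ p ∈ Finset.Icc (-(N : ℤ)) N ×ˢ Finset.Icc (-(N : ℤ)) N,
      if n = p.1 + p.2 then (phi (p.1 + p.2) : ℂ) * (e p.1 p.2 * phase (phi p.1 + phi p.2) t) *
        g p.1 ω * g p.2 ω else 0)
    (fun ω t n => ∑ p ∈ Finset.Icc (-(N : ℤ)) N ×ˢ Finset.Icc (-(N : ℤ)) N,
      if n = p.1 + p.2 then (phi (p.1 + p.2) : ℂ) * (e p.1 p.2 *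
        (-(Complex.I * ((phi p.1 + phi p.2 : ℝ) : ℂ)) * phase (phi p.1 + phi p.2) t)) *
        g p.1 ω * g p.2 ω else 0)
    (fun ω n t => HasDerivAt.fun_sum fun p _ => ?_)
    (fun ω n => continuous_finsetSum _ fun p _ => ?_)
    (fun n => Finset.measurable_fun_sum _ fun p _ => ?_)
    (fun n => Finset.measurable_fun_sum _ fun p _ => ?_) (fun j x => ?_)
    (fun t j x => ?_) _ (fun ω t n => ?_)
  · split_ifs
    · exact ((((hasDerivAt_phase _ _).const_mul _).const_mul _).mul_const _).mul_const _
    · exact hasDerivAt_const _ _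
  · split_ifs <;> fun_prop
  · split_ifs <;> fun_prop
  · have h1 : Measurable fun x : Ω × ℝ => g p.1 x.1 := (hgm p.1).comp measurable_fst
    have h2 : Measurable fun x : Ω × ℝ => g p.2 x.1 := (hgm p.2).comp measurable_fst
    split_ifs <;> fun_prop
  · refine lintegral_exp_block_bi_le hg hδ hγ hγ2 hγβ hs hκ N
      (fun a l => e a l * phase (phi a + phi l) 0) (fun a l => ?_) (fun a l => ?_) j x
    · rw [hsymm, add_comm]
    · rw [norm_mul, norm_phase, mul_one]
      exact he a l
  · refine lintegral_exp_block_bi_le hg hδ hγ hγ2 hγβ hs hκ N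
      (fun a l => e a l * (-(Complex.I * ((phi a + phi l : ℝ) : ℂ)) * phase (phi a + phi l) t))
      (fun a l => ?_) (fun a l => ?_) j x
    · rw [hsymm, add_comm (phi a)]
    · rw [norm_mul, norm_mul, norm_phase, mul_one, norm_neg, norm_mul, Complex.norm_I, one_mul,
        Complex.norm_real, Real.norm_eq_abs]
      refine (mul_le_of_le_one_right (norm_nonneg _) ?_).trans (he a l)
      linarith [abs_phi_le_half a, abs_phi_le_half l, abs_add_le (phi a) (phi l)]
  · rw [coeff_biPath]
    split_ifs with hn
    · refine Finset.sum_congr rfl fun p _ => ?_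
      split_ifs
      · ring
      · rfl
    · refine Finset.sum_eq_zero fun p hp => if_neg ?_
      rintro rfl
      obtain ⟨h1, h2⟩ := Finset.mem_product.mp hp
      rw [Finset.mem_Icc] at h1 h2 hn
      omega

/-- A finite sum of measurable scalars times fixed vectors: strong measurability is obtained without
separability of the path space. -/
lemma stronglyMeasurable_linPath (hg : IsGaussianSequence P g) (T s : ℝ) (N : ℕ) (e : ℤ → ℂ) :
    StronglyMeasurable fun ω => linPath T s g N e ω := by
  unfold linPath
  refine Finset.stronglyMeasurable_fun_sum _ fun n _ => ?_
  exact ((hg.measurable n).const_mul (e n)).stronglyMeasurable.smul_const _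

lemma stronglyMeasurable_biPath (hg : IsGaussianSequence P g) (T s : ℝ) (N : ℕ)
    (e : ℤ → ℤ → ℂ) : StronglyMeasurable fun ω => biPath T s g N e ω := by
  unfold biPath
  refine Finset.stronglyMeasurable_fun_sum _ fun p _ => ?_
  exact ((((hg.measurable p.1).const_mul _).mul (hg.measurable p.2))).stronglyMeasurable
    |>.smul_const _

end PathBounds

/-! ### Regularised data and their truncations -/

/-- Truncation of a multiplier to the frequencies `|n| ≤ N`. -/
def truncSymbol (N : ℕ) (m : ℤ → ℂ) (n : ℤ) : ℂ := if n ∈ Finset.Icc (-(N : ℤ)) N then m n else 0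

/-- The coefficients of the data regularised by `m`, without the Gaussians. -/
def linCoeff (α : ℝ) (m : ℤ → ℂ) (n : ℤ) : ℂ := m n * ((japanese n ^ (-α) : ℝ) : ℂ)

/-- The pair `(z, N(z))` for data regularised by `m` and truncated to `|n| ≤ N`. -/
def regPath {Ω : Type*} (T s₁ s₂ α : ℝ) (g : ℤ → Ω → ℂ) (N : ℕ) (m : ℤ → ℂ) (ω : Ω) :
    CW T s₁ × CW T s₂ :=
  (linPath T s₁ g N (linCoeff α m) ω,
    biPath T s₂ g N (fun a l => linCoeff α m a * linCoeff α m l) ω)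

lemma norm_linCoeff (α : ℝ) (m : ℤ → ℂ) (n : ℤ) :
    ‖linCoeff α m n‖ = ‖m n‖ * japanese n ^ (-α) := by
  rw [linCoeff, norm_mul, Complex.norm_real, Real.norm_eq_abs,
    abs_of_pos (Real.rpow_pos_of_pos (japanese_pos n) _)]

lemma regPath_zero {Ω : Type*} (T s₁ s₂ α : ℝ) (g : ℤ → Ω → ℂ) (N : ℕ) (ω : Ω) :
    regPath T s₁ s₂ α g N 0 ω = 0 := by
  simp [regPath, linPath, biPath, linCoeff]

/-- Comparing two truncation levels thereby becomes comparing two multipliers at the same level. -/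
lemma regPath_truncSymbol {Ω : Type*} (T s₁ s₂ α : ℝ) (g : ℤ → Ω → ℂ) {M N : ℕ} (h : M ≤ N)
    (m : ℤ → ℂ) (ω : Ω) :
    regPath T s₁ s₂ α g N (truncSymbol M m) ω = regPath T s₁ s₂ α g M m ω := by
  have hsub : Finset.Icc (-(M : ℤ)) M ⊆ Finset.Icc (-(N : ℤ)) N :=
    Finset.Icc_subset_Icc (by omega) (by omega)
  have hin : ∀ n ∈ Finset.Icc (-(M : ℤ)) M, linCoeff α (truncSymbol M m) n = linCoeff α m n :=
    fun n hn => by rw [linCoeff, truncSymbol, if_pos hn, linCoeff]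
  have hout : ∀ n ∉ Finset.Icc (-(M : ℤ)) M, linCoeff α (truncSymbol M m) n = 0 :=
    fun n hn => by rw [linCoeff, truncSymbol, if_neg hn, zero_mul]
  refine Prod.ext ?_ ?_
  · simp only [regPath, linPath]
    rw [← Finset.sum_subset hsub fun n _ hn => by rw [hout n hn, zero_mul, zero_smul]]
    exact Finset.sum_congr rfl fun n hn => by rw [hin n hn]
  · simp only [regPath, biPath]
    rw [← Finset.sum_subset (Finset.product_subset_product hsub hsub) fun p _ hp => ?_]
    · refine Finset.sum_congr rfl fun p hp => ?_
      obtain ⟨h1, h2⟩ := Finset.mem_product.mp hp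
      rw [hin _ h1, hin _ h2]
    · have : p.1 ∉ Finset.Icc (-(M : ℤ)) M ∨ p.2 ∉ Finset.Icc (-(M : ℤ)) M := by
        by_contra! hcon
        exact hp (Finset.mem_product.mpr hcon)
      rcases this with h | h <;> rw [hout _ h] <;> simp

/-- The difference lives on `|n| ≥ M + 1`, where `⟨n⟩ / (M + 1) ≥ 1`. -/
lemma norm_sub_truncSymbol_le {m : ℤ → ℂ} (hm : ∀ n, ‖m n‖ ≤ 1) (M : ℕ) {θ : ℝ} (hθ : 0 < θ)
    (n : ℤ) : ‖m n - truncSymbol M m n‖ ≤ ((M : ℝ) + 1) ^ (-θ) * japanese n ^ θ := by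
  have hn := japanese_pos n
  have hM : (0 : ℝ) < (M : ℝ) + 1 := by positivity
  rw [truncSymbol]
  split_ifs with h
  · rw [sub_self, norm_zero]; positivity
  · rw [sub_zero]
    refine (hm n).trans ?_
    rw [Real.rpow_neg hM.le, ← div_eq_inv_mul, one_le_div (by positivity)]
    refine Real.rpow_le_rpow hM.le (le_trans ?_ (abs_le_japanese n)) hθ.le
    have : M + 1 ≤ n.natAbs := by
      rw [Finset.mem_Icc] at h; omega
    rw [← Int.cast_abs, Int.abs_eq_natAbs]
    exact_mod_cast this

lemma norm_truncSymbol_le {m : ℤ → ℂ} (hm : ∀ n, ‖m n‖ ≤ 1) (M : ℕ) (n : ℤ) :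
    ‖truncSymbol M m n‖ ≤ 1 := by
  rw [truncSymbol]
  split_ifs
  · exact hm n
  · simp

/-! ### The difference estimate for regularised paths -/

section Moments

variable {Ω : Type*} [MeasurableSpace Ω] {P : Measure Ω} {g : ℤ → Ω → ℂ}

lemma stronglyMeasurable_regPath (hg : IsGaussianSequence P g) (T s₁ s₂ α : ℝ) (N : ℕ)
    (m : ℤ → ℂ) : StronglyMeasurable fun ω => regPath T s₁ s₂ α g N m ω :=
  (stronglyMeasurable_linPath hg T s₁ N _).prodMk (stronglyMeasurable_biPath hg T s₂ N _)

/-- Losing `⟨n⟩^θ` in the multiplier amounts to replacing the decay `α` by `β = α - θ`, which the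
strict inequalities on `α`, `s₁`, `s₂` allow. All constants are uniform in `N`, `T`, `κ` and the
multipliers. -/
lemma lintegral_exp_regPath_sub_le [IsProbabilityMeasure P] (hg : IsGaussianSequence P g)
    {α s₁ s₂ : ℝ} (hα : 1 / 4 < α) (hα' : α ≤ 1 / 2) (hs₁ : s₁ < α - 1 / 2) (hs₂ : s₂ < 2 * α) :
    ∃ θ C : ℝ, 0 < θ ∧ θ ≤ 1 ∧ 0 < C ∧ ∀ (T : ℝ), 0 < T → ∀ (κ : ℝ), 0 < κ →
      ∀ (N : ℕ) (m m' : ℤ → ℂ), (∀ n, ‖m n‖ ≤ 1) → (∀ n, ‖m' n‖ ≤ 1) →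
      (∀ n, ‖m n - m' n‖ ≤ κ * japanese n ^ θ) →
      ∫⁻ ω, ENNReal.ofReal (Real.exp (‖regPath T s₁ s₂ α g N m ω - regPath T s₁ s₂ α g N m' ω‖ /
        (C * (1 + T) * κ))) ∂P ≤ 9216 := by
  -- `η` measures the room in the three strict hypotheses; `θ` and `δ` are fractions of it. The gain
  -- `γ` must exceed `2 s₂ - 1 + 2δ`, be nonnegative, and stay below `4β - 1`, which is at most `2β`
  -- as `β ≤ 1/2`. It is taken as the midpoint of the resulting interval.
  set η : ℝ := min (α - 1 / 2 - s₁) (min ((2 * α - s₂) / 2) (α - 1 / 4)) with hη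
  have η0 : 0 < η := lt_min (by linarith) (lt_min (by linarith) (by linarith))
  have η1 : η ≤ α - 1 / 2 - s₁ := min_le_left _ _
  have η2 : η ≤ (2 * α - s₂) / 2 := (min_le_right _ _).trans (min_le_left _ _)
  have η3 : η ≤ α - 1 / 4 := (min_le_right _ _).trans (min_le_right _ _)
  set θ := η / 2 with hθ
  set β := α - θ with hβ
  set δ := η / 4 with hδ
  set γ := (max 0 (2 * s₂ - 1 + 2 * δ) + (4 * β - 1)) / 2 with hγ
  have m1 := le_max_left 0 (2 * s₂ - 1 + 2 * δ)
  have m2 := le_max_right 0 (2 * s₂ - 1 + 2 * δ)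
  have m3 : max 0 (2 * s₂ - 1 + 2 * δ) < 4 * β - 1 := max_lt (by linarith) (by linarith)
  have hδ0 : 0 < δ := by linarith
  have hγ0 : 0 ≤ γ := by linarith
  have hγ2 : γ ≤ 2 * β := by linarith
  have hγβ : γ - 2 * (2 * β) < -1 := by linarith
  have hS2 : 2 * s₂ - 2 - γ + 2 * δ < -1 := by linarith
  have hS1 : 2 * s₁ - 2 * β + 2 * δ < -1 := by linarith
  set Z1 := Real.sqrt (japaneseSum (2 * s₁ - 2 * β + 2 * δ)) with hZ1
  have hZ1p : 0 < Z1 := Real.sqrt_pos.mpr (japaneseSum_pos hS1)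
  set Z2 := biConst s₂ β γ δ with hZ2
  have hZ2p : 0 < Z2 := biConst_pos hγβ hS2
  have hW : 1 ≤ blockConst (2 ^ δ) := one_le_blockConst (Real.one_lt_rpow (by norm_num) hδ0)
  set W := blockConst (2 ^ δ)
  refine ⟨θ, 32 * (Z1 + Z2) * W, by linarith, by linarith, by positivity,
    fun T hT κ hκ N m m' hm hm' hmm => ?_⟩
  have hlin := lintegral_exp_linPath_le hg hδ0 hS1 hκ hT N (linCoeff α m - linCoeff α m')
    (fun n => by
      have hn := japanese_pos n
      have : linCoeff α m n - linCoeff α m' n = linCoeff α (m - m') n := by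
        simp only [linCoeff, Pi.sub_apply, sub_mul]
      rw [Pi.sub_apply, this, norm_linCoeff, show -β = θ + -α by rw [hβ]; ring,
        Real.rpow_add hn, ← mul_assoc]
      exact mul_le_mul_of_nonneg_right (hmm n) (by positivity))
  -- The difference of two products has two terms, hence `2κ`; the undifferenced factor is bounded
  -- by `1 ≤ ⟨·⟩^θ` to keep the two decay rates equal.
  have hbi := lintegral_exp_biPath_le hg hδ0 hγ0 hγ2 hγβ hS2 (κ := 2 * κ) (by linarith) hT N
    ((fun a l => linCoeff α m a * linCoeff α m l) - fun a l => linCoeff α m' a * linCoeff α m' l)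
    (fun a l => by simp only [Pi.sub_apply]; ring) (fun a l => by
      have ha := japanese_pos a
      have hl := japanese_pos l
      have e : linCoeff α m a * linCoeff α m l - linCoeff α m' a * linCoeff α m' l =
          linCoeff α (m - m') a * linCoeff α m l + linCoeff α m' a * linCoeff α (m - m') l := by
        simp only [linCoeff, Pi.sub_apply]; ring
      simp only [Pi.sub_apply]
      rw [e]
      refine (norm_add_le _ _).trans ?_
      simp only [norm_mul, norm_linCoeff, Pi.sub_apply]
      have ja : 1 ≤ japanese a ^ θ := Real.one_le_rpow (one_le_japanese a) (by linarith)
      have jl : 1 ≤ japanese l ^ θ := Real.one_le_rpow (one_le_japanese l) (by linarith)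
      have t1 : ‖m a - m' a‖ * ‖m l‖ ≤ κ * (japanese a ^ θ * japanese l ^ θ) := by
        calc ‖m a - m' a‖ * ‖m l‖ ≤ (κ * japanese a ^ θ) * japanese l ^ θ :=
              mul_le_mul (hmm a) ((hm l).trans jl) (norm_nonneg _) (by positivity)
          _ = _ := by ring
      have t2 : ‖m' a‖ * ‖m l - m' l‖ ≤ κ * (japanese a ^ θ * japanese l ^ θ) := by
        calc ‖m' a‖ * ‖m l - m' l‖ ≤ japanese a ^ θ * (κ * japanese l ^ θ) :=
              mul_le_mul ((hm' a).trans ja) (hmm l) (norm_nonneg _) (by positivity)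
          _ = _ := by ring
      rw [show -β = θ + -α by rw [hβ]; ring, Real.rpow_add ha, Real.rpow_add hl]
      calc _ = (‖m a - m' a‖ * ‖m l‖ + ‖m' a‖ * ‖m l - m' l‖) *
            (japanese a ^ (-α) * japanese l ^ (-α)) := by ring
        _ ≤ (κ * (japanese a ^ θ * japanese l ^ θ) + κ * (japanese a ^ θ * japanese l ^ θ)) *
            (japanese a ^ (-α) * japanese l ^ (-α)) := by gcongr
        _ = _ := by ring)
  rw [← hZ1] at hlin
  rw [← hZ2] at hbi
  have hT1 : 0 < 1 + T := by linarith
  have hc1 : 8 * (κ * Z1) * (2 * (1 + T) * W) ≤ 32 * (Z1 + Z2) * W * (1 + T) * κ := by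
    have : 0 ≤ (16 * Z1 + 32 * Z2) * (W * (1 + T) * κ) := by positivity
    linarith
  have hc2 : 8 * ((2 * κ) * Z2) * (2 * (1 + T) * W) ≤ 32 * (Z1 + Z2) * W * (1 + T) * κ := by
    have : 0 ≤ (32 * Z1) * (W * (1 + T) * κ) := by positivity
    linarith
  have hm1 : Measurable fun ω => ENNReal.ofReal (Real.exp
      (‖linPath T s₁ g N (linCoeff α m - linCoeff α m') ω‖ /
        (8 * (κ * Z1) * (2 * (1 + T) * W)))) := by
    have := (stronglyMeasurable_linPath hg T s₁ N (linCoeff α m - linCoeff α m')).norm.measurable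
    fun_prop
  calc _ ≤ ∫⁻ ω, (ENNReal.ofReal (Real.exp (‖linPath T s₁ g N (linCoeff α m - linCoeff α m') ω‖ /
        (8 * (κ * Z1) * (2 * (1 + T) * W)))) +
      ENNReal.ofReal (Real.exp (‖biPath T s₂ g N ((fun a l => linCoeff α m a * linCoeff α m l) -
        fun a l => linCoeff α m' a * linCoeff α m' l) ω‖ /
        (8 * (2 * κ * Z2) * (2 * (1 + T) * W))))) ∂P := by
        refine lintegral_mono fun ω => ?_
        rw [← linPath_sub, ← biPath_sub]
        have hnorm : ‖regPath T s₁ s₂ α g N m ω - regPath T s₁ s₂ α g N m' ω‖ =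
          max ‖linPath T s₁ g N (linCoeff α m) ω - linPath T s₁ g N (linCoeff α m') ω‖
            ‖biPath T s₂ g N (fun a l => linCoeff α m a * linCoeff α m l) ω -
              biPath T s₂ g N (fun a l => linCoeff α m' a * linCoeff α m' l) ω‖ := rfl
        rw [hnorm]
        rcases max_choice
          ‖linPath T s₁ g N (linCoeff α m) ω - linPath T s₁ g N (linCoeff α m') ω‖
          ‖biPath T s₂ g N (fun a l => linCoeff α m a * linCoeff α m l) ω -
              biPath T s₂ g N (fun a l => linCoeff α m' a * linCoeff α m' l) ω‖ with h | h <;>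
          rw [h]
        · exact le_add_right (ENNReal.ofReal_le_ofReal (Real.exp_le_exp.mpr (by gcongr)))
        · exact le_add_left (ENNReal.ofReal_le_ofReal (Real.exp_le_exp.mpr (by gcongr)))
    _ ≤ 4608 + 4608 := by
        rw [lintegral_add_left hm1]
        exact add_le_add hlin hbi
    _ = 9216 := by norm_num

end Moments

/-! ### Completeness -/

namespace SobolevInfty

variable {s : ℝ}

lemma bessel_surjective : Function.Surjective (bessel (s := s)) := by
  intro h
  have H : IsBesselPotential s (fun n => (((japanese n ^ s : ℝ) : ℂ))⁻¹ *
      fourierCoeff (h : Torus → ℂ) n) h := fun n => by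
    have : ((japanese n ^ s : ℝ) : ℂ) ≠ 0 :=
      Complex.ofReal_ne_zero.mpr (Real.rpow_pos_of_pos (japanese_pos n) s).ne'
    rw [mul_inv_cancel_left₀ this]
  exact ⟨mk _ h H, (bessel_spec (mk _ h H)).unique H⟩

/-- `bessel` is an isometry onto `L^∞`. -/
instance instCompleteSpace : CompleteSpace (SobolevInfty s) := by
  have hiso : Isometry (bessel (s := s)) :=
    AddMonoidHomClass.isometry_of_norm (bessel (s := s)) fun u => (norm_def u).symm
  rw [completeSpace_iff_isComplete_range hiso.isUniformInducing, bessel_surjective.range_eq]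
  exact isComplete_univ

end SobolevInfty

/-! ### Consequences of exponential moments -/

section ExpMoments

variable {Ω : Type*} [MeasurableSpace Ω] {P : Measure Ω} {E : Type*} [NormedAddCommGroup E]

lemma lintegral_enorm_pow_le {D : Ω → E} {K : ℝ} (hK : 0 < K) {M₀ : ℝ≥0∞}
    (h : ∫⁻ ω, ENNReal.ofReal (Real.exp (‖D ω‖ / K)) ∂P ≤ M₀) (n : ℕ) :
    ∫⁻ ω, ‖D ω‖ₑ ^ n ∂P ≤ ENNReal.ofReal (K ^ n * n.factorial) * M₀ := by
  calc ∫⁻ ω, ‖D ω‖ₑ ^ n ∂P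
      ≤ ∫⁻ ω, ENNReal.ofReal (K ^ n * n.factorial) * ENNReal.ofReal (Real.exp (‖D ω‖ / K)) ∂P := by
        refine lintegral_mono fun ω => ?_
        rw [← ENNReal.ofReal_mul (by positivity), ← ofReal_norm,
          ← ENNReal.ofReal_pow (norm_nonneg _)]
        apply ENNReal.ofReal_le_ofReal
        have h1 := Real.pow_div_factorial_le_exp (x := ‖D ω‖ / K) (by positivity) n
        rw [div_le_iff₀ (by positivity), div_pow, div_le_iff₀ (by positivity)] at h1
        linarith
    _ = ENNReal.ofReal (K ^ n * n.factorial) * ∫⁻ ω, ENNReal.ofReal (Real.exp (‖D ω‖ / K)) ∂P :=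
        lintegral_const_mul' _ _ ENNReal.ofReal_ne_top
    _ ≤ _ := by gcongr

lemma eLpNorm_le_of_exp [IsProbabilityMeasure P] {D : Ω → E} (hD : AEStronglyMeasurable D P)
    {K : ℝ} (hK : 0 < K) {M₀ : ℝ≥0∞}
    (h : ∫⁻ ω, ENNReal.ofReal (Real.exp (‖D ω‖ / K)) ∂P ≤ M₀) {q : ℝ≥0∞} {n : ℕ} (hn : n ≠ 0)
    (hqn : q ≤ n) :
    eLpNorm D q P ≤ ENNReal.ofReal K * (ENNReal.ofReal n.factorial * M₀) ^ (1 / (n : ℝ)) := by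
  have hn0 : (0 : ℝ) < n := by exact_mod_cast Nat.pos_of_ne_zero hn
  refine (eLpNorm_le_eLpNorm_of_exponent_le hqn hD).trans ?_
  rw [eLpNorm_eq_lintegral_rpow_enorm_toReal (by exact_mod_cast hn) (by simp)]
  simp only [ENNReal.toReal_natCast, ENNReal.rpow_natCast]
  have := lintegral_enorm_pow_le hK h n
  calc (∫⁻ ω, ‖D ω‖ₑ ^ n ∂P) ^ (1 / (n : ℝ))
      ≤ (ENNReal.ofReal (K ^ n * n.factorial) * M₀) ^ (1 / (n : ℝ)) := by gcongr
    _ = _ := by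
        rw [ENNReal.ofReal_mul (by positivity), mul_assoc,
          ENNReal.mul_rpow_of_nonneg _ _ (by positivity),
          ENNReal.ofReal_pow hK.le, ← ENNReal.rpow_natCast, ← ENNReal.rpow_mul,
          mul_one_div_cancel hn0.ne', ENNReal.rpow_one]

lemma memLp_of_exp [IsProbabilityMeasure P] {D : Ω → E} (hD : AEStronglyMeasurable D P)
    {K : ℝ} (hK : 0 < K) {M₀ : ℝ≥0∞} (hM₀ : M₀ ≠ ∞)
    (h : ∫⁻ ω, ENNReal.ofReal (Real.exp (‖D ω‖ / K)) ∂P ≤ M₀) {q : ℝ≥0∞} (hq : q ≠ ∞) :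
    MemLp D q P := by
  obtain ⟨n, hn⟩ := ENNReal.exists_nat_gt hq
  have hn0 : n ≠ 0 := by rintro rfl; simp at hn
  refine ⟨hD, (eLpNorm_le_of_exp hD hK h hn0 hn.le).trans_lt ?_⟩
  refine ENNReal.mul_lt_top ENNReal.ofReal_lt_top (ENNReal.rpow_lt_top_of_nonneg (by positivity) ?_)
  exact ENNReal.mul_ne_top ENNReal.ofReal_ne_top hM₀

lemma tendsto_eLpNorm_of_exp [IsProbabilityMeasure P] {D : ℕ → Ω → E}
    (hD : ∀ k, AEStronglyMeasurable (D k) P) {K : ℕ → ℝ} (hK : ∀ k, 0 < K k)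
    (hK0 : Tendsto K atTop (𝓝 0)) {M₀ : ℝ≥0∞} (hM₀ : M₀ ≠ ∞)
    (h : ∀ k, ∫⁻ ω, ENNReal.ofReal (Real.exp (‖D k ω‖ / K k)) ∂P ≤ M₀) {q : ℝ≥0∞} (hq : q ≠ ∞) :
    Tendsto (fun k => eLpNorm (D k) q P) atTop (𝓝 0) := by
  obtain ⟨n, hn⟩ := ENNReal.exists_nat_gt hq
  have hn0 : n ≠ 0 := by rintro rfl; simp at hn
  refine tendsto_of_tendsto_of_tendsto_of_le_of_le tendsto_const_nhds ?_ (fun _ => zero_le)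
    fun k => eLpNorm_le_of_exp (hD k) (hK k) (h k) hn0 hn.le
  have h1 : Tendsto (fun k => ENNReal.ofReal (K k)) atTop (𝓝 0) := by
    simpa using ENNReal.tendsto_ofReal hK0
  have h2 : (ENNReal.ofReal n.factorial * M₀) ^ (1 / (n : ℝ)) ≠ ∞ :=
    (ENNReal.rpow_lt_top_of_nonneg (by positivity)
      (ENNReal.mul_ne_top ENNReal.ofReal_ne_top hM₀)).ne
  simpa using ENNReal.Tendsto.mul_const h1 (Or.inr h2)

/-- Borel–Cantelli for polynomially decaying exponential moments. -/
lemma ae_tendsto_zero_of_exp {D : ℕ → Ω → E} (hD : ∀ k, AEStronglyMeasurable (D k) P) {K θ : ℝ}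
    (hK : 0 < K) (hθ : 0 < θ) {M₀ : ℝ≥0∞} (hM₀ : M₀ ≠ ∞)
    (h : ∀ k, ∫⁻ ω, ENNReal.ofReal (Real.exp (‖D k ω‖ / (K * ((k : ℝ) + 1) ^ (-θ)))) ∂P ≤ M₀) :
    ∀ᵐ ω ∂P, Tendsto (fun k => D k ω) atTop (𝓝 0) := by
  -- A moment so high that `(k + 1)^{-θn}` is bounded by the summable `(k + 1)^{-2}`, however small
  -- `θ` is.
  obtain ⟨n, hn⟩ := exists_nat_gt (2 / θ)
  have hn0 : (0 : ℝ) < n := lt_trans (by positivity) hn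
  have hn0' : n ≠ 0 := by exact_mod_cast hn0.ne'
  rw [div_lt_iff₀ hθ] at hn
  have hbound : ∀ k, ∫⁻ ω, ‖D k ω‖ₑ ^ n ∂P ≤
      ENNReal.ofReal ((K ^ n * n.factorial) * (1 / ((k : ℝ) + 1) ^ 2)) * M₀ := by
    intro k
    have hk : (0 : ℝ) < (k : ℝ) + 1 := by positivity
    refine (lintegral_enorm_pow_le (by positivity) (h k) n).trans
      (mul_le_mul_left (ENNReal.ofReal_le_ofReal ?_) _)
    rw [mul_pow, mul_right_comm]
    gcongr
    rw [← Real.rpow_natCast, ← Real.rpow_mul hk.le, one_div, ← Real.rpow_natCast ((k : ℝ) + 1) 2,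
      ← Real.rpow_neg hk.le]
    exact Real.rpow_le_rpow_of_exponent_le (by linarith [(Nat.cast_nonneg k : (0 : ℝ) ≤ k)])
      (by push_cast; linarith)
  have hsum : ∑' k, ∫⁻ ω, ‖D k ω‖ₑ ^ n ∂P ≠ ∞ := by
    refine ne_top_of_le_ne_top ?_ (ENNReal.tsum_le_tsum hbound)
    rw [ENNReal.tsum_mul_right]
    refine ENNReal.mul_ne_top ?_ hM₀
    have hs : Summable fun k : ℕ => (K ^ n * n.factorial) * (1 / ((k : ℝ) + 1) ^ 2) := by
      have := (summable_nat_add_iff 1).mpr (Real.summable_one_div_nat_pow.mpr (one_lt_two))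
      simpa using this.mul_left (K ^ n * (n.factorial : ℝ))
    rw [← ENNReal.ofReal_tsum_of_nonneg (fun k => by positivity) hs]
    exact ENNReal.ofReal_ne_top
  rw [← lintegral_tsum fun k => ((hD k).enorm.pow_const n)] at hsum
  have hae := ae_lt_top' (AEMeasurable.tsum fun k => ((hD k).enorm.pow_const n)) hsum
  filter_upwards [hae] with ω hω
  have h1 := ENNReal.tendsto_atTop_zero_of_tsum_ne_top hω.ne
  rw [tendsto_zero_iff_norm_tendsto_zero]
  have h2 : Tendsto (fun k => ‖D k ω‖ ^ n) atTop (𝓝 0) := by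
    have := (ENNReal.tendsto_toReal ENNReal.zero_ne_top).comp h1
    simpa [Function.comp_def] using this
  have h3 := h2.rpow_const (p := 1 / (n : ℝ)) (Or.inr (by positivity))
  rw [Real.zero_rpow (by positivity)] at h3
  refine h3.congr fun k => ?_
  rw [← Real.rpow_natCast, ← Real.rpow_mul (norm_nonneg _), mul_one_div_cancel hn0.ne',
    Real.rpow_one]

/-- Fatou's lemma. -/
lemma lintegral_exp_le_of_ae_tendsto {D : ℕ → Ω → E} {D' : Ω → E}
    (hD : ∀ k, AEStronglyMeasurable (D k) P)
    (hlim : ∀ᵐ ω ∂P, Tendsto (fun k => D k ω) atTop (𝓝 (D' ω))) {K : ℝ} {M₀ : ℝ≥0∞}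
    (h : ∀ᶠ k in atTop, ∫⁻ ω, ENNReal.ofReal (Real.exp (‖D k ω‖ / K)) ∂P ≤ M₀) :
    ∫⁻ ω, ENNReal.ofReal (Real.exp (‖D' ω‖ / K)) ∂P ≤ M₀ := by
  have e : ∀ᵐ ω ∂P, ENNReal.ofReal (Real.exp (‖D' ω‖ / K)) =
      liminf (fun k => ENNReal.ofReal (Real.exp (‖D k ω‖ / K))) atTop := by
    filter_upwards [hlim] with ω hω
    refine (Tendsto.liminf_eq ?_).symm
    exact ENNReal.tendsto_ofReal ((Real.continuous_exp.tendsto _).comp (hω.norm.div_const K))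
  rw [lintegral_congr_ae e]
  refine (lintegral_liminf_le' fun k => ?_).trans ?_
  · have := (hD k).norm.aemeasurable
    fun_prop
  · exact liminf_le_of_frequently_le' h.frequently

/-- The rate `(M + 1)^{-θ}` need not be summable, so consecutive differences cannot simply be added.
A limit is first found in `L¹`; an almost surely convergent subsequence and Fatou transfer the rate
to the distance from the limit, and Borel–Cantelli with high moments gives convergence of the whole
sequence. -/
lemma ae_exists_tendsto_of_exp [IsProbabilityMeasure P] [CompleteSpace E] {f : ℕ → Ω → E}
    (hf : ∀ k, AEStronglyMeasurable (f k) P) {K θ : ℝ} (hK : 0 < K) (hθ : 0 < θ) {M₀ : ℝ≥0∞}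
    (hM₀ : M₀ ≠ ∞) (h0 : ∀ k, ∫⁻ ω, ENNReal.ofReal (Real.exp (‖f k ω‖ / K)) ∂P ≤ M₀)
    (h : ∀ M N, M ≤ N → ∫⁻ ω, ENNReal.ofReal
      (Real.exp (‖f N ω - f M ω‖ / (K * ((M : ℝ) + 1) ^ (-θ)))) ∂P ≤ M₀) :
    ∀ᵐ ω ∂P, ∃ x, Tendsto (fun k => f k ω) atTop (𝓝 x) := by
  have hmem : ∀ k, MemLp (f k) 1 P := fun k => memLp_of_exp (hf k) hK hM₀ (h0 k) (by simp)
  set F : ℕ → Lp E 1 P := fun k => (hmem k).toLp (f k) with hF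
  set A : ℝ := (ENNReal.ofReal (Nat.factorial 1) * M₀).toReal with hA
  have hA' : ENNReal.ofReal (Nat.factorial 1) * M₀ ≠ ∞ :=
    ENNReal.mul_ne_top ENNReal.ofReal_ne_top hM₀
  have hpow0 : Tendsto (fun k : ℕ => ((k : ℝ) + 1) ^ (-θ)) atTop (𝓝 0) :=
    (tendsto_rpow_neg_atTop hθ).comp (tendsto_natCast_atTop_atTop.atTop_add tendsto_const_nhds)
  have hcau : CauchySeq F := by
    refine cauchySeq_of_le_tendsto_0' (fun k : ℕ => K * ((k : ℝ) + 1) ^ (-θ) * A)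
      (fun M N hMN => ?_)
      (by simpa using (hpow0.const_mul K).mul_const A)
    have hpos : 0 < K * ((M : ℝ) + 1) ^ (-θ) := by positivity
    have := eLpNorm_le_of_exp ((hf N).sub (hf M)) hpos (h M N hMN) (q := 1) one_ne_zero (by simp)
    rw [dist_comm, dist_eq_norm, hF, ← MemLp.toLp_sub, Lp.norm_toLp]
    refine (ENNReal.toReal_mono (ENNReal.mul_ne_top ENNReal.ofReal_ne_top (by simpa using hM₀))
      this).trans (le_of_eq ?_)
    rw [ENNReal.toReal_mul, ENNReal.toReal_ofReal hpos.le]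
    simp [hA]
  obtain ⟨L, hL⟩ := cauchySeq_tendsto_of_complete hcau
  have htm : TendstoInMeasure P f atTop L := by
    have := tendstoInMeasure_of_tendsto_Lp hL
    exact this.congr (fun k => (hmem k).coeFn_toLp) (by rfl)
  obtain ⟨ns, hns, hlim⟩ := htm.exists_seq_tendsto_ae
  have hdiff : ∀ M, ∫⁻ ω, ENNReal.ofReal
      (Real.exp (‖(L : Ω → E) ω - f M ω‖ / (K * ((M : ℝ) + 1) ^ (-θ)))) ∂P ≤ M₀ := by
    intro M
    refine lintegral_exp_le_of_ae_tendsto (D := fun i ω => f (ns i) ω - f M ω)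
      (fun i => (hf _).sub (hf M)) ?_ ?_
    · filter_upwards [hlim] with ω hω
      exact hω.sub_const _
    · filter_upwards [hns.tendsto_atTop.eventually_ge_atTop M] with i hi
      exact h M _ hi
  have := ae_tendsto_zero_of_exp (D := fun M ω => (L : Ω → E) ω - f M ω)
    (fun M => (Lp.aestronglyMeasurable L).sub (hf M)) hK hθ hM₀ hdiff
  filter_upwards [this] with ω hω
  refine ⟨L ω, ?_⟩
  have h2 := (tendsto_const_nhds (x := (L : Ω → E) ω)).sub hω
  simpa using h2

end ExpMoments

/-! ### Identification of the limit -/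

lemma CW.tendsto_coeff {T s : ℝ} {F : ℕ → CW T s} {G : CW T s} (h : Tendsto F atTop (𝓝 G))
    (t : Set.Icc (0 : ℝ) T) (n : ℤ) :
    Tendsto (fun N => (F N t).coeff n) atTop (𝓝 ((G t).coeff n)) := by
  have h1 : Tendsto (fun N => F N t) atTop (𝓝 (G t)) :=
    ((continuous_eval_const t).tendsto G).comp h
  rw [tendsto_iff_norm_sub_tendsto_zero] at h1 ⊢
  have h2 := h1.const_mul (japanese n ^ s)⁻¹
  rw [mul_zero] at h2
  exact squeeze_zero (fun _ => norm_nonneg _)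
    (fun N => SobolevInfty.norm_coeff_le (F N t - G t) n) h2

/-- For sequences vanishing at infinity, restricting both frequencies of a convolution to
`|a|, |n - a| ≤ N` or just one of them makes no difference in the limit. -/
lemma tendsto_sum_conv_sub {z : ℤ → ℂ} (hz : Tendsto z cofinite (𝓝 0)) (n : ℤ) :
    Tendsto (fun N : ℕ => ∑ a ∈ Finset.Icc (-(N : ℤ)) N, z a * z (n - a) -
      ∑ a ∈ Finset.Icc (-(N : ℤ)) N,
        if n - a ∈ Finset.Icc (-(N : ℤ)) N then z a * z (n - a) else 0) atTop (𝓝 0) := by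
  obtain ⟨B, hB⟩ := hz.norm.bddAbove_range_of_cofinite
  have hB' : ∀ a, ‖z a‖ ≤ B := fun a => hB ⟨a, rfl⟩
  have hB0 : 0 ≤ B := (norm_nonneg _).trans (hB' 0)
  rw [Metric.tendsto_atTop]
  intro ε hε
  -- The two sums differ only in indices `a` within `|n|` of `±N`. There are at most `2 (|n| + 1)`
  -- of them, and in each such term `|n - a| > N`, so one factor is small.
  set c : ℝ := ((2 * (|n| + 1) : ℤ) : ℝ) with hc
  have hc0 : 0 < c := by rw [hc]; exact_mod_cast (by positivity : 0 < 2 * (|n| + 1))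
  set ε' := ε / (c * (B + 1)) with hε'
  have hε0 : 0 < ε' := by positivity
  have hfin : {a : ℤ | ¬ ‖z a‖ < ε'}.Finite := by
    have := Metric.tendsto_nhds.mp hz ε' hε0
    simp only [dist_zero_right] at this
    exact eventually_cofinite.mp this
  obtain ⟨M, hM⟩ : ∃ M : ℕ, ∀ a : ℤ, M < a.natAbs → ‖z a‖ < ε' := by
    refine ⟨hfin.toFinset.sup Int.natAbs, fun a ha => ?_⟩
    by_contra hcon
    exact ha.not_ge (Finset.le_sup (f := Int.natAbs) (by simpa using hcon))
  refine ⟨M, fun N hN => ?_⟩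
  rw [dist_zero_right, ← Finset.sum_sub_distrib]
  have hterm : ∀ a ∈ Finset.Icc (-(N : ℤ)) N,
      ‖z a * z (n - a) - (if n - a ∈ Finset.Icc (-(N : ℤ)) N then z a * z (n - a) else 0)‖ ≤
        if n - a ∉ Finset.Icc (-(N : ℤ)) N then B * ε' else 0 := by
    intro a _
    by_cases h : n - a ∈ Finset.Icc (-(N : ℤ)) N
    · simp [h]
    · rw [if_neg h, if_pos h, sub_zero, norm_mul]
      refine mul_le_mul (hB' a) (hM _ ?_).le (norm_nonneg _) hB0
      rw [Finset.mem_Icc] at h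
      omega
  refine (norm_sum_le_of_le _ hterm).trans_lt ?_
  rw [← Finset.sum_filter, Finset.sum_const, nsmul_eq_mul]
  have hcard : (((Finset.Icc (-(N : ℤ)) N).filter
      fun a => n - a ∉ Finset.Icc (-(N : ℤ)) N).card : ℝ) ≤ c := by
    have hsub : ((Finset.Icc (-(N : ℤ)) N).filter fun a => n - a ∉ Finset.Icc (-(N : ℤ)) N) ⊆
        Finset.Icc (-(N : ℤ)) (-N + |n|) ∪ Finset.Icc (N - |n|) (N : ℤ) := by
      intro a ha
      simp only [Finset.mem_filter, Finset.mem_Icc, Finset.mem_union] at ha ⊢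
      rcases abs_cases n with h | h <;> omega
    have h1 := (Finset.card_le_card hsub).trans (Finset.card_union_le _ _)
    rw [Int.card_Icc, Int.card_Icc] at h1
    have h0 := abs_nonneg n
    rw [hc]
    exact_mod_cast (by omega : (((Finset.Icc (-(N : ℤ)) N).filter
      fun a => n - a ∉ Finset.Icc (-(N : ℤ)) N).card : ℤ) ≤ 2 * (|n| + 1))
  calc _ ≤ c * (B * ε') := by gcongr
    _ < c * ((B + 1) * ε') := by gcongr; linarith
    _ = ε := by rw [hε']; field_simp

lemma hasSum_symmetricIcc_conv {z : ℤ → ℂ} (hz : Tendsto z cofinite (𝓝 0)) {n : ℤ} {x : ℂ}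
    (hx : Tendsto (fun N : ℕ => ∑ a ∈ Finset.Icc (-(N : ℤ)) N,
        if n - a ∈ Finset.Icc (-(N : ℤ)) N then z a * z (n - a) else 0) atTop (𝓝 x)) :
    HasSum (fun a => z a * z (n - a)) x (SummationFilter.symmetricIcc ℤ) := by
  rw [SummationFilter.hasSum_symmetricIcc_iff]
  simpa using (tendsto_sum_conv_sub hz n).add hx

section Identification

variable {Ω : Type*} {g : ℤ → Ω → ℂ}

lemma regLinSol_apply (α : ℝ) (m : ℤ → ℂ) (ω : Ω) (t : ℝ) (n : ℤ) :
    regLinSol α g m ω t n = linCoeff α m n * g n ω * phase (phi n) t := by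
  rw [regLinSol, propagator, phase_apply, linCoeff, initialData, Real.rpow_neg (japanese_pos n).le]
  push_cast
  ring

lemma linSol_eq_regLinSol (α : ℝ) (ω : Ω) : linSol α g ω = regLinSol α g 1 ω := by
  simp [linSol, regLinSol]

lemma coeff_regPath_fst {T s₁ s₂ α : ℝ} (m : ℤ → ℂ) (ω : Ω) (t : Set.Icc (0 : ℝ) T)
    {N : ℕ} {n : ℤ} (hn : n ∈ Finset.Icc (-(N : ℤ)) N) :
    ((regPath T s₁ s₂ α g N m ω).1 t).coeff n = regLinSol α g m ω t n := by
  rw [regPath, coeff_linPath, if_pos hn, regLinSol_apply]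

lemma coeff_regPath_snd {T s₁ s₂ α : ℝ} (m : ℤ → ℂ) (ω : Ω) (t : Set.Icc (0 : ℝ) T)
    (N : ℕ) (n : ℤ) :
    ((regPath T s₁ s₂ α g N m ω).2 t).coeff n = (phi n : ℂ) *
      ∑ a ∈ Finset.Icc (-(N : ℤ)) N, if n - a ∈ Finset.Icc (-(N : ℤ)) N then
        regLinSol α g m ω t a * regLinSol α g m ω t (n - a) else 0 := by
  rw [regPath, coeff_biPath, Finset.sum_product, Finset.mul_sum]
  refine Finset.sum_congr rfl fun a _ => ?_
  have : ∀ l, n = a + l ↔ n - a = l := fun l => by omega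
  simp only [this, Finset.sum_ite_eq]
  split_ifs
  · rw [add_sub_cancel, phase_add, regLinSol_apply, regLinSol_apply]
    ring
  · rw [mul_zero]

lemma enhanced_eq_of_isPath {T s₁ s₂ : ℝ} {u : ℝ → ℤ → ℂ} {F : CW T s₁ × CW T s₂}
    (h₁ : IsPath T s₁ u F.1) (h₂ : IsPath T s₂ (fun t => nonlin (u t)) F.2) :
    enhanced T s₁ s₂ u = F := by
  have key : ∀ {s : ℝ} {v : ℝ → ℤ → ℂ} {G : CW T s}, IsPath T s v G → toCW T s v = G := by
    intro s v G h
    refine ContinuousMap.ext fun t => SobolevInfty.coeff_injective (funext fun n => ?_)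
    rw [isPath_toCW ⟨G, h⟩ t n, h t n]
  exact Prod.ext (key h₁) (key h₂)

/-- The argument is deterministic. Norm convergence gives convergence of each coefficient of the
truncated nonlinearity, a sum with both frequencies cut off. Decay of the data converts it into the
symmetric sum defining `nonlin`; dividing by `φ(n) ≠ 0` is allowed for `n ≠ 0`, and at `n = 0` both
sides vanish. -/
lemma enhancedMem_of_tendsto {T s₁ s₂ α : ℝ} {m : ℤ → ℂ} {ω : Ω} {F : CW T s₁ × CW T s₂}
    (hm : ∀ n, ‖m n‖ ≤ 1) (hω : Tendsto (fun n => initialData α g ω n) cofinite (𝓝 0))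
    (hF : Tendsto (fun N => regPath T s₁ s₂ α g N m ω) atTop (𝓝 F)) :
    EnhancedMem T s₁ s₂ (regLinSol α g m ω) ∧ enhanced T s₁ s₂ (regLinSol α g m ω) = F := by
  have hz : ∀ t, Tendsto (regLinSol α g m ω t) cofinite (𝓝 0) := by
    intro t
    refine squeeze_zero_norm (fun n => ?_) (tendsto_zero_iff_norm_tendsto_zero.mp hω)
    rw [regLinSol, propagator, ← phase_apply, norm_mul, norm_phase, one_mul, norm_mul]
    exact mul_le_of_le_one_right (norm_nonneg _) (hm n)
  have h₁ : IsPath T s₁ (regLinSol α g m ω) F.1 := by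
    intro t n
    refine tendsto_nhds_unique (CW.tendsto_coeff ((continuous_fst.tendsto F).comp hF) t n)
      (tendsto_const_nhds.congr' ?_)
    filter_upwards [eventually_ge_atTop n.natAbs] with N hN
    exact (coeff_regPath_fst m ω t (by rw [Finset.mem_Icc]; omega)).symm
  have hsnd : ∀ (t : Set.Icc (0 : ℝ) T) (n : ℤ), Tendsto (fun N : ℕ =>
      (phi n : ℂ) * ∑ a ∈ Finset.Icc (-(N : ℤ)) N,
      if n - a ∈ Finset.Icc (-(N : ℤ)) N then
        regLinSol α g m ω t a * regLinSol α g m ω t (n - a) else 0) atTop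
      (𝓝 ((F.2 t).coeff n)) := fun t n => by
    simpa only [Function.comp_apply, coeff_regPath_snd] using
      CW.tendsto_coeff ((continuous_snd.tendsto F).comp hF) t n
  have hsum : ∀ (t : Set.Icc (0 : ℝ) T) (n : ℤ), n ≠ 0 → HasSum
      (fun a => regLinSol α g m ω t a * regLinSol α g m ω t (n - a))
      ((phi n : ℂ)⁻¹ * (F.2 t).coeff n) (SummationFilter.symmetricIcc ℤ) := by
    intro t n hn
    have hphi : (phi n : ℂ) ≠ 0 := by
      rw [Complex.ofReal_ne_zero, phi]
      have : (n : ℝ) ≠ 0 := by exact_mod_cast hn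
      positivity
    refine hasSum_symmetricIcc_conv (hz t) ?_
    simpa only [inv_mul_cancel_left₀ hphi] using (hsnd t n).const_mul (phi n : ℂ)⁻¹
  have h₂ : IsPath T s₂ (fun t => nonlin (regLinSol α g m ω t)) F.2 := by
    intro t n
    change (F.2 t).coeff n = nonlin (regLinSol α g m ω t) n
    rw [nonlin]
    split_ifs with hn
    · subst hn
      have := hsnd t 0
      rw [phi_zero] at this
      simp only [Complex.ofReal_zero, zero_mul] at this
      exact tendsto_nhds_unique this tendsto_const_nhds
    · have hphi : (phi n : ℂ) ≠ 0 := by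
        rw [Complex.ofReal_ne_zero, phi]
        have : (n : ℝ) ≠ 0 := by exact_mod_cast hn
        positivity
      rw [(hsum t n hn).tsum_eq, mul_inv_cancel_left₀ hphi]
  exact ⟨⟨fun t ht n hn => (hsum ⟨t, ht⟩ n hn).summable, ⟨_, h₁⟩, ⟨_, h₂⟩⟩,
    enhanced_eq_of_isPath h₁ h₂⟩

end Identification

/-! ### Decay of the random data -/

section Decay

variable {Ω : Type*} [MeasurableSpace Ω] {P : Measure Ω} {g : ℤ → Ω → ℂ}

lemma IsGaussianSequence.lintegral_exp_norm_le (hg : IsGaussianSequence P g) (n : ℤ) :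
    ∫⁻ ω, ENNReal.ofReal (Real.exp (‖g n ω‖ / 8)) ∂P ≤ 16 := by
  have hn : n ∈ Finset.Icc (-(n.natAbs : ℤ)) n.natAbs := by rw [Finset.mem_Icc]; omega
  have h := hg.lintegral_exp_chaos_one_le n.natAbs (Pi.single n 1) (A := 1) one_pos (by
    rw [Finset.sum_eq_single_of_mem n hn fun k _ hk => by simp [hk]]
    simp)
  have e : ∀ ω, ∑ k ∈ Finset.Icc (-(n.natAbs : ℤ)) n.natAbs, (Pi.single n 1 : ℤ → ℂ) k * g k ω =
      g n ω := fun ω => by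
    rw [Finset.sum_eq_single_of_mem n hn fun k _ hk => by simp [hk]]
    simp
  simpa only [e, mul_one] using h

/-- The eighth moments are of order `⟨n⟩^{-8α}`, summable since `8α > 2`, so almost surely the
eighth powers are summable. -/
lemma IsGaussianSequence.ae_tendsto_initialData (hg : IsGaussianSequence P g) {α : ℝ}
    (hα : 1 / 4 < α) : ∀ᵐ ω ∂P, Tendsto (fun n => initialData α g ω n) cofinite (𝓝 0) := by
  have hmeas : ∀ n, Measurable fun ω => initialData α g ω n := fun n =>
    (hg.measurable n).div_const _
  have hb : ∀ n : ℤ, ∫⁻ ω, ‖initialData α g ω n‖ₑ ^ 8 ∂P ≤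
      ENNReal.ofReal (japanese n ^ (-8 * α)) *
        (ENNReal.ofReal (8 ^ 8 * (Nat.factorial 8)) * 16) := by
    intro n
    have hn := japanese_pos n
    have e : ∀ ω, ‖initialData α g ω n‖ₑ ^ 8 =
        ENNReal.ofReal (japanese n ^ (-8 * α)) * ‖g n ω‖ₑ ^ 8 := by
      intro ω
      rw [← ofReal_norm, ← ofReal_norm, ← ENNReal.ofReal_pow (norm_nonneg _),
        ← ENNReal.ofReal_pow (norm_nonneg _), ← ENNReal.ofReal_mul (by positivity), initialData,
        norm_div, Complex.norm_real, Real.norm_eq_abs, abs_of_pos (Real.rpow_pos_of_pos hn _),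
        div_pow, ← Real.rpow_mul_natCast hn.le, div_eq_inv_mul, ← Real.rpow_neg hn.le]
      congr 3
      push_cast; ring
    simp only [e]
    rw [lintegral_const_mul' _ _ ENNReal.ofReal_ne_top]
    gcongr
    exact lintegral_enorm_pow_le (by norm_num) (hg.lintegral_exp_norm_le n) 8
  have hsum : ∑' n : ℤ, ∫⁻ ω, ‖initialData α g ω n‖ₑ ^ 8 ∂P ≠ ∞ := by
    refine ne_top_of_le_ne_top ?_ (ENNReal.tsum_le_tsum hb)
    rw [ENNReal.tsum_mul_right]
    refine ENNReal.mul_ne_top ?_ (ENNReal.mul_ne_top ENNReal.ofReal_ne_top (by norm_num))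
    rw [← ENNReal.ofReal_tsum_of_nonneg (fun n => Real.rpow_nonneg (japanese_pos n).le _)
      (summable_japanese_rpow (by linarith))]
    exact ENNReal.ofReal_ne_top
  have hm8 : ∀ n : ℤ, Measurable fun ω => ‖initialData α g ω n‖ₑ ^ 8 := fun n =>
    (hmeas n).enorm.pow_const 8
  rw [← lintegral_tsum fun n => (hm8 n).aemeasurable] at hsum
  filter_upwards [ae_lt_top (Measurable.tsum hm8) hsum] with ω hω
  have h1 := ENNReal.tendsto_cofinite_zero_of_tsum_ne_top hω.ne
  rw [tendsto_zero_iff_norm_tendsto_zero]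
  have h2 : Tendsto (fun n => ‖initialData α g ω n‖ ^ 8) cofinite (𝓝 0) := by
    have := (ENNReal.tendsto_toReal ENNReal.zero_ne_top).comp h1
    simpa [Function.comp_def] using this
  have h3 := h2.rpow_const (p := 1 / (8 : ℕ)) (Or.inr (by positivity))
  rw [Real.zero_rpow (by norm_num)] at h3
  refine h3.congr fun n => ?_
  rw [← Real.rpow_natCast, ← Real.rpow_mul (norm_nonneg _)]
  norm_num

end Decay

/-! ### Regularisations -/

namespace IsMollifier

variable {ρ : ℝ → ℝ}

lemma integrable (hρ : IsMollifier ρ) : Integrable ρ := by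
  by_contra h
  have := hρ.integral_eq_one
  rw [integral_undef h] at this
  exact zero_ne_one this

lemma mollifierSymbol_eq (ρ : ℝ → ℝ) {k : ℕ} (hk : k ≠ 0) (n : ℤ) :
    mollifierSymbol ρ k n = ∫ y : ℝ, (ρ y : ℂ) *
      Complex.exp (Complex.I * ((-(n * (y / k)) : ℝ) : ℂ)) := by
  have hk' : (k : ℝ) ≠ 0 := by exact_mod_cast hk
  have h := Measure.integral_comp_mul_left (fun y : ℝ => ((k : ℝ) : ℂ) * ((ρ y : ℂ) *
      Complex.exp (Complex.I * ((-(n * (y / k)) : ℝ) : ℂ)))) (k : ℝ)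
  rw [integral_const_mul, integral_const_mul, Complex.real_smul, abs_of_nonneg (by positivity),
    Complex.ofReal_inv, inv_mul_cancel_left₀ (Complex.ofReal_ne_zero.mpr hk')] at h
  rw [← h, mollifierSymbol, ← integral_const_mul]
  refine integral_congr_ae (Eventually.of_forall fun y => ?_)
  simp only [mul_div_cancel_left₀ y hk']
  push_cast
  ring_nf

lemma norm_mollifierSymbol_le (hρ : IsMollifier ρ) (k : ℕ) (n : ℤ) :
    ‖mollifierSymbol ρ k n‖ ≤ 1 := by
  rcases eq_or_ne k 0 with rfl | hk
  · simp [mollifierSymbol]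
  · rw [mollifierSymbol_eq ρ hk, ← hρ.integral_eq_one]
    refine norm_integral_le_of_norm_le hρ.integrable (Eventually.of_forall fun y => ?_)
    rw [norm_mul, Complex.norm_exp_I_mul_ofReal, mul_one, Complex.norm_real, Real.norm_eq_abs,
      abs_of_nonneg (hρ.nonneg y)]

/-- As `ρ` has mass one and lives in `|y| ≤ π`, the symbol is an average of phases within `π ⟨n⟩ /
k` of `1`. -/
lemma norm_mollifierSymbol_sub_one_le (hρ : IsMollifier ρ) (k : ℕ) (n : ℤ) :
    ‖mollifierSymbol ρ k n - 1‖ ≤ 2 * Real.pi * (japanese n / (k + 1)) := by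
  have hpi := Real.pi_gt_three
  have hn := one_le_japanese n
  -- At `k = 0` the kernel `ρ_k` and its symbol are zero, and the bound holds since `2π ≥ 1`. For `k
  -- ≥ 1` the factor `2` comes from `k ≥ (k + 1)/2`.
  rcases eq_or_ne k 0 with rfl | hk
  · simp only [mollifierSymbol, CharP.cast_eq_zero, zero_mul, Complex.ofReal_zero, integral_zero,
      zero_sub, norm_neg, norm_one, zero_add, div_one]
    nlinarith
  · have hk' : (1 : ℝ) ≤ k := by exact_mod_cast Nat.one_le_iff_ne_zero.mpr hk
    have hρc : Integrable fun y : ℝ => (ρ y : ℂ) := hρ.integrable.ofReal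
    have hint : Integrable fun y : ℝ => (ρ y : ℂ) *
        Complex.exp (Complex.I * ((-(n * (y / k)) : ℝ) : ℂ)) := by
      refine hρc.mul_bdd (c := 1) ?_ ?_
      · exact Continuous.aestronglyMeasurable (by fun_prop)
      · exact Eventually.of_forall fun y => (Complex.norm_exp_I_mul_ofReal _).le
    have h1 : (1 : ℂ) = ∫ y, (ρ y : ℂ) := by
      rw [integral_complex_ofReal, hρ.integral_eq_one, Complex.ofReal_one]
    rw [mollifierSymbol_eq ρ hk, h1, ← integral_sub hint hρc]
    have hb : ∀ y, ‖(ρ y : ℂ) * Complex.exp (Complex.I * ((-(n * (y / k)) : ℝ) : ℂ)) - ρ y‖ ≤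
        ρ y * (2 * Real.pi * (japanese n / (k + 1))) := by
      intro y
      rw [← mul_sub_one, norm_mul, Complex.norm_real, Real.norm_eq_abs, abs_of_nonneg (hρ.nonneg y)]
      rcases eq_or_ne (ρ y) 0 with h0 | h0
      · simp [h0]
      · have hy := hρ.support_subset h0
        have hyabs : |y| ≤ Real.pi := abs_le.mpr ⟨hy.1.le, hy.2⟩
        refine mul_le_mul_of_nonneg_left (Real.norm_exp_I_mul_ofReal_sub_one_le.trans ?_)
          (hρ.nonneg y)
        rw [Real.norm_eq_abs, abs_neg, abs_mul, abs_div, abs_of_pos (by linarith : (0 : ℝ) < k)]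
        calc |(n : ℝ)| * (|y| / k) ≤ japanese n * (Real.pi / ((k + 1) / 2)) := by
              have := abs_le_japanese n
              gcongr
              linarith
          _ = _ := by field_simp
    refine (norm_integral_le_of_norm_le (hρ.integrable.mul_const _)
      (Eventually.of_forall hb)).trans (le_of_eq ?_)
    rw [integral_mul_const, hρ.integral_eq_one, one_mul]

end IsMollifier

lemma norm_dirichletSymbol_le (N : ℕ) (n : ℤ) : ‖dirichletSymbol N n‖ ≤ 1 := by
  rw [dirichletSymbol]
  split_ifs <;> simp

lemma norm_dirichletSymbol_sub_one_le (N : ℕ) (n : ℤ) :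
    ‖dirichletSymbol N n - 1‖ ≤ 2 * Real.pi * (japanese n / (N + 1)) := by
  have hn := japanese_pos n
  have hpi := Real.pi_gt_three
  rw [dirichletSymbol]
  split_ifs with h
  · rw [sub_self, norm_zero]
    positivity
  · have h1 : (N : ℝ) + 1 ≤ |(n : ℝ)| := by exact_mod_cast (by omega : (N : ℤ) + 1 ≤ |n|)
    have h2 : 1 ≤ japanese n / (N + 1) := by
      rw [one_le_div (by positivity)]
      exact h1.trans (abs_le_japanese n)
    rw [zero_sub, norm_neg, norm_one]
    nlinarith

lemma IsRegularisation.norm_le {m : ℕ → ℤ → ℂ} (hm : IsRegularisation m) (k : ℕ) (n : ℤ) :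
    ‖m k n‖ ≤ 1 := by
  obtain ⟨ρ, hρ, rfl⟩ | rfl := hm
  · exact hρ.norm_mollifierSymbol_le k n
  · exact norm_dirichletSymbol_le k n

/-- Interpolation between the Lipschitz bound, used where `⟨n⟩ ≤ k + 1`, and the trivial bound `2`
elsewhere. -/
lemma IsRegularisation.norm_sub_one_le {m : ℕ → ℤ → ℂ} (hm : IsRegularisation m) {θ : ℝ}
    (hθ : 0 < θ) (hθ1 : θ ≤ 1) (k : ℕ) (n : ℤ) :
    ‖m k n - 1‖ ≤ 2 * Real.pi * ((k : ℝ) + 1) ^ (-θ) * japanese n ^ θ := by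
  have hn := japanese_pos n
  have hk : (0 : ℝ) < (k : ℝ) + 1 := by positivity
  have hpi := Real.pi_gt_three
  have h1 : ‖m k n - 1‖ ≤ 2 * Real.pi * (japanese n / (k + 1)) := by
    obtain ⟨ρ, hρ, rfl⟩ | rfl := hm
    · exact hρ.norm_mollifierSymbol_sub_one_le k n
    · exact norm_dirichletSymbol_sub_one_le k n
  have h2 : ‖m k n - 1‖ ≤ 2 := by
    have := norm_sub_le (m k n) 1
    rw [norm_one] at this
    linarith [hm.norm_le k n]
  rw [mul_assoc, Real.rpow_neg hk.le, inv_mul_eq_div, ← Real.div_rpow hn.le hk.le]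
  rcases le_total (japanese n / (k + 1)) 1 with h | h
  · refine h1.trans ?_
    gcongr
    exact Real.self_le_rpow_of_le_one (by positivity) h hθ1
  · have := Real.one_le_rpow h hθ.le
    nlinarith

/-! ### The random enhanced data -/

lemma enhanced_regLinSol_zero {Ω : Type*} (g : ℤ → Ω → ℂ) (T s₁ s₂ α : ℝ) (ω : Ω) :
    enhanced T s₁ s₂ (regLinSol α g 0 ω) = 0 := by
  have h : ∀ t n, regLinSol α g 0 ω t n = 0 := fun t n => by
    simp [regLinSol_apply, linCoeff]
  refine enhanced_eq_of_isPath (fun t n => (h t n).symm) fun t n => ?_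
  change 0 = nonlin (regLinSol α g 0 ω t) n
  simp [nonlin, h]

section Enhanced

variable {Ω : Type*} [MeasurableSpace Ω] {P : Measure Ω} {g : ℤ → Ω → ℂ}

/-- Removal of the truncation. For each bounded multiplier the truncated paths converge almost
surely, and their limit is the enhanced data; measurability passes to the limit, and the difference
estimate follows by Fatou because it is uniform in `N`. -/
lemma exists_lintegral_exp_enhanced_le [IsProbabilityMeasure P] (hg : IsGaussianSequence P g)
    {α s₁ s₂ : ℝ} (hα : 1 / 4 < α) (hα' : α ≤ 1 / 2) (hs₁ : s₁ < α - 1 / 2) (hs₂ : s₂ < 2 * α) :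
    ∃ θ C : ℝ, 0 < θ ∧ θ ≤ 1 ∧ 0 < C ∧ ∀ T : ℝ, 0 < T →
      (∀ m : ℤ → ℂ, (∀ n, ‖m n‖ ≤ 1) →
        (∀ᵐ ω ∂P, EnhancedMem T s₁ s₂ (regLinSol α g m ω)) ∧
        AEStronglyMeasurable (fun ω => enhanced T s₁ s₂ (regLinSol α g m ω)) P) ∧
      ∀ κ : ℝ, 0 < κ → ∀ m m' : ℤ → ℂ, (∀ n, ‖m n‖ ≤ 1) → (∀ n, ‖m' n‖ ≤ 1) →
        (∀ n, ‖m n - m' n‖ ≤ κ * japanese n ^ θ) →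
        ∫⁻ ω, ENNReal.ofReal (Real.exp (‖enhanced T s₁ s₂ (regLinSol α g m ω) -
          enhanced T s₁ s₂ (regLinSol α g m' ω)‖ / (C * (1 + T) * κ))) ∂P ≤ 9216 := by
  obtain ⟨θ, C, hθ, hθ1, hC, H⟩ := lintegral_exp_regPath_sub_le hg hα hα' hs₁ hs₂
  refine ⟨θ, C, hθ, hθ1, hC, fun T hT => ?_⟩
  have hmeas : ∀ (m : ℤ → ℂ) (N : ℕ),
      AEStronglyMeasurable (fun ω => regPath T s₁ s₂ α g N m ω) P := fun m N =>
    (stronglyMeasurable_regPath hg T s₁ s₂ α N m).aestronglyMeasurable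
  have hlim : ∀ m : ℤ → ℂ, (∀ n, ‖m n‖ ≤ 1) → ∀ᵐ ω ∂P,
      EnhancedMem T s₁ s₂ (regLinSol α g m ω) ∧ Tendsto (fun N => regPath T s₁ s₂ α g N m ω) atTop
        (𝓝 (enhanced T s₁ s₂ (regLinSol α g m ω))) := by
    intro m hm
    have hK : 0 < C * (1 + T) := by positivity
    have hex := ae_exists_tendsto_of_exp (f := fun N ω => regPath T s₁ s₂ α g N m ω)
      (hmeas m) hK hθ (M₀ := 9216) (by norm_num)
      -- Comparison with the zero multiplier and `κ = 1` bounds the paths themselves.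
      (fun N => by
        have := H T hT 1 one_pos N m 0 hm (by simp) fun n => by
          rw [Pi.zero_apply, sub_zero, one_mul]
          exact (hm n).trans (Real.one_le_rpow (one_le_japanese n) hθ.le)
        simpa only [regPath_zero, sub_zero, mul_one] using this)
      (fun M N hMN => by
        have := H T hT (((M : ℝ) + 1) ^ (-θ)) (by positivity) N m (truncSymbol M m) hm
          (norm_truncSymbol_le hm M) (norm_sub_truncSymbol_le hm M hθ)
        simpa only [regPath_truncSymbol T s₁ s₂ α g hMN] using this)
    filter_upwards [hex, hg.ae_tendsto_initialData hα] with ω ⟨F, hF⟩ hω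
    obtain ⟨h1, h2⟩ := enhancedMem_of_tendsto hm hω hF
    exact ⟨h1, h2 ▸ hF⟩
  refine ⟨fun m hm => ⟨(hlim m hm).mono fun ω h => h.1,
    aestronglyMeasurable_of_tendsto_ae atTop (hmeas m) ((hlim m hm).mono fun ω h => h.2)⟩,
    fun κ hκ m m' hm hm' hmm => ?_⟩
  refine lintegral_exp_le_of_ae_tendsto
    (D := fun N ω => regPath T s₁ s₂ α g N m ω - regPath T s₁ s₂ α g N m' ω)
    (fun N => (hmeas m N).sub (hmeas m' N)) ?_
    (Eventually.of_forall fun N => H T hT κ hκ N m m' hm hm' hmm)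
  filter_upwards [hlim m hm, hlim m' hm'] with ω h h'
  exact h.2.sub h'.2

lemma measureReal_lt_le_of_exp [IsProbabilityMeasure P] {E : Type*} [NormedAddCommGroup E]
    {D : Ω → E} (hD : AEStronglyMeasurable D P) {K : ℝ} {M₀ : ℝ} (hM₀ : 0 ≤ M₀)
    (h : ∫⁻ ω, ENNReal.ofReal (Real.exp (‖D ω‖ / K)) ∂P ≤ ENNReal.ofReal M₀) (hK : 0 < K) (r : ℝ) :
    P.real {ω | r < ‖D ω‖} ≤ M₀ * Real.exp (-(r / K)) := by
  have hsub : {ω | r < ‖D ω‖} ⊆ {ω | ENNReal.ofReal (Real.exp (r / K)) ≤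
      ENNReal.ofReal (Real.exp (‖D ω‖ / K))} := fun ω hω => by
    have : r < ‖D ω‖ := hω
    exact ENNReal.ofReal_le_ofReal (Real.exp_le_exp.mpr (by gcongr))
  have hm : AEMeasurable (fun ω => ENNReal.ofReal (Real.exp (‖D ω‖ / K))) P := by
    have := hD.norm.aemeasurable
    fun_prop
  have h1 := (measure_mono hsub).trans (meas_ge_le_lintegral_div hm
    (by simp [Real.exp_pos]) ENNReal.ofReal_ne_top)
  refine ENNReal.toReal_le_of_le_ofReal (by positivity) (h1.trans ?_)
  rw [Real.exp_neg, ← div_eq_mul_inv, ENNReal.ofReal_div_of_pos (Real.exp_pos _)]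
  gcongr

/-- `1 + T ≤ 2 max(1, T)`: the first exponential is needed for large `T`, the second for small `T`,
and either one suffices in its range. -/
lemma exp_neg_div_one_add_le {C T r : ℝ} (hC : 0 < C) (hT : 0 < T) (hr : 0 < r) :
    Real.exp (-(r / 2 / (C * (1 + T)))) ≤
      Real.exp (-(1 / (4 * C) * r / T)) + Real.exp (-(1 / (4 * C) * r)) := by
  rcases le_total T 1 with h | h
  · refine le_add_of_nonneg_of_le (Real.exp_pos _).le (Real.exp_le_exp.mpr (neg_le_neg ?_))
    rw [one_div_mul_eq_div, div_div, div_le_div_iff_of_pos_left hr (by positivity) (by positivity)]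
    nlinarith
  · refine le_add_of_le_of_nonneg (Real.exp_le_exp.mpr (neg_le_neg ?_)) (Real.exp_pos _).le
    rw [one_div_mul_eq_div, div_div, div_div,
      div_le_div_iff_of_pos_left hr (by positivity) (by positivity)]
    nlinarith

end Enhanced

end BBM

end

theorem proposition2p2 {Ω : Type*} [MeasurableSpace Ω] (P : Measure Ω) [IsProbabilityMeasure P]
    (g : ℤ → Ω → ℂ) (hg : BBM.IsGaussianSequence P g)
    (α s₁ s₂ : ℝ) (hα : 1 / 4 < α) (hα' : α ≤ 1 / 2) (hs₁ : s₁ < α - 1 / 2) (hs₂ : s₂ < 2 * α) :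
    (∀ T : ℝ, 0 < T →
      (∀ᵐ ω ∂P, BBM.EnhancedMem T s₁ s₂ (BBM.linSol α g ω)) ∧
      (∀ q : ℝ≥0∞, 1 ≤ q → q ≠ ∞ →
        MemLp (fun ω => BBM.enhanced T s₁ s₂ (BBM.linSol α g ω)) q P) ∧
      (∀ m : ℕ → ℤ → ℂ, BBM.IsRegularisation m →
        (∀ᵐ ω ∂P, ∀ k : ℕ, BBM.EnhancedMem T s₁ s₂ (BBM.regLinSol α g (m k) ω)) ∧
        (∀ q : ℝ≥0∞, 1 ≤ q → q ≠ ∞ →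
          (∀ k : ℕ, MemLp (fun ω => BBM.enhanced T s₁ s₂ (BBM.regLinSol α g (m k) ω)) q P) ∧
          Tendsto (fun k : ℕ => eLpNorm (fun ω =>
              BBM.enhanced T s₁ s₂ (BBM.regLinSol α g (m k) ω) -
                BBM.enhanced T s₁ s₂ (BBM.linSol α g ω)) q P)
            atTop (𝓝 0)) ∧
        (∀ᵐ ω ∂P, Tendsto
          (fun k : ℕ => BBM.enhanced T s₁ s₂ (BBM.regLinSol α g (m k) ω)) atTop
          (𝓝 (BBM.enhanced T s₁ s₂ (BBM.linSol α g ω)))))) ∧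
    (∃ C C' c : ℝ, 0 < C ∧ 0 < C' ∧ 0 < c ∧ ∀ T : ℝ, 0 < T → ∀ r : ℝ, 0 < r →
      P.real {ω | r < ‖BBM.toCW T s₁ (BBM.linSol α g ω)‖ +
          ‖BBM.toCW T s₂ (fun t => BBM.nonlin (BBM.linSol α g ω t))‖} ≤
        C' * (Real.exp (-(C * r / T ^ c)) + Real.exp (-(C * r)))) := by
  obtain ⟨θ, C, hθ, hθ1, hC, H⟩ :=
    BBM.exists_lintegral_exp_enhanced_le (P := P) hg hα hα' hs₁ hs₂
  simp only [BBM.linSol_eq_regLinSol]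
  have hone : ∀ n : ℤ, ‖(1 : ℤ → ℂ) n‖ ≤ 1 := fun n => by simp
  have hexp : ∀ T : ℝ, 0 < T → ∀ m : ℤ → ℂ, (∀ n, ‖m n‖ ≤ 1) →
      ∫⁻ ω, ENNReal.ofReal (Real.exp (‖BBM.enhanced T s₁ s₂ (BBM.regLinSol α g m ω)‖ /
        (C * (1 + T)))) ∂P ≤ 9216 := by
    intro T hT m hm
    have := (H T hT).2 1 one_pos m 0 hm (by simp) fun n => by
      rw [Pi.zero_apply, sub_zero, one_mul]
      exact (hm n).trans (Real.one_le_rpow (BBM.one_le_japanese n) hθ.le)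
    simpa only [BBM.enhanced_regLinSol_zero, sub_zero, mul_one] using this
  -- The exponential moment at scale `C (1 + T)` gives `c = 1`. The `4` combines passing from the
  -- sum of the two norms to their maximum with `1 + T ≤ 2 max(1, T)`.
  refine ⟨fun T hT => ?_, 1 / (4 * C), 9216, 1, by positivity, by norm_num, one_pos,
    fun T hT r hr => ?_⟩
  · have hK : 0 < C * (1 + T) := by positivity
    have hLp : ∀ m : ℤ → ℂ, (∀ n, ‖m n‖ ≤ 1) → ∀ q : ℝ≥0∞, q ≠ ∞ →
        MemLp (fun ω => BBM.enhanced T s₁ s₂ (BBM.regLinSol α g m ω)) q P := fun m hm q hq =>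
      BBM.memLp_of_exp ((H T hT).1 m hm).2 hK (by norm_num) (hexp T hT m hm) hq
    refine ⟨((H T hT).1 1 hone).1, fun q _ hq => hLp 1 hone q hq, fun m hm => ?_⟩
    have hmeas := fun k => (((H T hT).1 (m k) (hm.norm_le k)).2.sub ((H T hT).1 1 hone).2)
    have hK' : 0 < C * (1 + T) * (2 * Real.pi) := mul_pos hK Real.two_pi_pos
    have hdiff : ∀ k : ℕ, ∫⁻ ω, ENNReal.ofReal (Real.exp (‖BBM.enhanced T s₁ s₂
        (BBM.regLinSol α g (m k) ω) - BBM.enhanced T s₁ s₂ (BBM.regLinSol α g 1 ω)‖ /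
          (C * (1 + T) * (2 * Real.pi) * ((k : ℝ) + 1) ^ (-θ)))) ∂P ≤ 9216 := by
      intro k
      have := (H T hT).2 (2 * Real.pi * ((k : ℝ) + 1) ^ (-θ)) (by positivity) (m k) 1
        (hm.norm_le k) hone (hm.norm_sub_one_le hθ hθ1 k)
      simpa only [← mul_assoc] using this
    refine ⟨ae_all_iff.mpr fun k => ((H T hT).1 (m k) (hm.norm_le k)).1,
      fun q _ hq => ⟨fun k => hLp (m k) (hm.norm_le k) q hq, ?_⟩, ?_⟩
    · refine BBM.tendsto_eLpNorm_of_exp hmeas (fun k => by positivity) ?_ (by norm_num) hdiff hq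
      simpa using ((tendsto_rpow_neg_atTop hθ).comp
        (tendsto_natCast_atTop_atTop.atTop_add (tendsto_const_nhds (x := (1 : ℝ))))).const_mul
          (C * (1 + T) * (2 * Real.pi))
    · filter_upwards [BBM.ae_tendsto_zero_of_exp hmeas hK' hθ (by norm_num) hdiff] with ω hω
      exact tendsto_sub_nhds_zero_iff.mp hω
  · have hK : 0 < C * (1 + T) := by positivity
    have htail := BBM.measureReal_lt_le_of_exp (M₀ := 9216) ((H T hT).1 1 hone).2 (by norm_num)
      (by simpa using hexp T hT 1 hone) hK (r / 2)
    rw [Real.rpow_one]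
    refine (measureReal_mono fun ω (hω : r < _) => ?_).trans (htail.trans
      (mul_le_mul_of_nonneg_left (BBM.exp_neg_div_one_add_le hC hT hr) (by norm_num)))
    have h1 := norm_fst_le (BBM.enhanced T s₁ s₂ (BBM.regLinSol α g 1 ω))
    have h2 := norm_snd_le (BBM.enhanced T s₁ s₂ (BBM.regLinSol α g 1 ω))
    change r / 2 < _
    rw [BBM.enhanced] at h1 h2 ⊢
    linarith
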